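/- Let $M$ be a closed (compact, without boundary) smooth manifold of dimension $n\ge 3$ with a smooth Riemannian metric $g$. Let $R_g$ be its scalar curvature, $dv_g$ its Riemannian measure, $c_n=\frac{n-2}{4(n-1)}$, and let $L_g=-\Delta_g+c_nR_g$ be the conformal Laplacian, where $\Delta_g$ is the Laplace–Beltrami operator (a nonpositive operator). Let $\lambda_1(L_g)$ be the smallest element of the (discrete) spectrum of $L_g$. The conformal class $[g]$ consists of the metrics $\mu^{4/(n-2)}g$ with $\mu$ a smooth positive function on $M$. Put $$Y(M,[g])=\inf_{0\ne u\in W^{1,2}(M,g)}\frac{\int_M u\,L_gu\,dv_g}{\left(\int_M|u|^{\frac{2n}{n-2}}\,dv_g\right)^{\frac{n-2}{n}}},$$ and, for $\tilde g=\mu^{4/(n-2)}g\in[g]$, $$F_g^1(\tilde g)=\lambda_1(L_{\tilde g})\int_M\mu^{\frac4{n-2}}\,dv_g,\qquad \Lambda_1(M,g)=\sup_{\tilde g\in[g]}F_g^1(\tilde g).$$ Suppose that $Y(M,[g])<0$ and that $R_g<0$ everywhere on $M$. Then the metric $$g_{\max}=\mu_{\max}^{\frac4{n-2}}g=\left(\frac{R_g}{\int_MR_g\,dv_g}\right)g$$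 belongs to $[g]$ and solves the maximization problem for $\Lambda_1(M,g)$: $F_g^1(\tilde g)\le F_g^1(g_{\max})=\Lambda_1(M,g)$ for every $\tilde g\in[g]$. Moreover $\Lambda_1(M,g)=c_n\int_MR_g\,dv_g$, and in particular $\Lambda_1(M,g)<0$. -/

import Mathlib

open scoped Manifold ContDiff Topology

noncomputable section

namespace ConfLap

/-- The model space `ℝⁿ` with its Euclidean structure. -/
abbrev Eu (n : ℕ) : Type := EuclideanSpace ℝ (Fin n)

/-- The `i`-th partial derivative of a real function on `ℝⁿ`. -/
def partialD {n : ℕ} (i : Fin n) (f : Eu n → ℝ) (y : Eu n) : ℝ :=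
  fderiv ℝ f y (EuclideanSpace.single i 1)

section Geometry

variable {n : ℕ} {M : Type*} [TopologicalSpace M] [ChartedSpace (Eu n) M]

section Metric

variable [IsManifold (𝓡 n) ∞ M]

variable (n M) in
/-- A smooth Riemannian metric on the smooth `n`-manifold `M` (without boundary). -/
abbrev Metric : Type _ :=
  Bundle.ContMDiffRiemannianMetric (𝓡 n) ∞ (Eu n) (TangentSpace (𝓡 n) : M → Type _)

/-- The `i`-th coordinate vector field of the preferred chart at `p`, at the point `x` of the
domain of this chart. -/
def coordVec (p : M) (i : Fin n) (x : M) : TangentSpace (𝓡 n) x :=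
  (trivializationAt (Eu n) (TangentSpace (𝓡 n) : M → Type _) p).symmL ℝ x
    (EuclideanSpace.single i 1)

/-- The matrix `g_{ij}` of the metric in the preferred chart at `p`, as a function on the
target of this chart. -/
def gMat (g : Metric n M) (p : M) (y : Eu n) : Matrix (Fin n) (Fin n) ℝ :=
  Matrix.of fun i j =>
    g.inner ((extChartAt (𝓡 n) p).symm y)
      (coordVec p i ((extChartAt (𝓡 n) p).symm y))
      (coordVec p j ((extChartAt (𝓡 n) p).symm y))

/-- The inverse matrix `g^{ij}`. -/
def gInv (g : Metric n M) (p : M) (y : Eu n) : Matrix (Fin n) (Fin n) ℝ :=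
  (gMat g p y)⁻¹

/-- The Riemannian density `√(det g_{ij})`. -/
def density (g : Metric n M) (p : M) (y : Eu n) : ℝ :=
  Real.sqrt (gMat g p y).det

/-- The Christoffel symbols `Γ^k_{ij}` in the preferred chart at `p`. -/
def christoffel (g : Metric n M) (p : M) (k i j : Fin n) (y : Eu n) : ℝ :=
  (1 / 2) * ∑ l, gInv g p y k l *
    (partialD i (fun z => gMat g p z j l) y + partialD j (fun z => gMat g p z i l) y
      - partialD l (fun z => gMat g p z i j) y)

/-- The Ricci curvature `Ric_{jk}` in the preferred chart at `p`. -/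
def ricci (g : Metric n M) (p : M) (j k : Fin n) (y : Eu n) : ℝ :=
  ∑ i, (partialD i (christoffel g p i j k) y - partialD j (christoffel g p i i k) y
    + ∑ l, (christoffel g p i i l y * christoffel g p l j k y
      - christoffel g p i j l y * christoffel g p l i k y))

/-- The scalar curvature `R_g`. Its value at `x` is computed in the preferred chart at `x`
(any other chart gives the same value). -/
def scalarCurvature (g : Metric n M) (x : M) : ℝ :=
  ∑ j, ∑ k, gInv g x (extChartAt (𝓡 n) x x) j k * ricci g x j k (extChartAt (𝓡 n) x x)

/-- The Laplace-Beltrami operator `(det g)^{-1/2} ∂_i ((det g)^{1/2} g^{ij} ∂_j u)`, a nonpositive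
operator. The value at `x` is computed in the preferred chart at `x`. -/
def laplacian (g : Metric n M) (u : M → ℝ) (x : M) : ℝ :=
  (density g x (extChartAt (𝓡 n) x x))⁻¹ *
    ∑ i, partialD i (fun y => density g x y *
      ∑ j, gInv g x y i j * partialD j (u ∘ (extChartAt (𝓡 n) x).symm) y) (extChartAt (𝓡 n) x x)

/-- The squared norm `|∇u|²_g = g^{ij} ∂_i u ∂_j u`. -/
def gradSq (g : Metric n M) (u : M → ℝ) (x : M) : ℝ :=
  ∑ i, ∑ j, gInv g x (extChartAt (𝓡 n) x x) i j *
    partialD i (u ∘ (extChartAt (𝓡 n) x).symm) (extChartAt (𝓡 n) x x) *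
    partialD j (u ∘ (extChartAt (𝓡 n) x).symm) (extChartAt (𝓡 n) x x)

/-- The constant `c_n = (n - 2) / (4 (n - 1))`. -/
def confConst (n : ℕ) : ℝ := ((n : ℝ) - 2) / (4 * ((n : ℝ) - 1))

/-- The conformal Laplacian `L_g = -Δ_g + c_n R_g`. -/
def confLaplacian (g : Metric n M) (u : M → ℝ) (x : M) : ℝ :=
  -laplacian g u x + confConst n * scalarCurvature g x * u x

/-- The Riemannian measure of the domain of the preferred chart at `p`: the measure
`√(det g) dy` on the target of the chart, transported to `M`. -/
def chartVolume [MeasurableSpace M] (g : Metric n M) (p : M) : MeasureTheory.Measure M :=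
  (((MeasureTheory.volume : MeasureTheory.Measure (Eu n)).restrict
      (extChartAt (𝓡 n) p).target).withDensity
    (fun y => ENNReal.ofReal (density g p y))).map (extChartAt (𝓡 n) p).symm

/-- The Riemannian measure `dv_g`: the smallest measure on `M` that dominates the Riemannian
measures of all chart domains. As these agree on overlaps (change of variables), it is the
measure which restricts to each of them. -/
def vol [MeasurableSpace M] (g : Metric n M) : MeasureTheory.Measure M :=
  ⨆ p : M, chartVolume g p

end Metric

variable (n M) in
/-- A smooth positive function `μ` on `M`, the factor of the conformal change
`g ↦ μ^{4/(n-2)} g`. -/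
structure ConformalFactor where
  /-- The underlying function. -/
  toFun : M → ℝ
  smooth : ContMDiff (𝓡 n) 𝓘(ℝ) ∞ toFun
  pos : ∀ x, 0 < toFun x

variable [IsManifold (𝓡 n) ∞ M]

/-- The metric `f g`, for a smooth positive function `f`. -/
def scaleMetric (g : Metric n M) (f : M → ℝ) (hf : ContMDiff (𝓡 n) 𝓘(ℝ) ∞ f)
    (hpos : ∀ x, 0 < f x) : Metric n M where
  inner x := f x • g.inner x
  symm x v w := by
    change f x * g.inner x v w = f x * g.inner x w v
    rw [g.symm x v w]
  pos x v hv := by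
    exact mul_pos (hpos x) (g.pos x v hv)
  isVonNBounded x := by
    have hs : (Real.sqrt (f x)) * (Real.sqrt (f x)) = f x := Real.mul_self_sqrt (hpos x).le
    have hs0 : Real.sqrt (f x) ≠ 0 := (Real.sqrt_pos.2 (hpos x)).ne'
    have h := (g.isVonNBounded x).image
      ((Real.sqrt (f x))⁻¹ • ContinuousLinearMap.id ℝ (TangentSpace (𝓡 n) x))
    refine h.subset ?_
    intro v hv
    refine (Set.mem_image _ _ _).2 ⟨Real.sqrt (f x) • v, ?_, ?_⟩
    · have hv' : f x * g.inner x v v < 1 := hv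
      change g.inner x (Real.sqrt (f x) • v) (Real.sqrt (f x) • v) < 1
      rw [map_smul, map_smul]
      change Real.sqrt (f x) * (Real.sqrt (f x) * g.inner x v v) < 1
      rwa [← mul_assoc, hs]
    · change (Real.sqrt (f x))⁻¹ • (Real.sqrt (f x) • v) = v
      rw [smul_smul, inv_mul_cancel₀ hs0, one_smul]
  contMDiff := ContMDiff.smul_section hf g.contMDiff

/-- The conformal metric `μ^{4/(n-2)} g`. The conformal class `[g]` consists of these metrics. -/
def conformal (g : Metric n M) (μ : ConformalFactor n M) : Metric n M :=
  scaleMetric g (fun x => μ.toFun x ^ (4 / ((n : ℝ) - 2)))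
    (by
      intro x
      have h : ContDiffAt ℝ ∞ (fun t : ℝ => t ^ (4 / ((n : ℝ) - 2))) (μ.toFun x) :=
        contDiffAt_id.rpow_const_of_ne (μ.pos x).ne'
      exact ContMDiffAt.comp x h.contMDiffAt (μ.smooth x))
    (fun x => Real.rpow_pos_of_pos (μ.pos x) _)

section Analysis

variable [MeasurableSpace M]

/-- The smooth functions `φ k` converge to `u` in `L²(M, dv_g)` and form a Cauchy sequence in the
norm `(∫ φ² + |∇φ|² dv_g)^{1/2}`. -/
structure IsW12Approx (g : Metric n M) (u : M → ℝ) (φ : ℕ → M → ℝ) : Prop where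
  memLp : MeasureTheory.MemLp u 2 (vol g)
  smooth : ∀ k, ContMDiff (𝓡 n) 𝓘(ℝ) ∞ (φ k)
  tendsto : Filter.Tendsto (fun k => MeasureTheory.eLpNorm (φ k - u) 2 (vol g))
    Filter.atTop (𝓝 0)
  cauchy : ∀ ε > 0, ∃ N, ∀ k ≥ N, ∀ l ≥ N, ∫ x, gradSq g (φ k - φ l) x ∂(vol g) < ε

/-- The Sobolev space `W^{1,2}(M, g)`: the completion of `C^∞(M)` in the norm
`(∫ φ² + |∇φ|² dv_g)^{1/2}`, realized as a space of `L²` functions. -/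
def MemW12 (g : Metric n M) (u : M → ℝ) : Prop :=
  ∃ φ : ℕ → M → ℝ, IsW12Approx g u φ

/-- `e` is the value at `u ∈ W^{1,2}(M, g)` of the quadratic form `∫ u L_g u dv_g`, extended from
`C^∞(M)` to `W^{1,2}(M, g)` by continuity. -/
def HasEnergy (g : Metric n M) (u : M → ℝ) (e : ℝ) : Prop :=
  ∃ φ : ℕ → M → ℝ, IsW12Approx g u φ ∧
    Filter.Tendsto (fun k => ∫ x, φ k x * confLaplacian g (φ k) x ∂(vol g)) Filter.atTop (𝓝 e)

/-- The Yamabe invariant `Y(M, [g])`: the infimum, over nonzero `u ∈ W^{1,2}(M, g)`, of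
`∫ u L_g u dv_g / (∫ |u|^{2n/(n-2)} dv_g)^{(n-2)/n}`. -/
def yamabeInvariant (g : Metric n M) : ℝ :=
  sInf {q : ℝ | ∃ (u : M → ℝ) (e : ℝ), ¬ (u =ᵐ[vol g] 0) ∧ HasEnergy g u e ∧
    q = e / (∫ x, |u x| ^ (2 * (n : ℝ) / ((n : ℝ) - 2)) ∂(vol g)) ^ (((n : ℝ) - 2) / (n : ℝ))}

/-- `u ∈ W^{1,2}(M, g)` is a weak solution of the equation `L_g u - lam u = f`. -/
def IsWeakSolution (g : Metric n M) (lam : ℝ) (f u : M → ℝ) : Prop :=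
  MemW12 g u ∧ ∀ v : M → ℝ, ContMDiff (𝓡 n) 𝓘(ℝ) ∞ v →
    ∫ x, u x * (confLaplacian g v x - lam * v x) ∂(vol g) = ∫ x, f x * v x ∂(vol g)

/-- The spectrum of `L_g`, as a self-adjoint operator in `L²(M, dv_g)`: `lam` is outside the
spectrum iff `L_g u - lam u = f` has exactly one weak solution `u` for each `f ∈ L²(M, dv_g)`. -/
def confSpectrum (g : Metric n M) : Set ℝ :=
  {lam : ℝ | ¬ ∀ f : M → ℝ, MeasureTheory.MemLp f 2 (vol g) →
    ∃ u : M → ℝ, IsWeakSolution g lam f u ∧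
      ∀ u' : M → ℝ, IsWeakSolution g lam f u' → u' =ᵐ[vol g] u}

/-- The first eigenvalue `λ₁(L_g)`, the bottom of the (discrete) spectrum of `L_g`. -/
def firstEigenvalue (g : Metric n M) : ℝ := sInf (confSpectrum g)

/-- The functional `F_g^1(μ^{4/(n-2)} g) = λ₁(L_{μ^{4/(n-2)} g}) ∫ μ^{4/(n-2)} dv_g` on the
conformal class `[g]`, whose elements are given by their conformal factors. -/
def functionalF (g : Metric n M) (μ : ConformalFactor n M) : ℝ :=
  firstEigenvalue (conformal g μ) * ∫ x, μ.toFun x ^ (4 / ((n : ℝ) - 2)) ∂(vol g)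

/-- `Λ₁(M, g)`, the supremum of `F_g^1` over the conformal class `[g]`. -/
def supF (g : Metric n M) : ℝ := ⨆ μ : ConformalFactor n M, functionalF g μ

end Analysis

end Geometry

end ConfLap

end

/-!
The proof compares `F_g^1` with `c_n ∫ R_g dv_g` through two test computations, both resting on the
conformal covariance `μ^{4/(n-2)} μ L_{g'} u = L_g (μ u)` of the conformal Laplacian, where
`g' = μ^{4/(n-2)} g` (`confLaplacian_conformal`). Since `dv_{g'} = μ^2 μ^{4/(n-2)} dv_g`
(`vol_conformal`), the form `∫ v L_{g'} v dv_{g'}` equals `∫ (μ v) L_g (μ v) dv_g`, whereas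
`∫ v² dv_{g'} = ∫ μ^{4/(n-2)} (μ v)² dv_g`.

*Upper bound* (`functionalF_le`). The test function `v = μ⁻¹` has energy `∫ L_g 1 = c_n ∫ R_g` and
squared norm `∫ μ^{4/(n-2)}`, so `λ₁(L_{g'}) ∫ μ^{4/(n-2)} ≤ c_n ∫ R_g` for every conformal factor.

*Equality* (`functionalF_eq`). If `μ^{4/(n-2)} = R_g / ∫ R_g`, then dropping the Dirichlet
integral gives `∫ v L_{g'} v dv_{g'} ≥ ∫ c_n R_g (μ v)² dv_g = (c_n ∫ R_g) ∫ v² dv_{g'}`, which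
bounds `λ₁` from below, and `∫ μ^{4/(n-2)} = 1`. The sign `R_g < 0` makes `R_g / ∫ R_g` positive.

Two groups of facts support this.

*Geometry.* In a chart the scalar curvature and the Laplacian are written without coordinates,
through bilinear forms and connection maps: `scal` and `lap` are metric traces of the Ricci form and of
the Hessian. They are invariant under changes of charts, because the Levi-Civita connection is
determined by the metric, and the same uniqueness gives the behaviour of connection and curvature
under conformal changes (`IsLocalMetric.conformal_covariance`). Green's formula (`green`) follows
from the divergence form of the Laplacian by a partition of unity.

*Spectral theory.* Compactness of the resolvent is not needed to locate the bottom of the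
spectrum. Below any lower bound of the quadratic form the Lax-Milgram argument solves the
equation (`exists_isFormSolution`). Conversely, if the equation were solvable for all right-hand
sides at the infimum of the Rayleigh quotient, the uniform boundedness principle would make the
shifted form coercive (`coercive_of_solvable`), which contradicts the choice of the infimum. So the
infimum belongs to the spectrum (`exists_not_solvable`).
-/

noncomputable section

namespace ConfLap

/-! ### Linear algebra of scalar products and traces -/

section LinearAlgebra

variable {n : ℕ}

/-- The bilinear form with a given Gram matrix in the standard basis. -/
def formOf (G : Matrix (Fin n) (Fin n) ℝ) : Eu n →L[ℝ] Eu n →L[ℝ] ℝ :=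
  ∑ i, ∑ j, G i j •
    (EuclideanSpace.proj i : Eu n →L[ℝ] ℝ).smulRight (EuclideanSpace.proj j : Eu n →L[ℝ] ℝ)

lemma formOf_apply (G : Matrix (Fin n) (Fin n) ℝ) (v w : Eu n) :
    formOf G v w = ∑ i, ∑ j, G i j * (v i * w j) := by
  simp [formOf]

@[simp] lemma formOf_single (G : Matrix (Fin n) (Fin n) ℝ) (i j : Fin n) :
    formOf G (EuclideanSpace.single i 1) (EuclideanSpace.single j 1) = G i j := by
  simp [formOf_apply]

/-- The bilinear map with given components `c k i j` (the `k`-th component of the value at the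
basis vectors `e_i`, `e_j`). -/
def bilMapOf (c : Fin n → Fin n → Fin n → ℝ) : Eu n →L[ℝ] Eu n →L[ℝ] Eu n :=
  ∑ k, ∑ i, ∑ j, c k i j • (EuclideanSpace.proj i : Eu n →L[ℝ] ℝ).smulRight
    ((EuclideanSpace.proj j : Eu n →L[ℝ] ℝ).smulRight (EuclideanSpace.single k (1 : ℝ) : Eu n))

lemma bilMapOf_apply (c : Fin n → Fin n → Fin n → ℝ) (v w : Eu n) (k : Fin n) :
    bilMapOf c v w k = ∑ i, ∑ j, c k i j * (v i * w j) := by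
  simp [bilMapOf, Pi.single_apply]

@[simp] lemma bilMapOf_single (c : Fin n → Fin n → Fin n → ℝ) (i j k : Fin n) :
    bilMapOf c (EuclideanSpace.single i 1) (EuclideanSpace.single j 1) k = c k i j := by
  simp [bilMapOf_apply]

/-- The Gram matrix of a bilinear form in the standard basis. -/
def gram (b : Eu n →L[ℝ] Eu n →L[ℝ] ℝ) : Matrix (Fin n) (Fin n) ℝ :=
  Matrix.of fun i j => b (EuclideanSpace.single i 1) (EuclideanSpace.single j 1)

@[simp] lemma gram_formOf (G : Matrix (Fin n) (Fin n) ℝ) : gram (formOf G) = G := by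
  ext i j; simp [gram]

/-- `b` is symmetric and positive definite. -/
structure IsScalarProduct (b : Eu n →L[ℝ] Eu n →L[ℝ] ℝ) : Prop where
  symm : ∀ v w, b v w = b w v
  pos : ∀ v, v ≠ 0 → 0 < b v v

/-- The trace of a bilinear form `h` with respect to the scalar product `b`, `b^{jk} h_{jk}`. -/
def metricTrace (b : Eu n →L[ℝ] Eu n →L[ℝ] ℝ) (h : Eu n → Eu n → ℝ) : ℝ :=
  ∑ j, ∑ k, (gram b)⁻¹ j k * h (EuclideanSpace.single j 1) (EuclideanSpace.single k 1)

lemma sum_single (v : Eu n) : v = ∑ i, v i • (EuclideanSpace.single i (1 : ℝ) : Eu n) := by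
  ext k
  simp [Pi.single_apply]

lemma IsScalarProduct.eq_of_forall {b : Eu n →L[ℝ] Eu n →L[ℝ] ℝ} (hb : IsScalarProduct b)
    {v v' : Eu n} (h : ∀ w, b v w = b v' w) : v = v' := by
  by_contra hne
  have h1 := hb.pos (v - v') (sub_ne_zero.2 hne)
  have h2 := h (v - v')
  have h3 : b (v - v') (v - v') = b v (v - v') - b v' (v - v') := by
    rw [map_sub b]; rfl
  linarith

lemma form_apply_eq (b : Eu n →L[ℝ] Eu n →L[ℝ] ℝ) (v w : Eu n) :
    b v w = ∑ i, ∑ j, gram b i j * (v i * w j) := by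
  conv_lhs => rw [sum_single v, sum_single w]
  simp only [map_sum, map_smul, sum_apply, smul_apply, smul_eq_mul, gram, Matrix.of_apply,
    Finset.mul_sum]
  rw [Finset.sum_comm]
  refine Finset.sum_congr rfl fun i _ => Finset.sum_congr rfl fun j _ => by ring

lemma IsScalarProduct.posDef {b : Eu n →L[ℝ] Eu n →L[ℝ] ℝ} (hb : IsScalarProduct b) :
    (gram b).PosDef := by
  refine Matrix.PosDef.of_dotProduct_mulVec_pos ?_ ?_
  · ext i j
    simp [gram, hb.symm (EuclideanSpace.single j 1)]
  · intro x hx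
    have h := hb.pos (WithLp.toLp 2 x) (by simpa using hx)
    rw [form_apply_eq] at h
    simp only [star_trivial, dotProduct, Matrix.mulVec, Finset.mul_sum]
    refine h.trans_eq (Finset.sum_congr rfl fun i _ => Finset.sum_congr rfl fun j _ => ?_)
    ring

lemma isScalarProduct_formOf {G : Matrix (Fin n) (Fin n) ℝ} (hG : G.PosDef) :
    IsScalarProduct (formOf G) := by
  have hs : ∀ i j, G i j = G j i := fun i j => by
    have := congrFun (congrFun hG.isHermitian i) j
    simpa using this.symm
  constructor
  · intro v w
    rw [formOf_apply, formOf_apply, Finset.sum_comm]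
    refine Finset.sum_congr rfl fun i _ => Finset.sum_congr rfl fun j _ => ?_
    rw [hs]; ring
  · intro v hv
    have h := hG.dotProduct_mulVec_pos (x := v.ofLp) (by simpa using hv)
    rw [formOf_apply]
    simp only [star_trivial, dotProduct, Matrix.mulVec, Finset.mul_sum] at h
    refine h.trans_eq (Finset.sum_congr rfl fun i _ => Finset.sum_congr rfl fun j _ => ?_)
    ring

lemma IsScalarProduct.det_pos {b : Eu n →L[ℝ] Eu n →L[ℝ] ℝ} (hb : IsScalarProduct b) :
    0 < (gram b).det := hb.posDef.det_pos

lemma trace_eq_sum (S : Eu n →ₗ[ℝ] Eu n) :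
    LinearMap.trace ℝ (Eu n) S = ∑ i, S (EuclideanSpace.single i 1) i := by
  rw [LinearMap.trace_eq_matrix_trace ℝ (EuclideanSpace.basisFun (Fin n) ℝ).toBasis]
  simp [Matrix.trace, LinearMap.toMatrix_apply]

/-- The metric trace of `h` is the trace of the operator which represents `h`. This frees all later
trace computations from the inverse Gram matrix. -/
lemma IsScalarProduct.metricTrace_eq {b : Eu n →L[ℝ] Eu n →L[ℝ] ℝ} (hb : IsScalarProduct b)
    {h : Eu n → Eu n → ℝ} (S : Eu n →ₗ[ℝ] Eu n) (hS : ∀ v w, b (S v) w = h v w) :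
    metricTrace b h = LinearMap.trace ℝ (Eu n) S := by
  rw [trace_eq_sum, metricTrace]
  refine Finset.sum_congr rfl fun j _ => ?_
  have h1 : ∀ k, h (EuclideanSpace.single j 1) (EuclideanSpace.single k 1) =
      ∑ l, gram b k l * S (EuclideanSpace.single j 1) l := by
    intro k
    rw [← hS, form_apply_eq, Finset.sum_comm]
    simp only [PiLp.single_apply, mul_ite, mul_one, mul_zero]
    rw [Finset.sum_comm]
    simp [gram, hb.symm (EuclideanSpace.single k 1)]
  have h2 : (gram b)⁻¹ * gram b = 1 := Matrix.nonsing_inv_mul _ hb.det_pos.ne'.isUnit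
  simp only [h1, Finset.mul_sum]
  rw [Finset.sum_comm]
  simp only [← mul_assoc, ← Finset.sum_mul]
  have h3 : ∀ l, ∑ k, (gram b)⁻¹ j k * gram b k l = (1 : Matrix (Fin n) (Fin n) ℝ) j l := by
    intro l; rw [← h2, Matrix.mul_apply]
  simp [h3, Matrix.one_apply]

/-- A scalar product as an isomorphism onto the dual space. -/
def IsScalarProduct.flat {b : Eu n →L[ℝ] Eu n →L[ℝ] ℝ} (hb : IsScalarProduct b) :
    Eu n ≃L[ℝ] (Eu n →L[ℝ] ℝ) :=
  (LinearEquiv.ofInjectiveOfFinrankEq (b : Eu n →ₗ[ℝ] (Eu n →L[ℝ] ℝ))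
    (fun v v' h => hb.eq_of_forall fun w => by
      have := DFunLike.congr_fun h w
      exact this)
    (by
      rw [← (LinearMap.toContinuousLinearMap (E := Eu n) (F' := ℝ) (𝕜 := ℝ)).finrank_eq,
        Subspace.dual_finrank_eq])).toContinuousLinearEquiv

@[simp] lemma IsScalarProduct.coe_flat {b : Eu n →L[ℝ] Eu n →L[ℝ] ℝ} (hb : IsScalarProduct b) :
    (hb.flat : Eu n →L[ℝ] (Eu n →L[ℝ] ℝ)) = b := by
  ext v w; rfl

/-- The vector which represents a linear form with respect to `b`. It is `0` when `b` is not
invertible; it is used for scalar products only. -/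
def sharp (b : Eu n →L[ℝ] Eu n →L[ℝ] ℝ) (a : Eu n →L[ℝ] ℝ) : Eu n :=
  ContinuousLinearMap.inverse b a

lemma IsScalarProduct.apply_sharp {b : Eu n →L[ℝ] Eu n →L[ℝ] ℝ} (hb : IsScalarProduct b)
    (a : Eu n →L[ℝ] ℝ) (v : Eu n) : b (sharp b a) v = a v := by
  have h : sharp b a = hb.flat.symm a := by
    rw [sharp]
    conv_lhs => rw [← hb.coe_flat, ContinuousLinearMap.inverse_equiv]
    rfl
  have h2 : hb.flat (hb.flat.symm a) v = a v := by simp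
  rw [h]
  exact h2

lemma IsScalarProduct.sharp_apply {b : Eu n →L[ℝ] Eu n →L[ℝ] ℝ} (hb : IsScalarProduct b)
    (a : Eu n →L[ℝ] ℝ) (i : Fin n) :
    sharp b a i = ∑ j, (gram b)⁻¹ i j * a (EuclideanSpace.single j 1) := by
  have h1 : ∀ k, a (EuclideanSpace.single k 1) = ∑ l, gram b k l * sharp b a l := by
    intro k
    rw [← hb.apply_sharp, form_apply_eq, Finset.sum_comm]
    simp only [PiLp.single_apply, mul_ite, mul_one, mul_zero]
    rw [Finset.sum_comm]
    simp [gram, hb.symm (EuclideanSpace.single k 1)]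
  have h2 : (gram b)⁻¹ * gram b = 1 := Matrix.nonsing_inv_mul _ hb.det_pos.ne'.isUnit
  have h3 : ∀ l, ∑ k, (gram b)⁻¹ i k * gram b k l = (1 : Matrix (Fin n) (Fin n) ℝ) i l := by
    intro l; rw [← h2, Matrix.mul_apply]
  simp only [h1, Finset.mul_sum]
  rw [Finset.sum_comm]
  simp only [← mul_assoc, ← Finset.sum_mul, h3]
  simp [Matrix.one_apply]

lemma IsScalarProduct.exists_op {b : Eu n →L[ℝ] Eu n →L[ℝ] ℝ} (hb : IsScalarProduct b)
    (h : Eu n →ₗ[ℝ] Eu n →ₗ[ℝ] ℝ) : ∃ S : Eu n →ₗ[ℝ] Eu n, ∀ v w, b (S v) w = h v w := by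
  refine ⟨(hb.flat.symm.toLinearEquiv : (Eu n →L[ℝ] ℝ) →ₗ[ℝ] Eu n) ∘ₗ
    ((LinearMap.toContinuousLinearMap (E := Eu n) (F' := ℝ) (𝕜 := ℝ) :
      (Eu n →ₗ[ℝ] ℝ) →ₗ[ℝ] (Eu n →L[ℝ] ℝ)) ∘ₗ h), fun v w => ?_⟩
  change hb.flat (hb.flat.symm (LinearMap.toContinuousLinearMap (h v))) w = h v w
  simp

/-- A metric trace is invariant under linear isomorphisms. -/
lemma IsScalarProduct.metricTrace_pullback {b b' : Eu n →L[ℝ] Eu n →L[ℝ] ℝ}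
    (hb : IsScalarProduct b) (hb' : IsScalarProduct b') (A : Eu n ≃L[ℝ] Eu n)
    (hA : ∀ v w, b' v w = b (A v) (A w)) (h : Eu n →ₗ[ℝ] Eu n →ₗ[ℝ] ℝ) {h' : Eu n → Eu n → ℝ}
    (hh : ∀ v w, h' v w = h (A v) (A w)) :
    metricTrace b' h' = metricTrace b (fun v w => h v w) := by
  obtain ⟨S, hS⟩ := hb.exists_op h
  rw [hb.metricTrace_eq S hS, hb'.metricTrace_eq (A.symm.toLinearEquiv.conj S),
    LinearMap.trace_conj']
  intro v w
  rw [hA, hh, ← hS]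
  simp [LinearEquiv.conj_apply]

end LinearAlgebra

/-! ### Metrics, connections and curvature on an open set -/

section LocalGeometry

variable {n : ℕ}

/-- The bilinear map field `Γ` is torsion free and compatible with the metric `b` at `y`, that is,
it is the Levi-Civita connection of `b` at `y` (in the coordinates of `ℝⁿ`). -/
structure IsLeviCivita (b : Eu n → Eu n →L[ℝ] Eu n →L[ℝ] ℝ)
    (Γ : Eu n → Eu n →L[ℝ] Eu n →L[ℝ] Eu n) (y : Eu n) : Prop where
  symm : ∀ u v, Γ y u v = Γ y v u
  compat : ∀ u v w, fderiv ℝ b y u v w = b y (Γ y u v) w + b y v (Γ y u w)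

/-- `b` is, near `y`, a smooth Riemannian metric with the smooth Levi-Civita connection `Γ`. -/
structure IsLocalMetric (b : Eu n → Eu n →L[ℝ] Eu n →L[ℝ] ℝ)
    (Γ : Eu n → Eu n →L[ℝ] Eu n →L[ℝ] Eu n) (y : Eu n) : Prop where
  smooth : ContDiffAt ℝ ∞ b y
  smooth_conn : ContDiffAt ℝ ∞ Γ y
  scalarProduct : ∀ᶠ z in 𝓝 y, IsScalarProduct (b z)
  leviCivita : ∀ᶠ z in 𝓝 y, IsLeviCivita b Γ z

/-- The curvature operator `w ↦ R(u, v) w` of the connection `Γ`. -/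
def riemann (Γ : Eu n → Eu n →L[ℝ] Eu n →L[ℝ] Eu n) (y u v w : Eu n) : Eu n :=
  fderiv ℝ Γ y u v w - fderiv ℝ Γ y v u w + Γ y u (Γ y v w) - Γ y v (Γ y u w)

/-- The linear map `u ↦ R(u, v) w`. -/
def riemannOp (Γ : Eu n → Eu n →L[ℝ] Eu n →L[ℝ] Eu n) (y v w : Eu n) : Eu n →ₗ[ℝ] Eu n where
  toFun u := riemann Γ y u v w
  map_add' u u' := by simp only [riemann, map_add, add_apply]; abel
  map_smul' c u := by
    simp only [riemann, map_smul, smul_apply, RingHom.id_apply, smul_sub, smul_add]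

/-- The Ricci form `(v, w) ↦ tr (u ↦ R(u, v) w)`. -/
def ricciForm (Γ : Eu n → Eu n →L[ℝ] Eu n →L[ℝ] Eu n) (y : Eu n) : Eu n →ₗ[ℝ] Eu n →ₗ[ℝ] ℝ :=
  LinearMap.mk₂ ℝ (fun v w => LinearMap.trace ℝ (Eu n) (riemannOp Γ y v w))
    (fun v v' w => by
      rw [← map_add]; congr 1; ext1 u
      simp only [riemannOp, riemann, map_add, add_apply, LinearMap.coe_mk, AddHom.coe_mk,
        LinearMap.add_apply]
      abel)
    (fun c v w => by
      rw [← map_smul]; congr 1; ext1 u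
      simp only [riemannOp, riemann, map_smul, smul_apply, LinearMap.coe_mk, AddHom.coe_mk,
        LinearMap.smul_apply, smul_sub, smul_add])
    (fun v w w' => by
      rw [← map_add]; congr 1; ext1 u
      simp only [riemannOp, riemann, map_add, LinearMap.coe_mk, AddHom.coe_mk,
        LinearMap.add_apply]
      abel)
    (fun c v w => by
      rw [← map_smul]; congr 1; ext1 u
      simp only [riemannOp, riemann, map_smul, LinearMap.coe_mk, AddHom.coe_mk,
        LinearMap.smul_apply, smul_sub, smul_add])

lemma ricciForm_apply (Γ : Eu n → Eu n →L[ℝ] Eu n →L[ℝ] Eu n) (y v w : Eu n) :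
    ricciForm Γ y v w = LinearMap.trace ℝ (Eu n) (riemannOp Γ y v w) := rfl

/-- The Hessian `D²f(v, w) - Df(Γ(v, w))` of `f`, for the connection `Γ`. -/
def hess (Γ : Eu n → Eu n →L[ℝ] Eu n →L[ℝ] Eu n) (f : Eu n → ℝ) (y : Eu n) :
    Eu n →ₗ[ℝ] Eu n →ₗ[ℝ] ℝ :=
  LinearMap.mk₂ ℝ (fun v w => fderiv ℝ (fderiv ℝ f) y v w - fderiv ℝ f y (Γ y v w))
    (fun v v' w => by simp only [map_add, add_apply]; ring)
    (fun c v w => by simp only [map_smul, smul_apply, smul_sub])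
    (fun v w w' => by simp only [map_add]; ring)
    (fun c v w => by simp only [map_smul, smul_sub])

lemma hess_apply (Γ : Eu n → Eu n →L[ℝ] Eu n →L[ℝ] Eu n) (f : Eu n → ℝ) (y v w : Eu n) :
    hess Γ f y v w = fderiv ℝ (fderiv ℝ f) y v w - fderiv ℝ f y (Γ y v w) := rfl

/-- The scalar curvature of the metric `b` with connection `Γ`. -/
def scal (b : Eu n → Eu n →L[ℝ] Eu n →L[ℝ] ℝ) (Γ : Eu n → Eu n →L[ℝ] Eu n →L[ℝ] Eu n)
    (y : Eu n) : ℝ :=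
  metricTrace (b y) fun v w => ricciForm Γ y v w

/-- The Laplacian of the metric `b` with connection `Γ`, as the trace of the Hessian. -/
def lap (b : Eu n → Eu n →L[ℝ] Eu n →L[ℝ] ℝ) (Γ : Eu n → Eu n →L[ℝ] Eu n →L[ℝ] Eu n)
    (f : Eu n → ℝ) (y : Eu n) : ℝ :=
  metricTrace (b y) fun v w => hess Γ f y v w

/-- The scalar product `⟨∇f, ∇h⟩` for the metric `b`. -/
def gradInner (b : Eu n → Eu n →L[ℝ] Eu n →L[ℝ] ℝ) (f h : Eu n → ℝ) (y : Eu n) : ℝ :=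
  fderiv ℝ f y (sharp (b y) (fderiv ℝ h y))

/-- The algebraic core of the uniqueness of the Levi-Civita connection. -/
lemma eq_zero_of_symm_antisymm {X : Type*} {t : X → X → X → ℝ} (h₁ : ∀ u v w, t u v w = t v u w)
    (h₂ : ∀ u v w, t u v w = -t u w v) (u v w : X) : t u v w = 0 := by
  have e1 := h₁ u v w
  have e2 := h₂ v u w
  have e3 := h₁ v w u
  have e4 := h₂ w v u
  have e5 := h₁ w u v
  have e6 := h₂ u w v
  linarith

/-- A linear map which pulls a form back to a scalar product is an isomorphism. -/
lemma exists_equiv_of_pullback {B B' : Eu n →L[ℝ] Eu n →L[ℝ] ℝ}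
    (hB' : IsScalarProduct B') {A : Eu n →L[ℝ] Eu n}
    (hA : ∀ v w, B' v w = B (A v) (A w)) : ∃ A' : Eu n ≃L[ℝ] Eu n, ∀ v, A' v = A v := by
  have hinj : Function.Injective (A : Eu n →ₗ[ℝ] Eu n) := by
    rw [injective_iff_map_eq_zero]
    intro v hv
    by_contra hne
    have h := hB'.pos v hne
    have hv' : A v = 0 := hv
    rw [hA, hv'] at h
    simp at h
  exact ⟨(LinearEquiv.ofInjectiveEndo _ hinj).toContinuousLinearEquiv, fun v => rfl⟩

section Pullback

variable {b b' : Eu n → Eu n →L[ℝ] Eu n →L[ℝ] ℝ} {Γ Γ' : Eu n → Eu n →L[ℝ] Eu n →L[ℝ] Eu n}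
  {ψ : Eu n → Eu n} {z : Eu n}

/-- The transformation law of the Christoffel symbols. -/
lemma IsLeviCivita.pullback (hΓ : IsLeviCivita b Γ (ψ z)) (hΓ' : IsLeviCivita b' Γ' z)
    (hb : DifferentiableAt ℝ b (ψ z)) (hb' : DifferentiableAt ℝ b' z)
    (hs : IsScalarProduct (b (ψ z))) (hs' : IsScalarProduct (b' z)) (hψ : ContDiffAt ℝ 2 ψ z)
    (h : ∀ᶠ x in 𝓝 z, ∀ v w, b' x v w = b (ψ x) (fderiv ℝ ψ x v) (fderiv ℝ ψ x w))
    (v w : Eu n) :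
    fderiv ℝ ψ z (Γ' z v w) =
      Γ (ψ z) (fderiv ℝ ψ z v) (fderiv ℝ ψ z w) + fderiv ℝ (fderiv ℝ ψ) z v w := by
  have hψ1 : DifferentiableAt ℝ ψ z := hψ.differentiableAt (by simp)
  have hψ2 : DifferentiableAt ℝ (fderiv ℝ ψ) z :=
    (hψ.fderiv_right (m := 1) (by norm_num)).differentiableAt (by simp)
  have hsymm : ∀ v w, fderiv ℝ (fderiv ℝ ψ) z v w = fderiv ℝ (fderiv ℝ ψ) z w v := fun v w =>
    (hψ.isSymmSndFDerivAt (by simp)).eq v w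
  have hz := h.self_of_nhds
  obtain ⟨A, hA⟩ := exists_equiv_of_pullback hs' hz
  -- the derivative of the pulled back metric
  have hd : ∀ u v w, fderiv ℝ b' z u v w =
      fderiv ℝ b (ψ z) (fderiv ℝ ψ z u) (fderiv ℝ ψ z v) (fderiv ℝ ψ z w) +
      b (ψ z) (fderiv ℝ (fderiv ℝ ψ) z u v) (fderiv ℝ ψ z w) +
      b (ψ z) (fderiv ℝ ψ z v) (fderiv ℝ (fderiv ℝ ψ) z u w) := by
    intro u v w
    have e1 : HasFDerivAt (fun x => b' x v w) _ z :=
      (hb'.hasFDerivAt.clm_apply (hasFDerivAt_const v z)).clm_apply (hasFDerivAt_const w z)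
    have e2 : HasFDerivAt (fun x => b (ψ x) (fderiv ℝ ψ x v) (fderiv ℝ ψ x w)) _ z :=
      (((hb.hasFDerivAt.comp z hψ1.hasFDerivAt).clm_apply
        (hψ2.hasFDerivAt.clm_apply (hasFDerivAt_const v z)))).clm_apply
        (hψ2.hasFDerivAt.clm_apply (hasFDerivAt_const w z))
    have e3 : (fun x => b' x v w) =ᶠ[𝓝 z] fun x => b (ψ x) (fderiv ℝ ψ x v) (fderiv ℝ ψ x w) :=
      h.mono fun x hx => hx v w
    have e4 := DFunLike.congr_fun (e1.unique (e2.congr_of_eventuallyEq e3)) u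
    simp at e4
    linarith
  -- lowered with the metric, the difference of the two sides is symmetric in the first two
  -- arguments (torsion) and antisymmetric in the last two (metric compatibility)
  have key := eq_zero_of_symm_antisymm (t := fun u v w =>
    b (ψ z) (fderiv ℝ ψ z (Γ' z u v) - (Γ (ψ z) (fderiv ℝ ψ z u) (fderiv ℝ ψ z v) +
      fderiv ℝ (fderiv ℝ ψ) z u v)) (fderiv ℝ ψ z w))
    (fun u v w => by simp only [hΓ'.symm u v, hΓ.symm _ (fderiv ℝ ψ z v), hsymm u v])
    (fun u v w => by
      have e1 := hΓ'.compat u v w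
      rw [hd, hΓ.compat, hz, hz, hs.symm _ (fderiv ℝ ψ z (Γ' z u w)),
        hs.symm _ (Γ (ψ z) (fderiv ℝ ψ z u) (fderiv ℝ ψ z w)),
        hs.symm _ (fderiv ℝ (fderiv ℝ ψ) z u w)] at e1
      simp only [map_sub, map_add, sub_apply, add_apply]
      linarith) v w
  refine hs.eq_of_forall fun w' => ?_
  have h1 := key (A.symm w')
  rw [← hA (A.symm w'), A.apply_symm_apply] at h1
  rw [map_sub, sub_apply, sub_eq_zero] at h1
  exact h1

/-- The curvature transforms as a tensor. -/
lemma IsLocalMetric.riemann_pullback (hm : IsLocalMetric b Γ (ψ z)) (hm' : IsLocalMetric b' Γ' z)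
    (hψ : ContDiffAt ℝ ∞ ψ z)
    (h : ∀ᶠ x in 𝓝 z, ∀ v w, b' x v w = b (ψ x) (fderiv ℝ ψ x v) (fderiv ℝ ψ x w))
    (u v w : Eu n) :
    fderiv ℝ ψ z (riemann Γ' z u v w) =
      riemann Γ (ψ z) (fderiv ℝ ψ z u) (fderiv ℝ ψ z v) (fderiv ℝ ψ z w) := by
  have h2 : (2 : ℕ∞ω) ≤ ∞ := by norm_cast
  have hψ1 : DifferentiableAt ℝ ψ z := hψ.differentiableAt (by simp)
  have hψ2' : ContDiffAt ℝ ∞ (fderiv ℝ ψ) z := hψ.fderiv_right (by norm_cast)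
  have hψ2 : DifferentiableAt ℝ (fderiv ℝ ψ) z := hψ2'.differentiableAt (by simp)
  have hψ3 : DifferentiableAt ℝ (fderiv ℝ (fderiv ℝ ψ)) z :=
    (hψ2'.fderiv_right (m := 1) (by norm_cast)).differentiableAt (by simp)
  have hsymm : ∀ v w, fderiv ℝ (fderiv ℝ ψ) z v w = fderiv ℝ (fderiv ℝ ψ) z w v := fun v w =>
    (hψ.isSymmSndFDerivAt (by simpa using h2)).eq v w
  have hsymm3 : ∀ u v, fderiv ℝ (fderiv ℝ (fderiv ℝ ψ)) z u v =
      fderiv ℝ (fderiv ℝ (fderiv ℝ ψ)) z v u := fun u v =>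
    (hψ2'.isSymmSndFDerivAt (by simpa using h2)).eq u v
  have hcont := hψ1.continuousAt
  have hlaw : ∀ᶠ x in 𝓝 z, ∀ v w, fderiv ℝ ψ x (Γ' x v w) =
      Γ (ψ x) (fderiv ℝ ψ x v) (fderiv ℝ ψ x w) + fderiv ℝ (fderiv ℝ ψ) x v w := by
    filter_upwards [hcont.eventually hm.leviCivita, hm'.leviCivita,
      hcont.eventually hm.scalarProduct, hm'.scalarProduct, (hψ.of_le h2).eventually (by simp),
      hcont.eventually ((hm.smooth.of_le h2).eventually (by simp)),
      (hm'.smooth.of_le h2).eventually (by simp),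
      h.eventually_nhds] with x h1 h1' h3 h4 h5 h6 h7 h8
    exact h1.pullback h1' (h6.differentiableAt (by simp)) (h7.differentiableAt (by simp)) h3 h4
      h5 h8
  have hΓ : DifferentiableAt ℝ Γ (ψ z) := hm.smooth_conn.differentiableAt (by simp)
  have hΓ' : DifferentiableAt ℝ Γ' z := hm'.smooth_conn.differentiableAt (by simp)
  have hz := hlaw.self_of_nhds
  -- the derivative of the transformation law
  have hd : ∀ u v w, fderiv ℝ (fderiv ℝ ψ) z u (Γ' z v w) + fderiv ℝ ψ z (fderiv ℝ Γ' z u v w) =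
      fderiv ℝ Γ (ψ z) (fderiv ℝ ψ z u) (fderiv ℝ ψ z v) (fderiv ℝ ψ z w) +
      Γ (ψ z) (fderiv ℝ (fderiv ℝ ψ) z u v) (fderiv ℝ ψ z w) +
      Γ (ψ z) (fderiv ℝ ψ z v) (fderiv ℝ (fderiv ℝ ψ) z u w) +
      fderiv ℝ (fderiv ℝ (fderiv ℝ ψ)) z u v w := by
    intro u v w
    have e1 : HasFDerivAt (fun x => fderiv ℝ ψ x (Γ' x v w)) _ z :=
      hψ2.hasFDerivAt.clm_apply ((hΓ'.hasFDerivAt.clm_apply (hasFDerivAt_const v z)).clm_apply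
        (hasFDerivAt_const w z))
    have e2 : HasFDerivAt (fun x => Γ (ψ x) (fderiv ℝ ψ x v) (fderiv ℝ ψ x w) +
        fderiv ℝ (fderiv ℝ ψ) x v w) _ z :=
      ((((hΓ.hasFDerivAt.comp z hψ1.hasFDerivAt).clm_apply
        (hψ2.hasFDerivAt.clm_apply (hasFDerivAt_const v z)))).clm_apply
        (hψ2.hasFDerivAt.clm_apply (hasFDerivAt_const w z))).add
        ((hψ3.hasFDerivAt.clm_apply (hasFDerivAt_const v z)).clm_apply (hasFDerivAt_const w z))
    have e3 : (fun x => fderiv ℝ ψ x (Γ' x v w)) =ᶠ[𝓝 z] fun x =>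
        Γ (ψ x) (fderiv ℝ ψ x v) (fderiv ℝ ψ x w) + fderiv ℝ (fderiv ℝ ψ) x v w :=
      hlaw.mono fun x hx => hx v w
    have e4 := DFunLike.congr_fun (e1.unique (e2.congr_of_eventuallyEq e3)) u
    simp at e4
    rw [add_comm, e4]
    abel
  have h1 : fderiv ℝ ψ z (fderiv ℝ Γ' z u v w) = _ := eq_sub_of_add_eq' (hd u v w)
  have h1' : fderiv ℝ ψ z (fderiv ℝ Γ' z v u w) = _ := eq_sub_of_add_eq' (hd v u w)
  have h3 : fderiv ℝ (fderiv ℝ (fderiv ℝ ψ)) z u v w =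
    fderiv ℝ (fderiv ℝ (fderiv ℝ ψ)) z v u w := by rw [hsymm3]
  simp only [riemann, map_sub, map_add, hz, h1, h1', h3, hsymm u v]
  abel

lemma IsLocalMetric.ricciForm_pullback (hm : IsLocalMetric b Γ (ψ z))
    (hm' : IsLocalMetric b' Γ' z) (hψ : ContDiffAt ℝ ∞ ψ z)
    (h : ∀ᶠ x in 𝓝 z, ∀ v w, b' x v w = b (ψ x) (fderiv ℝ ψ x v) (fderiv ℝ ψ x w))
    (v w : Eu n) :
    ricciForm Γ' z v w = ricciForm Γ (ψ z) (fderiv ℝ ψ z v) (fderiv ℝ ψ z w) := by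
  obtain ⟨A, hA⟩ := exists_equiv_of_pullback hm'.scalarProduct.self_of_nhds h.self_of_nhds
  rw [ricciForm_apply, ricciForm_apply,
    ← LinearMap.trace_conj' (riemannOp Γ' z v w) A.toLinearEquiv]
  congr 1
  ext1 u
  rw [LinearEquiv.conj_apply_apply]
  change A (riemann Γ' z (A.symm u) v w) = riemann Γ (ψ z) u _ _
  rw [hA, hm.riemann_pullback hm' hψ h, ← hA, A.apply_symm_apply]

/-- The scalar curvature does not depend on the coordinates. -/
theorem IsLocalMetric.scal_pullback (hm : IsLocalMetric b Γ (ψ z))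
    (hm' : IsLocalMetric b' Γ' z) (hψ : ContDiffAt ℝ ∞ ψ z)
    (h : ∀ᶠ x in 𝓝 z, ∀ v w, b' x v w = b (ψ x) (fderiv ℝ ψ x v) (fderiv ℝ ψ x w)) :
    scal b' Γ' z = scal b Γ (ψ z) := by
  obtain ⟨A, hA⟩ := exists_equiv_of_pullback hm'.scalarProduct.self_of_nhds h.self_of_nhds
  refine hm.scalarProduct.self_of_nhds.metricTrace_pullback hm'.scalarProduct.self_of_nhds A
    (fun v w => ?_) _ (fun v w => ?_)
  · rw [h.self_of_nhds, hA, hA]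
  · rw [hm.ricciForm_pullback hm' hψ h, hA, hA]

lemma IsLocalMetric.hess_pullback (hm : IsLocalMetric b Γ (ψ z))
    (hm' : IsLocalMetric b' Γ' z) (hψ : ContDiffAt ℝ ∞ ψ z)
    (h : ∀ᶠ x in 𝓝 z, ∀ v w, b' x v w = b (ψ x) (fderiv ℝ ψ x v) (fderiv ℝ ψ x w))
    {f f' : Eu n → ℝ} (hf : ContDiffAt ℝ ∞ f (ψ z)) (hf' : f' =ᶠ[𝓝 z] f ∘ ψ) (v w : Eu n) :
    hess Γ' f' z v w = hess Γ f (ψ z) (fderiv ℝ ψ z v) (fderiv ℝ ψ z w) := by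
  have h2 : (2 : ℕ∞ω) ≤ ∞ := by norm_cast
  have hψ1 : DifferentiableAt ℝ ψ z := hψ.differentiableAt (by simp)
  have hψ2 : DifferentiableAt ℝ (fderiv ℝ ψ) z :=
    (hψ.fderiv_right (m := 1) (by norm_cast)).differentiableAt (by simp)
  have hf2 : DifferentiableAt ℝ (fderiv ℝ f) (ψ z) :=
    (hf.fderiv_right (m := 1) (by norm_cast)).differentiableAt (by simp)
  have hd : ∀ᶠ x in 𝓝 z, fderiv ℝ f' x = (fderiv ℝ f (ψ x)).comp (fderiv ℝ ψ x) := by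
    filter_upwards [hf'.eventuallyEq_nhds, (hψ.of_le h2).eventually (by simp),
      hψ1.continuousAt.eventually ((hf.of_le h2).eventually (by simp))] with x h1 h4 h3
    rw [h1.fderiv_eq, fderiv_comp x (h3.differentiableAt (by simp)) (h4.differentiableAt (by simp))]
  have hd2 : fderiv ℝ (fderiv ℝ f') z v w =
      fderiv ℝ (fderiv ℝ f) (ψ z) (fderiv ℝ ψ z v) (fderiv ℝ ψ z w) +
        fderiv ℝ f (ψ z) (fderiv ℝ (fderiv ℝ ψ) z v w) := by
    have hd' : fderiv ℝ f' =ᶠ[𝓝 z] fun x => (fderiv ℝ f (ψ x)).comp (fderiv ℝ ψ x) := hd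
    have e1 : HasFDerivAt (fun x => (fderiv ℝ f (ψ x)).comp (fderiv ℝ ψ x)) _ z :=
      (hf2.hasFDerivAt.comp z hψ1.hasFDerivAt).clm_comp hψ2.hasFDerivAt
    rw [hd'.fderiv_eq, e1.fderiv]
    simp
    ring
  have hlaw := hm.leviCivita.self_of_nhds.pullback hm'.leviCivita.self_of_nhds
    (hm.smooth.differentiableAt (by simp)) (hm'.smooth.differentiableAt (by simp))
    hm.scalarProduct.self_of_nhds hm'.scalarProduct.self_of_nhds (hψ.of_le h2) h v w
  rw [hess_apply, hess_apply, hd2, hd.self_of_nhds, ContinuousLinearMap.comp_apply, hlaw, map_add]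
  ring

/-- The Laplacian does not depend on the coordinates. -/
theorem IsLocalMetric.lap_pullback (hm : IsLocalMetric b Γ (ψ z))
    (hm' : IsLocalMetric b' Γ' z) (hψ : ContDiffAt ℝ ∞ ψ z)
    (h : ∀ᶠ x in 𝓝 z, ∀ v w, b' x v w = b (ψ x) (fderiv ℝ ψ x v) (fderiv ℝ ψ x w))
    {f f' : Eu n → ℝ} (hf : ContDiffAt ℝ ∞ f (ψ z)) (hf' : f' =ᶠ[𝓝 z] f ∘ ψ) :
    lap b' Γ' f' z = lap b Γ f (ψ z) := by
  obtain ⟨A, hA⟩ := exists_equiv_of_pullback hm'.scalarProduct.self_of_nhds h.self_of_nhds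
  refine hm.scalarProduct.self_of_nhds.metricTrace_pullback hm'.scalarProduct.self_of_nhds A
    (fun v w => ?_) _ (fun v w => ?_)
  · rw [h.self_of_nhds, hA, hA]
  · rw [hm.hess_pullback hm' hψ h hf hf', hA, hA]

/-- The scalar product of gradients does not depend on the coordinates. -/
theorem gradInner_pullback (hs : IsScalarProduct (b (ψ z))) (hs' : IsScalarProduct (b' z))
    (hψ : DifferentiableAt ℝ ψ z)
    (h : ∀ v w, b' z v w = b (ψ z) (fderiv ℝ ψ z v) (fderiv ℝ ψ z w))
    {f f' k k' : Eu n → ℝ} (hf : DifferentiableAt ℝ f (ψ z)) (hf' : f' =ᶠ[𝓝 z] f ∘ ψ)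
    (hk : DifferentiableAt ℝ k (ψ z)) (hk' : k' =ᶠ[𝓝 z] k ∘ ψ) :
    gradInner b' f' k' z = gradInner b f k (ψ z) := by
  obtain ⟨A, hA⟩ := exists_equiv_of_pullback hs' h
  have h1 : fderiv ℝ ψ z (sharp (b' z) (fderiv ℝ k' z)) = sharp (b (ψ z)) (fderiv ℝ k (ψ z)) := by
    refine hs.eq_of_forall fun w => ?_
    obtain ⟨w', rfl⟩ := A.surjective w
    rw [hA, ← h, hs'.apply_sharp, hs.apply_sharp, hk'.fderiv_eq, fderiv_comp z hk hψ]
    rfl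
  rw [gradInner, gradInner, ← h1, hf'.fderiv_eq, fderiv_comp z hf hψ]
  rfl

end Pullback

end LocalGeometry

/-! ### Components: Christoffel symbols and the divergence form of the Laplacian -/

section Components

variable {n : ℕ}

/-- Jacobi's formula for the derivative of a determinant. -/
lemma hasFDerivAt_det {G : Eu n → Matrix (Fin n) (Fin n) ℝ} {y : Eu n}
    (hG : ∀ i j, DifferentiableAt ℝ (fun z => G z i j) y) :
    HasFDerivAt (fun z => (G z).det)
      (∑ i, ∑ j, (G y).adjugate i j • fderiv ℝ (fun z => G z j i) y) y := by
  have h1 : HasFDerivAt (fun z => (G z).det) (∑ σ : Equiv.Perm (Fin n),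
      (Equiv.Perm.sign σ : ℤ) • ∑ i, (∏ j ∈ Finset.univ.erase i, G y (σ j) j) •
        fderiv ℝ (fun z => G z (σ i) i) y) y := by
    have h2 : (fun z => (G z).det) = fun z => ∑ σ : Equiv.Perm (Fin n),
        (Equiv.Perm.sign σ : ℤ) • ∏ i, G z (σ i) i := by
      ext z; rw [Matrix.det_apply]; rfl
    rw [h2]
    refine HasFDerivAt.fun_sum fun σ _ => ?_
    refine HasFDerivAt.fun_const_smul ?_ _
    exact HasFDerivAt.finsetProd fun i _ => (hG (σ i) i).hasFDerivAt
  refine h1.congr_fderiv ?_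
  ext u
  have h3 : ∀ i, ∑ j, (G y).adjugate i j * fderiv ℝ (fun z => G z j i) y u =
      ((G y).updateCol i (fun j => fderiv ℝ (fun z => G z j i) y u)).det := by
    intro i
    rw [← Matrix.cramer_apply, Matrix.cramer_eq_adjugate_mulVec]
    rfl
  simp only [sum_apply, smul_apply, smul_eq_mul, h3, Matrix.det_apply, Finset.smul_sum]
  rw [Finset.sum_comm]
  refine Finset.sum_congr rfl fun i _ => Finset.sum_congr rfl fun σ _ => ?_
  rw [← Finset.mul_prod_erase Finset.univ _ (Finset.mem_univ i), Matrix.updateCol_self, mul_comm]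
  rw [Finset.prod_congr rfl fun j hj => Matrix.updateCol_ne (Finset.ne_of_mem_erase hj)]
  rfl

lemma contDiffAt_det {G : Eu n → Matrix (Fin n) (Fin n) ℝ} {y : Eu n} {m : ℕ∞ω}
    (hG : ∀ i j, ContDiffAt ℝ m (fun z => G z i j) y) :
    ContDiffAt ℝ m (fun z => (G z).det) y := by
  simp only [Matrix.det_apply]
  refine ContDiffAt.sum fun σ _ => ?_
  exact ContDiffAt.const_smul _ (contDiffAt_prod fun i _ => hG (σ i) i)

lemma contDiffAt_inv_apply {G : Eu n → Matrix (Fin n) (Fin n) ℝ} {y : Eu n} {m : ℕ∞ω}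
    (hG : ∀ i j, ContDiffAt ℝ m (fun z => G z i j) y) (h0 : (G y).det ≠ 0) (i j : Fin n) :
    ContDiffAt ℝ m (fun z => (G z)⁻¹ i j) y := by
  simp only [Matrix.inv_def, Ring.inverse_eq_inv', Matrix.smul_apply, smul_eq_mul]
  refine ((contDiffAt_det hG).inv h0).mul ?_
  simp only [Matrix.adjugate_apply]
  refine contDiffAt_det fun k l => ?_
  by_cases hk : k = j
  · subst hk
    simp only [Matrix.updateRow_self]
    exact contDiffAt_const
  · simp only [Matrix.updateRow_ne hk]
    exact hG k l

set_option maxSynthPendingDepth 4 in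
lemma contDiffAt_formOf {G : Eu n → Matrix (Fin n) (Fin n) ℝ} {y : Eu n} {m : ℕ∞ω}
    (hG : ∀ i j, ContDiffAt ℝ m (fun z => G z i j) y) :
    ContDiffAt ℝ m (fun z => formOf (G z)) y := by
  unfold formOf
  exact ContDiffAt.sum fun i _ => ContDiffAt.sum fun j _ => (hG i j).smul contDiffAt_const

set_option maxSynthPendingDepth 4 in
lemma contDiffAt_bilMapOf {c : Eu n → Fin n → Fin n → Fin n → ℝ} {y : Eu n} {m : ℕ∞ω}
    (hc : ∀ k i j, ContDiffAt ℝ m (fun z => c z k i j) y) :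
    ContDiffAt ℝ m (fun z => bilMapOf (c z)) y := by
  unfold bilMapOf
  exact ContDiffAt.sum fun k _ => ContDiffAt.sum fun i _ => ContDiffAt.sum fun j _ =>
    (hc k i j).smul contDiffAt_const

set_option maxSynthPendingDepth 4 in
lemma fderiv_formOf_single {G : Eu n → Matrix (Fin n) (Fin n) ℝ} {y : Eu n}
    (hG : ∀ i j, DifferentiableAt ℝ (fun z => G z i j) y) (u : Eu n) (i j : Fin n) :
    fderiv ℝ (fun z => formOf (G z)) y u (EuclideanSpace.single i 1) (EuclideanSpace.single j 1) =
      fderiv ℝ (fun z => G z i j) y u := by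
  have hd : DifferentiableAt ℝ (fun z => formOf (G z)) y := by
    unfold formOf
    fun_prop
  have h1 : HasFDerivAt (fun z => formOf (G z) (EuclideanSpace.single i 1)
      (EuclideanSpace.single j 1)) _ y :=
    (hd.hasFDerivAt.clm_apply (hasFDerivAt_const _ y)).clm_apply (hasFDerivAt_const _ y)
  simp only [formOf_single] at h1
  rw [h1.fderiv]
  simp

set_option maxSynthPendingDepth 4 in
lemma fderiv_bilMapOf_single {c : Eu n → Fin n → Fin n → Fin n → ℝ} {y : Eu n}
    (hc : ∀ k i j, DifferentiableAt ℝ (fun z => c z k i j) y) (u : Eu n) (i j k : Fin n) :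
    fderiv ℝ (fun z => bilMapOf (c z)) y u (EuclideanSpace.single i 1)
      (EuclideanSpace.single j 1) k = fderiv ℝ (fun z => c z k i j) y u := by
  have hd : DifferentiableAt ℝ (fun z => bilMapOf (c z)) y := by
    unfold bilMapOf
    fun_prop
  have h1 : HasFDerivAt (fun z => bilMapOf (c z) (EuclideanSpace.single i 1)
      (EuclideanSpace.single j 1)) _ y :=
    (hd.hasFDerivAt.clm_apply (hasFDerivAt_const _ y)).clm_apply (hasFDerivAt_const _ y)
  have h2 := ((EuclideanSpace.proj k : Eu n →L[ℝ] ℝ).hasFDerivAt.comp y h1)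
  have h3 : (EuclideanSpace.proj k : Eu n →L[ℝ] ℝ) ∘ (fun z => bilMapOf (c z)
      (EuclideanSpace.single i 1) (EuclideanSpace.single j 1)) = fun z => c z k i j := by
    ext z; simp
  rw [h3] at h2
  rw [h2.fderiv]
  simp

/-- The Christoffel symbols of a matrix field `G`. -/
def christoffelOf (G : Eu n → Matrix (Fin n) (Fin n) ℝ) (y : Eu n) (k i j : Fin n) : ℝ :=
  (1 / 2) * ∑ l, (G y)⁻¹ k l *
    (partialD i (fun z => G z j l) y + partialD j (fun z => G z i l) y
      - partialD l (fun z => G z i j) y)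

lemma eq_zero_of_trilinear {F : Eu n → Eu n → Eu n → ℝ}
    (h₁ : ∀ v w, IsLinearMap ℝ fun u => F u v w) (h₂ : ∀ u w, IsLinearMap ℝ fun v => F u v w)
    (h₃ : ∀ u v, IsLinearMap ℝ fun w => F u v w)
    (h : ∀ i j k, F (EuclideanSpace.single i 1) (EuclideanSpace.single j 1)
      (EuclideanSpace.single k 1) = 0) (u v w : Eu n) : F u v w = 0 := by
  have key : ∀ f : Eu n → ℝ, IsLinearMap ℝ f → (∀ i, f (EuclideanSpace.single i 1) = 0) →
      ∀ x, f x = 0 := by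
    intro f hf h0 x
    have h1 := map_sum (hf.mk' f) (fun i => x i • (EuclideanSpace.single i (1 : ℝ) : Eu n))
      Finset.univ
    rw [← sum_single] at h1
    change f x = _ at h1
    rw [h1]
    refine Finset.sum_eq_zero fun i _ => ?_
    change f _ = 0
    rw [hf.map_smul, h0, smul_zero]
  exact key _ (h₁ v w) (fun i => key _ (h₂ _ w) (fun j => key _ (h₃ _ _) (fun k => h i j k) w) v) u

/-- The Christoffel symbols are the components of the Levi-Civita connection. -/
lemma isLeviCivita_christoffelOf {G : Eu n → Matrix (Fin n) (Fin n) ℝ} {y : Eu n}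
    (hG : ∀ i j, DifferentiableAt ℝ (fun z => G z i j) y) (hpos : (G y).PosDef)
    (hsymm : ∀ᶠ z in 𝓝 y, (G z).IsHermitian) :
    IsLeviCivita (fun z => formOf (G z)) (fun z => bilMapOf (christoffelOf G z)) y := by
  have hs : ∀ i j a, partialD a (fun z => G z i j) y = partialD a (fun z => G z j i) y := by
    intro i j a
    have : (fun z => G z i j) =ᶠ[𝓝 y] fun z => G z j i := by
      filter_upwards [hsymm] with z hz
      simpa using hz.apply j i
    rw [partialD, this.fderiv_eq]
    rfl
  have hsym : ∀ i j k, christoffelOf G y k i j = christoffelOf G y k j i := by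
    intro i j k
    simp only [christoffelOf]
    congr 1
    refine Finset.sum_congr rfl fun l _ => ?_
    rw [hs i j l]; ring
  have hB := isScalarProduct_formOf hpos
  have hsymΓ : ∀ u v, bilMapOf (christoffelOf G y) u v = bilMapOf (christoffelOf G y) v u := by
    intro u v
    ext k
    rw [bilMapOf_apply, bilMapOf_apply, Finset.sum_comm]
    refine Finset.sum_congr rfl fun i _ => Finset.sum_congr rfl fun j _ => ?_
    rw [hsym]; ring
  refine ⟨hsymΓ, fun u v w => ?_⟩
  -- the Christoffel symbols of the first kind
  have hlow : ∀ i j l, formOf (G y) (bilMapOf (christoffelOf G y) (EuclideanSpace.single i 1)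
      (EuclideanSpace.single j 1)) (EuclideanSpace.single l 1) =
      (1 / 2) * (partialD i (fun z => G z j l) y + partialD j (fun z => G z i l) y
      - partialD l (fun z => G z i j) y) := by
    intro i j l
    rw [hB.symm, formOf_apply]
    simp only [PiLp.single_apply, bilMapOf_single, ite_mul, one_mul, zero_mul, mul_ite, mul_zero]
    rw [Finset.sum_comm]
    simp only [Finset.sum_ite_eq', Finset.mem_univ, if_true, christoffelOf]
    have h2 : G y * (G y)⁻¹ = 1 := Matrix.mul_nonsing_inv _ hpos.det_pos.ne'.isUnit
    have h3 : ∀ m, ∑ k, G y l k * (G y)⁻¹ k m = (1 : Matrix (Fin n) (Fin n) ℝ) l m := by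
      intro m; rw [← h2, Matrix.mul_apply]
    calc _ = (1 / 2) * ∑ m, (∑ k, G y l k * (G y)⁻¹ k m) * (partialD i (fun z => G z j m) y +
          partialD j (fun z => G z i m) y - partialD m (fun z => G z i j) y) := by
          simp only [Finset.mul_sum, Finset.sum_mul]
          rw [Finset.sum_comm]
          refine Finset.sum_congr rfl fun i _ => Finset.sum_congr rfl fun j _ => ?_
          ring
      _ = _ := by simp [h3, Matrix.one_apply]
  have h0 := eq_zero_of_trilinear (F := fun u v w => fderiv ℝ (fun z => formOf (G z)) y u v w -
      (formOf (G y) (bilMapOf (christoffelOf G y) u v) w +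
      formOf (G y) v (bilMapOf (christoffelOf G y) u w)))
    (fun v w => by constructor <;> intros <;> simp <;> ring)
    (fun u w => by constructor <;> intros <;> simp <;> ring)
    (fun u v => by constructor <;> intros <;> simp <;> ring)
    (fun i j k => by
      rw [fderiv_formOf_single hG, hB.symm (EuclideanSpace.single j 1), hlow, hlow, hs k j i,
        hs i k j]
      simp only [partialD]
      ring) u v w
  linarith

lemma contDiffAt_partialD {f : Eu n → ℝ} {y : Eu n} (hf : ContDiffAt ℝ ∞ f y) (i : Fin n) :
    ContDiffAt ℝ ∞ (partialD i f) y :=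
  (hf.fderiv_right (m := ∞) (by norm_cast)).clm_apply contDiffAt_const

/-- A smooth field of positive definite matrices is a Riemannian metric whose connection is given
by the Christoffel symbols. -/
lemma isLocalMetric_formOf {G : Eu n → Matrix (Fin n) (Fin n) ℝ} {U : Set (Eu n)} (hU : IsOpen U)
    (hG : ∀ i j, ContDiffOn ℝ ∞ (fun z => G z i j) U) (hpos : ∀ z ∈ U, (G z).PosDef) {y : Eu n}
    (hy : y ∈ U) :
    IsLocalMetric (fun z => formOf (G z)) (fun z => bilMapOf (christoffelOf G z)) y := by
  have hG' : ∀ z ∈ U, ∀ i j, ContDiffAt ℝ ∞ (fun z => G z i j) z := fun z hz i j =>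
    (hG i j).contDiffAt (hU.mem_nhds hz)
  have hmem : ∀ᶠ z in 𝓝 y, z ∈ U := hU.mem_nhds hy
  refine ⟨contDiffAt_formOf (hG' y hy), contDiffAt_bilMapOf fun k i j => ?_,
    hmem.mono fun z hz => isScalarProduct_formOf (hpos z hz), hmem.mono fun z hz => ?_⟩
  · refine contDiffAt_const.mul (ContDiffAt.sum fun l _ => ?_)
    exact (contDiffAt_inv_apply (hG' y hy) (hpos y hy).det_pos.ne' k l).mul
      (((contDiffAt_partialD (hG' y hy j l) i).add (contDiffAt_partialD (hG' y hy i l) j)).sub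
        (contDiffAt_partialD (hG' y hy i j) l))
  · refine isLeviCivita_christoffelOf (fun i j => (hG' z hz i j).differentiableAt (by simp))
      (hpos z hz) ?_
    filter_upwards [hU.mem_nhds hz] with x hx using (hpos x hx).isHermitian

end Components

section Divergence

variable {n : ℕ} {b : Eu n → Eu n →L[ℝ] Eu n →L[ℝ] ℝ} {Γ : Eu n → Eu n →L[ℝ] Eu n →L[ℝ] Eu n}
  {y : Eu n}

lemma IsLocalMetric.gram_smooth (h : IsLocalMetric b Γ y) (i j : Fin n) :
    ContDiffAt ℝ ∞ (fun z => gram (b z) i j) y :=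
  (h.smooth.clm_apply contDiffAt_const).clm_apply contDiffAt_const

lemma IsLocalMetric.sharp_smooth (h : IsLocalMetric b Γ y) {a : Eu n → Eu n →L[ℝ] ℝ} {m : ℕ∞ω}
    (hm : m ≤ ∞) (ha : ContDiffAt ℝ m a y) : ContDiffAt ℝ m (fun z => sharp (b z) (a z)) y := by
  refine ContDiffAt.clm_apply ?_ ha
  have h1 : ContDiffAt ℝ m (ContinuousLinearMap.inverse : _ → (Eu n →L[ℝ] ℝ) →L[ℝ] Eu n) (b y) :=
    ContinuousLinearMap.IsInvertible.contDiffAt_map_inverse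
      ⟨h.scalarProduct.self_of_nhds.flat, h.scalarProduct.self_of_nhds.coe_flat⟩
  exact h1.comp y (h.smooth.of_le hm)

/-- The derivative of the Riemannian density is a trace of the connection. -/
lemma IsLocalMetric.fderiv_sqrt_det (h : IsLocalMetric b Γ y) (u : Eu n) :
    fderiv ℝ (fun z => Real.sqrt (gram (b z)).det) y u =
      Real.sqrt (gram (b y)).det * LinearMap.trace ℝ (Eu n) (Γ y u : Eu n →ₗ[ℝ] Eu n) := by
  have hd : ∀ i j, DifferentiableAt ℝ (fun z => gram (b z) i j) y := fun i j =>
    (h.gram_smooth i j).differentiableAt (by simp)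
  have hB := h.scalarProduct.self_of_nhds
  have hpos := hB.det_pos
  have hdet := hasFDerivAt_det hd
  have hbd : DifferentiableAt ℝ b y := h.smooth.differentiableAt (by simp)
  have h1 : ∀ i j, fderiv ℝ (fun z => gram (b z) j i) y u =
      ∑ k, gram (b y) i k * Γ y u (EuclideanSpace.single j 1) k +
      ∑ k, gram (b y) j k * Γ y u (EuclideanSpace.single i 1) k := by
    intro i j
    have e1 : HasFDerivAt (fun z => gram (b z) j i) _ y :=
      (hbd.hasFDerivAt.clm_apply (hasFDerivAt_const (EuclideanSpace.single j 1) y)).clm_apply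
        (hasFDerivAt_const (EuclideanSpace.single i 1) y)
    have e2 : ∀ l (x : Eu n), b y (EuclideanSpace.single l 1) x = ∑ k, gram (b y) l k * x k := by
      intro l x
      rw [form_apply_eq, Finset.sum_comm]
      refine Finset.sum_congr rfl fun k _ => ?_
      simp
    rw [e1.fderiv]
    simp only [ContinuousLinearMap.comp_zero, zero_add, ContinuousLinearMap.flip_apply]
    rw [h.leviCivita.self_of_nhds.compat, hB.symm _ (EuclideanSpace.single i 1), e2, e2]
  have h2 : (gram (b y)).adjugate * gram (b y) = (gram (b y)).det • 1 := Matrix.adjugate_mul _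
  have h2' : gram (b y) * (gram (b y)).adjugate = (gram (b y)).det • 1 := Matrix.mul_adjugate _
  have h3 : ∑ i, ∑ j, (gram (b y)).adjugate i j * fderiv ℝ (fun z => gram (b z) j i) y u =
      2 * (gram (b y)).det * LinearMap.trace ℝ (Eu n) (Γ y u : Eu n →ₗ[ℝ] Eu n) := by
    simp only [h1, mul_add, Finset.sum_add_distrib, Finset.mul_sum, ← mul_assoc]
    have e1 : ∑ i, ∑ j, ∑ k, (gram (b y)).adjugate i j * gram (b y) i k *
        Γ y u (EuclideanSpace.single j 1) k = (gram (b y)).det *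
          LinearMap.trace ℝ (Eu n) (Γ y u : Eu n →ₗ[ℝ] Eu n) := by
      rw [Finset.sum_comm, trace_eq_sum, Finset.mul_sum]
      refine Finset.sum_congr rfl fun j _ => ?_
      rw [Finset.sum_comm]
      simp only [← Finset.sum_mul]
      have : ∀ k, ∑ i, (gram (b y)).adjugate i j * gram (b y) i k =
          ((gram (b y)).det • (1 : Matrix (Fin n) (Fin n) ℝ)) k j := by
        intro k
        rw [← h2', Matrix.mul_apply]
        refine Finset.sum_congr rfl fun i _ => ?_
        rw [mul_comm]
        congr 1
        exact hB.symm _ _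
      simp [this, Matrix.one_apply]
    have e2 : ∑ i, ∑ j, ∑ k, (gram (b y)).adjugate i j * gram (b y) j k *
        Γ y u (EuclideanSpace.single i 1) k = (gram (b y)).det *
          LinearMap.trace ℝ (Eu n) (Γ y u : Eu n →ₗ[ℝ] Eu n) := by
      rw [trace_eq_sum, Finset.mul_sum]
      refine Finset.sum_congr rfl fun i _ => ?_
      rw [Finset.sum_comm]
      simp only [← Finset.sum_mul]
      have : ∀ k, ∑ j, (gram (b y)).adjugate i j * gram (b y) j k =
          ((gram (b y)).det • (1 : Matrix (Fin n) (Fin n) ℝ)) i k := by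
        intro k
        rw [← h2, Matrix.mul_apply]
      simp [this, Matrix.one_apply]
    rw [e1, e2]; ring
  rw [(hdet.sqrt hpos.ne').fderiv]
  simp only [smul_apply, sum_apply, smul_eq_mul, h3]
  have hs := Real.mul_self_sqrt hpos.le
  have hs0 : Real.sqrt (gram (b y)).det ≠ 0 := (Real.sqrt_pos.2 hpos).ne'
  field_simp
  rw [sq, hs]

/-- The covariant derivative of the gradient represents the Hessian. -/
lemma IsLocalMetric.apply_fderiv_sharp (h : IsLocalMetric b Γ y) {f : Eu n → ℝ}
    (hf : ContDiffAt ℝ ∞ f y) (v w : Eu n) :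
    b y (fderiv ℝ (fun z => sharp (b z) (fderiv ℝ f z)) y v +
      Γ y v (sharp (b y) (fderiv ℝ f y))) w = hess Γ f y v w := by
  have hf2 : ContDiffAt ℝ ∞ (fderiv ℝ f) y := hf.fderiv_right (by norm_cast)
  have hN : DifferentiableAt ℝ (fun z => sharp (b z) (fderiv ℝ f z)) y :=
    (h.sharp_smooth le_rfl hf2).differentiableAt (by simp)
  have hbd : DifferentiableAt ℝ b y := h.smooth.differentiableAt (by simp)
  have e1 : HasFDerivAt (fun z => b z (sharp (b z) (fderiv ℝ f z)) w) _ y :=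
    (hbd.hasFDerivAt.clm_apply hN.hasFDerivAt).clm_apply (hasFDerivAt_const w y)
  have e2 : HasFDerivAt (fun z => fderiv ℝ f z w) _ y :=
    (hf2.differentiableAt (by simp)).hasFDerivAt.clm_apply (hasFDerivAt_const w y)
  have e3 : (fun z => b z (sharp (b z) (fderiv ℝ f z)) w) =ᶠ[𝓝 y] fun z => fderiv ℝ f z w :=
    h.scalarProduct.mono fun z hz => hz.apply_sharp _ _
  have e4 := DFunLike.congr_fun (e1.unique (e2.congr_of_eventuallyEq e3)) v
  simp at e4
  have hB := h.scalarProduct.self_of_nhds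
  rw [h.leviCivita.self_of_nhds.compat, hB.apply_sharp] at e4
  rw [map_add, add_apply, hess_apply]
  linarith

/-- The Laplacian in divergence form. -/
theorem IsLocalMetric.divergence_eq_lap (h : IsLocalMetric b Γ y) {f : Eu n → ℝ}
    (hf : ContDiffAt ℝ ∞ f y) :
    (Real.sqrt (gram (b y)).det)⁻¹ * ∑ i, partialD i (fun z => Real.sqrt (gram (b z)).det *
      sharp (b z) (fderiv ℝ f z) i) y = lap b Γ f y := by
  have hf2 : ContDiffAt ℝ ∞ (fderiv ℝ f) y := hf.fderiv_right (by norm_cast)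
  have hN : DifferentiableAt ℝ (fun z => sharp (b z) (fderiv ℝ f z)) y :=
    (h.sharp_smooth le_rfl hf2).differentiableAt (by simp)
  have hB := h.scalarProduct.self_of_nhds
  have hD : DifferentiableAt ℝ (fun z => Real.sqrt (gram (b z)).det) y :=
    (((contDiffAt_det h.gram_smooth).sqrt hB.det_pos.ne')).differentiableAt (by simp)
  have hs0 : Real.sqrt (gram (b y)).det ≠ 0 := (Real.sqrt_pos.2 hB.det_pos).ne'
  have hpart : ∀ i, partialD i (fun z => Real.sqrt (gram (b z)).det *
      sharp (b z) (fderiv ℝ f z) i) y = Real.sqrt (gram (b y)).det *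
      fderiv ℝ (fun z => sharp (b z) (fderiv ℝ f z)) y (EuclideanSpace.single i 1) i +
      sharp (b y) (fderiv ℝ f y) i * (Real.sqrt (gram (b y)).det *
        LinearMap.trace ℝ (Eu n) (Γ y (EuclideanSpace.single i 1) : Eu n →ₗ[ℝ] Eu n)) := by
    intro i
    have e1 : HasFDerivAt (fun z => sharp (b z) (fderiv ℝ f z) i) _ y :=
      (EuclideanSpace.proj i : Eu n →L[ℝ] ℝ).hasFDerivAt.comp y hN.hasFDerivAt
    rw [partialD, (hD.hasFDerivAt.fun_mul e1).fderiv, ← h.fderiv_sqrt_det]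
    simp
  have htr : ∑ i, sharp (b y) (fderiv ℝ f y) i *
      LinearMap.trace ℝ (Eu n) (Γ y (EuclideanSpace.single i 1) : Eu n →ₗ[ℝ] Eu n) =
      LinearMap.trace ℝ (Eu n) (Γ y (sharp (b y) (fderiv ℝ f y)) : Eu n →ₗ[ℝ] Eu n) := by
    conv_rhs => rw [sum_single (sharp (b y) (fderiv ℝ f y))]
    simp
  rw [lap, hB.metricTrace_eq
    ((fderiv ℝ (fun z => sharp (b z) (fderiv ℝ f z)) y : Eu n →ₗ[ℝ] Eu n) +
      (Γ y (sharp (b y) (fderiv ℝ f y)) : Eu n →ₗ[ℝ] Eu n)), map_add, ← htr, trace_eq_sum]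
  · simp only [hpart, Finset.sum_add_distrib, mul_add, Finset.mul_sum]
    congr 1
    · refine Finset.sum_congr rfl fun i _ => ?_
      rw [← mul_assoc, inv_mul_cancel₀ hs0, one_mul]; rfl
    · refine Finset.sum_congr rfl fun i _ => ?_
      field_simp
  · intro v w
    rw [← h.apply_fderiv_sharp hf, h.leviCivita.self_of_nhds.symm v]
    rfl

end Divergence

/-! ### Conformal change of curvature and Laplacian in coordinates -/

section ConformalChange

variable {n : ℕ} {b b' : Eu n → Eu n →L[ℝ] Eu n →L[ℝ] ℝ}
  {Γ Γ' : Eu n → Eu n →L[ℝ] Eu n →L[ℝ] Eu n} {y : Eu n} {φ : Eu n → ℝ}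

/-- The Levi-Civita connection of `e^{2φ} b`. -/
lemma IsLeviCivita.conformal (hΓ : IsLeviCivita b Γ y) (hΓ' : IsLeviCivita b' Γ' y)
    (hb : DifferentiableAt ℝ b y) (hb' : DifferentiableAt ℝ b' y)
    (hs : IsScalarProduct (b y)) (hφ : DifferentiableAt ℝ φ y)
    (h : ∀ᶠ z in 𝓝 y, ∀ v w, b' z v w = Real.exp (2 * φ z) * b z v w) (v w : Eu n) :
    Γ' y v w = Γ y v w + fderiv ℝ φ y v • w + fderiv ℝ φ y w • v -
      b y v w • sharp (b y) (fderiv ℝ φ y) := by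
  have hd : ∀ u v w, fderiv ℝ b' y u v w = Real.exp (2 * φ y) *
      (fderiv ℝ b y u v w + 2 * fderiv ℝ φ y u * b y v w) := by
    intro u v w
    have e1 : HasFDerivAt (fun x => b' x v w) _ y :=
      (hb'.hasFDerivAt.clm_apply (hasFDerivAt_const v y)).clm_apply (hasFDerivAt_const w y)
    have e2 : HasFDerivAt (fun x => Real.exp (2 * φ x) * b x v w) _ y :=
      ((hφ.hasFDerivAt.const_mul 2).exp).mul
        ((hb.hasFDerivAt.clm_apply (hasFDerivAt_const v y)).clm_apply (hasFDerivAt_const w y))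
    have e3 : (fun x => b' x v w) =ᶠ[𝓝 y] fun x => Real.exp (2 * φ x) * b x v w :=
      h.mono fun x hx => hx v w
    have e4 := DFunLike.congr_fun (e1.unique (e2.congr_of_eventuallyEq e3)) u
    simp at e4
    rw [e4]; ring
  have hz := h.self_of_nhds
  have hN := fun v => hs.apply_sharp (fderiv ℝ φ y) v
  have hN' : ∀ v, b y v (sharp (b y) (fderiv ℝ φ y)) = fderiv ℝ φ y v := fun v => by
    rw [hs.symm, hN]
  have hexp := Real.exp_pos (2 * φ y)
  -- the same symmetry argument as for the transformation law
  have key := eq_zero_of_symm_antisymm (t := fun u v w =>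
    b y (Γ' y u v - (Γ y u v + fderiv ℝ φ y u • v + fderiv ℝ φ y v • u -
      b y u v • sharp (b y) (fderiv ℝ φ y))) w)
    (fun u v w => by
      simp only [hΓ'.symm u v, hΓ.symm u v, hs.symm u v]
      congr 3
      abel)
    (fun u v w => by
      have e1 := hΓ'.compat u v w
      rw [hd, hΓ.compat, hz, hz, ← mul_add] at e1
      have e2 := mul_left_cancel₀ hexp.ne' e1
      simp only [map_sub, map_add, sub_apply, add_apply, map_smul, smul_apply, smul_eq_mul, hN]
      rw [hs.symm (Γ' y u w), hs.symm (Γ y u w), hs.symm w v]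
      linarith) v w
  exact hs.eq_of_forall fun w' => by
    have := key w'
    rw [map_sub, sub_apply, sub_eq_zero] at this
    exact this

lemma IsLocalMetric.conformal_conn (hm : IsLocalMetric b Γ y) (hm' : IsLocalMetric b' Γ' y)
    (hφ : ContDiffAt ℝ ∞ φ y)
    (h : ∀ᶠ z in 𝓝 y, ∀ v w, b' z v w = Real.exp (2 * φ z) * b z v w) :
    ∀ᶠ z in 𝓝 y, ∀ v w, Γ' z v w = Γ z v w + fderiv ℝ φ z v • w + fderiv ℝ φ z w • v -
      b z v w • sharp (b z) (fderiv ℝ φ z) := by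
  have h1 : (1 : ℕ∞ω) ≤ ∞ := by norm_cast
  filter_upwards [hm.leviCivita, hm'.leviCivita, hm.scalarProduct,
    (hm.smooth.of_le h1).eventually (by simp), (hm'.smooth.of_le h1).eventually (by simp),
    (hφ.of_le h1).eventually (by simp), h.eventually_nhds] with z h1 h2 h3 h4 h5 h6 h7
  exact h1.conformal h2 (h4.differentiableAt (by simp)) (h5.differentiableAt (by simp)) h3
    (h6.differentiableAt (by simp)) h7

/-- The conformal change of the curvature operator; here `∇_u N` is the covariant derivative of
the gradient `N` of `φ`. -/
lemma IsLocalMetric.riemann_conformal (hm : IsLocalMetric b Γ y) (hm' : IsLocalMetric b' Γ' y)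
    (hφ : ContDiffAt ℝ ∞ φ y)
    (h : ∀ᶠ z in 𝓝 y, ∀ v w, b' z v w = Real.exp (2 * φ z) * b z v w) {N : Eu n}
    (hN : N = sharp (b y) (fderiv ℝ φ y)) {dN : Eu n → Eu n}
    (hdN : ∀ u, dN u = fderiv ℝ (fun z => sharp (b z) (fderiv ℝ φ z)) y u + Γ y u N)
    (u v w : Eu n) :
    riemann Γ' y u v w = riemann Γ y u v w + hess Γ φ y u w • v - hess Γ φ y v w • u
      - b y v w • dN u + b y u w • dN v
      + (fderiv ℝ φ y v * fderiv ℝ φ y w) • u - (fderiv ℝ φ y u * fderiv ℝ φ y w) • v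
      - (fderiv ℝ φ y v * b y u w - fderiv ℝ φ y u * b y v w) • N
      - fderiv ℝ φ y N • (b y v w • u - b y u w • v) := by
  have hs := hm.scalarProduct.self_of_nhds
  have hlc := hm.leviCivita.self_of_nhds
  have hφ2 : ContDiffAt ℝ ∞ (fderiv ℝ φ) y := hφ.fderiv_right (by norm_cast)
  have hφ2d : DifferentiableAt ℝ (fderiv ℝ φ) y := hφ2.differentiableAt (by simp)
  have hNd : DifferentiableAt ℝ (fun z => sharp (b z) (fderiv ℝ φ z)) y :=
    (hm.sharp_smooth le_rfl hφ2).differentiableAt (by simp)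
  have hbd : DifferentiableAt ℝ b y := hm.smooth.differentiableAt (by simp)
  have hΓ : DifferentiableAt ℝ Γ y := hm.smooth_conn.differentiableAt (by simp)
  have hΓ' : DifferentiableAt ℝ Γ' y := hm'.smooth_conn.differentiableAt (by simp)
  have hlaw := hm.conformal_conn hm' hφ h
  have hNa : ∀ v, b y N v = fderiv ℝ φ y v := fun v => by rw [hN, hs.apply_sharp]
  have hNa' : ∀ v, b y v N = fderiv ℝ φ y v := fun v => by rw [hs.symm, hNa]
  have h2 : (2 : ℕ∞ω) ≤ ∞ := by norm_cast
  have hsymm : ∀ v w, fderiv ℝ (fderiv ℝ φ) y v w = fderiv ℝ (fderiv ℝ φ) y w v := fun v w =>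
    (hφ.isSymmSndFDerivAt (by simpa using h2)).eq v w
  have hd : ∀ u v w, fderiv ℝ Γ' y u v w = fderiv ℝ Γ y u v w +
      fderiv ℝ (fderiv ℝ φ) y u v • w + fderiv ℝ (fderiv ℝ φ) y u w • v
      - (b y (Γ y u v) w + b y v (Γ y u w)) • N
      - b y v w • (dN u - Γ y u N) := by
    intro u v w
    have e1 : HasFDerivAt (fun x => Γ' x v w) _ y :=
      (hΓ'.hasFDerivAt.clm_apply (hasFDerivAt_const v y)).clm_apply (hasFDerivAt_const w y)
    have e2 : HasFDerivAt (fun x => Γ x v w + fderiv ℝ φ x v • w + fderiv ℝ φ x w • v -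
        b x v w • sharp (b x) (fderiv ℝ φ x)) _ y :=
      ((((hΓ.hasFDerivAt.clm_apply (hasFDerivAt_const v y)).clm_apply (hasFDerivAt_const w y)).add
        ((hφ2d.hasFDerivAt.clm_apply (hasFDerivAt_const v y)).smul_const w)).add
        ((hφ2d.hasFDerivAt.clm_apply (hasFDerivAt_const w y)).smul_const v)).sub
        (((hbd.hasFDerivAt.clm_apply (hasFDerivAt_const v y)).clm_apply
          (hasFDerivAt_const w y)).smul hNd.hasFDerivAt)
    have e3 : (fun x => Γ' x v w) =ᶠ[𝓝 y] fun x => Γ x v w + fderiv ℝ φ x v • w +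
        fderiv ℝ φ x w • v - b x v w • sharp (b x) (fderiv ℝ φ x) :=
      hlaw.mono fun x hx => hx v w
    have e4 := DFunLike.congr_fun (e1.unique (e2.congr_of_eventuallyEq e3)) u
    simp at e4
    rw [e4, hlc.compat, hdN, ← hN]
    module
  have hz := hlaw.self_of_nhds
  rw [← hN] at hz
  simp only [riemann, hd, hz, hess_apply, map_add, map_sub, map_smul, hNa',
    hsymm u v, hlc.symm u v, hs.symm u v, smul_eq_mul]
  rw [hlc.symm u N, hlc.symm v N]
  module

/-- The conformal change of the Ricci form. -/
lemma IsLocalMetric.ricciForm_conformal (hm : IsLocalMetric b Γ y) (hm' : IsLocalMetric b' Γ' y)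
    (hφ : ContDiffAt ℝ ∞ φ y)
    (h : ∀ᶠ z in 𝓝 y, ∀ v w, b' z v w = Real.exp (2 * φ z) * b z v w) (v w : Eu n) :
    ricciForm Γ' y v w = ricciForm Γ y v w - ((n : ℝ) - 2) * hess Γ φ y v w
      - lap b Γ φ y * b y v w + ((n : ℝ) - 2) * (fderiv ℝ φ y v * fderiv ℝ φ y w)
      - ((n : ℝ) - 2) * gradInner b φ φ y * b y v w := by
  have hs := hm.scalarProduct.self_of_nhds
  set N := sharp (b y) (fderiv ℝ φ y) with hN
  set dN : Eu n →ₗ[ℝ] Eu n := (fderiv ℝ (fun z => sharp (b z) (fderiv ℝ φ z)) y : Eu n →ₗ[ℝ] Eu n) +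
    (Γ y N : Eu n →ₗ[ℝ] Eu n) with hdN
  have hlc := hm.leviCivita.self_of_nhds
  have hdN' : ∀ u, dN u = fderiv ℝ (fun z => sharp (b z) (fderiv ℝ φ z)) y u + Γ y u N := by
    intro u
    rw [hlc.symm u N]; rfl
  have hh : ∀ v w, b y (dN v) w = hess Γ φ y v w := by
    intro v w
    rw [hdN', hm.apply_fderiv_sharp hφ]
  have hNa : ∀ v, b y N v = fderiv ℝ φ y v := fun v => by rw [hN, hs.apply_sharp]
  have h2 : (2 : ℕ∞ω) ≤ ∞ := by norm_cast
  have hsymm : hess Γ φ y v w = hess Γ φ y w v := by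
    rw [hess_apply, hess_apply, hlc.symm, (hφ.isSymmSndFDerivAt (by simpa using h2)).eq v w]
  have hop : riemannOp Γ' y v w = riemannOp Γ y v w
      + ((hess Γ φ y).flip w).smulRight v - hess Γ φ y v w • LinearMap.id
      - b y v w • dN + ((b y w : Eu n →L[ℝ] ℝ) : Eu n →ₗ[ℝ] ℝ).smulRight (dN v)
      + (fderiv ℝ φ y v * fderiv ℝ φ y w) • LinearMap.id
      - fderiv ℝ φ y w • ((fderiv ℝ φ y : Eu n →L[ℝ] ℝ) : Eu n →ₗ[ℝ] ℝ).smulRight v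
      - fderiv ℝ φ y v • ((b y w : Eu n →L[ℝ] ℝ) : Eu n →ₗ[ℝ] ℝ).smulRight N
      + b y v w • ((fderiv ℝ φ y : Eu n →L[ℝ] ℝ) : Eu n →ₗ[ℝ] ℝ).smulRight N
      - fderiv ℝ φ y N • (b y v w • LinearMap.id -
        ((b y w : Eu n →L[ℝ] ℝ) : Eu n →ₗ[ℝ] ℝ).smulRight v) := by
    ext1 u
    change riemann Γ' y u v w = _
    rw [hm.riemann_conformal hm' hφ h hN hdN']
    simp only [LinearMap.add_apply, LinearMap.sub_apply, LinearMap.smul_apply,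
      LinearMap.smulRight_apply, LinearMap.flip_apply, LinearMap.id_apply,
      ContinuousLinearMap.coe_coe, hs.symm u w]
    change riemann Γ y u v w + _ - _ - _ + _ + _ - _ - _ - _ =
      riemann Γ y u v w + _ - _ - _ + _ + _ - _ - _ + _ - _
    module
  have htr : LinearMap.trace ℝ (Eu n) dN = lap b Γ φ y := (hs.metricTrace_eq dN hh).symm
  rw [ricciForm_apply, hop]
  simp only [map_add, map_sub, map_smul, LinearMap.trace_smulRight, LinearMap.trace_id,
    finrank_euclideanSpace, Fintype.card_fin, htr, ← ricciForm_apply, smul_eq_mul,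
    ContinuousLinearMap.coe_coe, LinearMap.flip_apply, hsymm]
  rw [hs.symm w (dN v), hh, hsymm, hs.symm w N, hNa, hs.symm w v, gradInner, ← hN]
  ring

lemma metricTrace_congr_mul {B B' : Eu n →L[ℝ] Eu n →L[ℝ] ℝ} {c : ℝ} (hc : c ≠ 0)
    (hB : IsScalarProduct B) (h : ∀ v w, B' v w = c * B v w) (k : Eu n → Eu n → ℝ) :
    c * metricTrace B' k = metricTrace B k := by
  have h1 : gram B' = c • gram B := by
    ext i j
    simp [gram, h]
  have h2 : (gram B')⁻¹ = c⁻¹ • (gram B)⁻¹ := by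
    rw [h1]
    refine Matrix.inv_eq_left_inv ?_
    rw [Matrix.smul_mul, Matrix.mul_smul, smul_smul, inv_mul_cancel₀ hc, one_smul,
      Matrix.nonsing_inv_mul _ hB.det_pos.ne'.isUnit]
  simp only [metricTrace, h2, Finset.mul_sum, Matrix.smul_apply, smul_eq_mul]
  refine Finset.sum_congr rfl fun i _ => Finset.sum_congr rfl fun j _ => ?_
  field_simp

lemma metricTrace_self {B : Eu n →L[ℝ] Eu n →L[ℝ] ℝ} (hB : IsScalarProduct B) :
    metricTrace B (fun v w => B v w) = n := by
  rw [hB.metricTrace_eq (h := fun v w => B v w) LinearMap.id (fun v w => rfl),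
    LinearMap.trace_id]
  simp

lemma metricTrace_mul {B : Eu n →L[ℝ] Eu n →L[ℝ] ℝ} (hB : IsScalarProduct B)
    (a c : Eu n →L[ℝ] ℝ) : metricTrace B (fun v w => a v * c w) = a (sharp B c) := by
  rw [hB.metricTrace_eq ((a : Eu n →ₗ[ℝ] ℝ).smulRight (sharp B c)) (fun v w => by
    simp [hB.apply_sharp]), LinearMap.trace_smulRight]
  rfl

lemma metricTrace_add (B : Eu n →L[ℝ] Eu n →L[ℝ] ℝ) (h k : Eu n → Eu n → ℝ) :
    metricTrace B (fun v w => h v w + k v w) = metricTrace B h + metricTrace B k := by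
  simp only [metricTrace, mul_add, Finset.sum_add_distrib]

lemma metricTrace_const_mul (B : Eu n →L[ℝ] Eu n →L[ℝ] ℝ) (c : ℝ) (h : Eu n → Eu n → ℝ) :
    metricTrace B (fun v w => c * h v w) = c * metricTrace B h := by
  simp only [metricTrace, Finset.mul_sum]
  refine Finset.sum_congr rfl fun i _ => Finset.sum_congr rfl fun j _ => ?_
  ring

lemma gradInner_comm (hs : IsScalarProduct (b y)) (f k : Eu n → ℝ) :
    gradInner b f k y = gradInner b k f y := by
  rw [gradInner, gradInner, ← hs.apply_sharp (fderiv ℝ f y), hs.symm, hs.apply_sharp]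

/-- The scalar curvature of `e^{2φ} b`. -/
theorem IsLocalMetric.scal_conformal (hm : IsLocalMetric b Γ y) (hm' : IsLocalMetric b' Γ' y)
    (hφ : ContDiffAt ℝ ∞ φ y)
    (h : ∀ᶠ z in 𝓝 y, ∀ v w, b' z v w = Real.exp (2 * φ z) * b z v w) :
    Real.exp (2 * φ y) * scal b' Γ' y = scal b Γ y - 2 * ((n : ℝ) - 1) * lap b Γ φ y
      - ((n : ℝ) - 1) * ((n : ℝ) - 2) * gradInner b φ φ y := by
  have hs := hm.scalarProduct.self_of_nhds
  rw [scal, metricTrace_congr_mul (Real.exp_pos _).ne' hs h.self_of_nhds]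
  have h1 : (fun v w => ricciForm Γ' y v w) = fun v w => (((ricciForm Γ y v w
      + (-((n : ℝ) - 2)) * hess Γ φ y v w) + (-lap b Γ φ y) * b y v w) +
      ((n : ℝ) - 2) * (fderiv ℝ φ y v * fderiv ℝ φ y w))
      + (-(((n : ℝ) - 2) * gradInner b φ φ y)) * b y v w := by
    ext v w
    rw [hm.ricciForm_conformal hm' hφ h]
    ring
  rw [h1]
  simp only [metricTrace_add, metricTrace_const_mul, metricTrace_self hs, metricTrace_mul hs]
  rw [← gradInner, ← scal, ← lap]
  ring

/-- The Laplacian of `e^{2φ} b`. -/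
theorem IsLocalMetric.lap_conformal (hm : IsLocalMetric b Γ y) (hm' : IsLocalMetric b' Γ' y)
    (hφ : ContDiffAt ℝ ∞ φ y)
    (h : ∀ᶠ z in 𝓝 y, ∀ v w, b' z v w = Real.exp (2 * φ z) * b z v w) (f : Eu n → ℝ) :
    Real.exp (2 * φ y) * lap b' Γ' f y = lap b Γ f y + ((n : ℝ) - 2) * gradInner b φ f y := by
  have hs := hm.scalarProduct.self_of_nhds
  rw [lap, metricTrace_congr_mul (Real.exp_pos _).ne' hs h.self_of_nhds]
  have h1 : (fun v w => hess Γ' f y v w) = fun v w => ((hess Γ f y v w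
      + (-1) * (fderiv ℝ φ y v * fderiv ℝ f y w)) + (-1) * (fderiv ℝ f y v * fderiv ℝ φ y w)) +
      gradInner b f φ y * b y v w := by
    ext v w
    rw [hess_apply, hess_apply, (hm.conformal_conn hm' hφ h).self_of_nhds]
    simp only [map_add, map_sub, map_smul, smul_eq_mul, gradInner]
    ring
  rw [h1]
  simp only [metricTrace_add, metricTrace_const_mul, metricTrace_self hs, metricTrace_mul hs]
  rw [← gradInner, ← gradInner, ← lap, gradInner_comm hs f φ]
  ring

/-- Leibniz rule for the Laplacian. -/
lemma IsLocalMetric.lap_mul (hm : IsLocalMetric b Γ y) {f k : Eu n → ℝ}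
    (hf : ContDiffAt ℝ ∞ f y) (hk : ContDiffAt ℝ ∞ k y) :
    lap b Γ (fun z => f z * k z) y =
      f y * lap b Γ k y + 2 * gradInner b f k y + k y * lap b Γ f y := by
  have hs := hm.scalarProduct.self_of_nhds
  have h1 : (1 : ℕ∞ω) ≤ ∞ := by norm_cast
  have hfd : DifferentiableAt ℝ f y := hf.differentiableAt (by simp)
  have hkd : DifferentiableAt ℝ k y := hk.differentiableAt (by simp)
  have hf2 : DifferentiableAt ℝ (fderiv ℝ f) y :=
    (hf.fderiv_right (m := 1) (by norm_cast)).differentiableAt (by simp)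
  have hk2 : DifferentiableAt ℝ (fderiv ℝ k) y :=
    (hk.fderiv_right (m := 1) (by norm_cast)).differentiableAt (by simp)
  have hd : fderiv ℝ (fun z => f z * k z) =ᶠ[𝓝 y]
      fun z => f z • fderiv ℝ k z + k z • fderiv ℝ f z := by
    filter_upwards [(hf.of_le h1).eventually (by simp), (hk.of_le h1).eventually (by simp)]
      with z hz hz'
    exact ((hz.differentiableAt (by simp)).hasFDerivAt.fun_mul
      (hz'.differentiableAt (by simp)).hasFDerivAt).fderiv
  have hd2 : HasFDerivAt (fun z => f z • fderiv ℝ k z + k z • fderiv ℝ f z) _ y :=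
    (hfd.hasFDerivAt.fun_smul hk2.hasFDerivAt).fun_add (hkd.hasFDerivAt.fun_smul hf2.hasFDerivAt)
  have h1 : (fun v w => hess Γ (fun z => f z * k z) y v w) = fun v w => ((f y * hess Γ k y v w
      + k y * hess Γ f y v w) + 1 * (fderiv ℝ f y v * fderiv ℝ k y w)) +
      1 * (fderiv ℝ k y v * fderiv ℝ f y w) := by
    ext v w
    rw [hess_apply, hd.fderiv_eq, hd2.fderiv, hd.self_of_nhds]
    simp [hess_apply]
    ring
  rw [lap, h1]
  simp only [metricTrace_add, metricTrace_const_mul, metricTrace_mul hs]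
  rw [← gradInner, ← gradInner, ← lap, ← lap, gradInner_comm hs k f]
  ring

/-- Chain rule for the Laplacian of a multiple of the logarithm. -/
lemma IsLocalMetric.lap_log (hm : IsLocalMetric b Γ y) {f : Eu n → ℝ}
    (hf : ContDiffAt ℝ ∞ f y) (h0 : 0 < f y) (c : ℝ) :
    lap b Γ (fun z => c * Real.log (f z)) y =
      c * ((f y)⁻¹ * lap b Γ f y - (f y)⁻¹ ^ 2 * gradInner b f f y) := by
  have hs := hm.scalarProduct.self_of_nhds
  have h1 : (1 : ℕ∞ω) ≤ ∞ := by norm_cast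
  have hfd : DifferentiableAt ℝ f y := hf.differentiableAt (by simp)
  have hf2 : DifferentiableAt ℝ (fderiv ℝ f) y :=
    (hf.fderiv_right (m := 1) (by norm_cast)).differentiableAt (by simp)
  have hd : fderiv ℝ (fun z => c * Real.log (f z)) =ᶠ[𝓝 y]
      fun z => (c * (f z)⁻¹) • fderiv ℝ f z := by
    filter_upwards [(hf.of_le h1).eventually (by simp),
      hf.continuousAt.eventually (lt_mem_nhds h0)] with z hz hz'
    rw [(((hz.differentiableAt (by simp)).hasFDerivAt.log hz'.ne').const_mul c).fderiv, smul_smul]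
  have hd2 : HasFDerivAt (fun z => (c * (f z)⁻¹) • fderiv ℝ f z) _ y :=
    (((hasDerivAt_inv h0.ne').comp_hasFDerivAt y hfd.hasFDerivAt).const_mul c).fun_smul
      hf2.hasFDerivAt
  have h1 : (fun v w => hess Γ (fun z => c * Real.log (f z)) y v w) = fun v w =>
      (c * (f y)⁻¹) * hess Γ f y v w + (-(c * (f y)⁻¹ ^ 2)) *
        (fderiv ℝ f y v * fderiv ℝ f y w) := by
    ext v w
    rw [hess_apply, hd.fderiv_eq, hd2.fderiv, hd.self_of_nhds]
    simp [hess_apply]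
    ring
  rw [lap, h1]
  simp only [metricTrace_add, metricTrace_const_mul, metricTrace_mul hs]
  rw [← gradInner, ← lap]
  ring

/-- The conformal covariance of `-Δ + c_n R`, in coordinates. -/
theorem IsLocalMetric.conformal_covariance (hn : 3 ≤ n) (hm : IsLocalMetric b Γ y)
    (hm' : IsLocalMetric b' Γ' y) {μ f : Eu n → ℝ} (hμ : ContDiffAt ℝ ∞ μ y) (h0 : 0 < μ y)
    (h : ∀ᶠ z in 𝓝 y, ∀ v w, b' z v w = μ z ^ (4 / ((n : ℝ) - 2)) * b z v w)
    (hf : ContDiffAt ℝ ∞ f y) :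
    μ y ^ (4 / ((n : ℝ) - 2)) * μ y * (-lap b' Γ' f y + confConst n * scal b' Γ' y * f y) =
      -lap b Γ (fun z => μ z * f z) y + confConst n * scal b Γ y * (μ y * f y) := by
  have hs := hm.scalarProduct.self_of_nhds
  have hn2 : (0 : ℝ) < (n : ℝ) - 2 := by
    have : (3 : ℝ) ≤ n := by exact_mod_cast hn
    linarith
  -- `φ` is chosen such that `μ^{4/(n-2)} = e^{2φ}`
  set c : ℝ := 2 / ((n : ℝ) - 2) with hc
  set φ : Eu n → ℝ := fun z => c * Real.log (μ z) with hφ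
  have hφ' : ContDiffAt ℝ ∞ φ y := contDiffAt_const.mul (hμ.log h0.ne')
  have hexp : ∀ z, 0 < μ z → μ z ^ (4 / ((n : ℝ) - 2)) = Real.exp (2 * φ z) := by
    intro z hz
    rw [Real.rpow_def_of_pos hz, hφ, hc]
    congr 1
    ring
  have h' : ∀ᶠ z in 𝓝 y, ∀ v w, b' z v w = Real.exp (2 * φ z) * b z v w := by
    filter_upwards [h, hμ.continuousAt.eventually (lt_mem_nhds h0)] with z hz hz' v w
    rw [hz, hexp z hz']
  have hμd : DifferentiableAt ℝ μ y := hμ.differentiableAt (by simp)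
  have hdφ : fderiv ℝ φ y = (c * (μ y)⁻¹) • fderiv ℝ μ y := by
    rw [((hμd.hasFDerivAt.log h0.ne').const_mul c).fderiv, smul_smul]
  have hg1 : gradInner b φ f y = c * (μ y)⁻¹ * gradInner b μ f y := by
    rw [gradInner, hdφ]; rfl
  have hg2 : gradInner b φ φ y = (c * (μ y)⁻¹) ^ 2 * gradInner b μ μ y := by
    rw [gradInner_comm hs, gradInner, gradInner_comm hs μ, gradInner, hdφ, sharp, sharp, map_smul]
    simp
    ring
  have e1 := hm.scal_conformal hm' hφ' h'
  have e2 := hm.lap_conformal hm' hφ' h' f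
  rw [hm.lap_log hμ h0, hg2] at e1
  rw [hg1] at e2
  rw [hm.lap_mul hμ hf, hexp y h0]
  have hn1 : (0 : ℝ) < (n : ℝ) - 1 := by linarith
  have e3 : Real.exp (2 * φ y) * μ y * (-lap b' Γ' f y + confConst n * scal b' Γ' y * f y) =
      -μ y * (Real.exp (2 * φ y) * lap b' Γ' f y) +
      confConst n * μ y * f y * (Real.exp (2 * φ y) * scal b' Γ' y) := by ring
  rw [e3, e1, e2, confConst, hc]
  field_simp
  ring

end ConformalChange

/-! ### From coordinates to the manifold -/

section SmoothInvariants

variable {n : ℕ} {b : Eu n → Eu n →L[ℝ] Eu n →L[ℝ] ℝ} {Γ : Eu n → Eu n →L[ℝ] Eu n →L[ℝ] Eu n}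
  {y : Eu n}

lemma IsLocalMetric.contDiffAt_metricTrace (hm : IsLocalMetric b Γ y) {h : Eu n → Eu n → Eu n → ℝ}
    (hh : ∀ v w, ContDiffAt ℝ ∞ (fun z => h z v w) y) :
    ContDiffAt ℝ ∞ (fun z => metricTrace (b z) (h z)) y := by
  refine ContDiffAt.sum fun j _ => ContDiffAt.sum fun k _ => ?_
  exact (contDiffAt_inv_apply hm.gram_smooth hm.scalarProduct.self_of_nhds.det_pos.ne' j k).mul
    (hh _ _)

lemma contDiffAt_coord {f : Eu n → Eu n} (hf : ContDiffAt ℝ ∞ f y) (i : Fin n) :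
    ContDiffAt ℝ ∞ (fun z => f z i) y :=
  (EuclideanSpace.proj i : Eu n →L[ℝ] ℝ).contDiff.contDiffAt.comp y hf

set_option maxSynthPendingDepth 4 in
lemma IsLocalMetric.contDiffAt_scal (hm : IsLocalMetric b Γ y) :
    ContDiffAt ℝ ∞ (fun z => scal b Γ z) y := by
  refine hm.contDiffAt_metricTrace fun v w => ?_
  simp only [ricciForm_apply, trace_eq_sum]
  refine ContDiffAt.sum fun i _ => contDiffAt_coord (f := fun z =>
    riemann Γ z (EuclideanSpace.single i 1) v w) ?_ i
  have hΓ := hm.smooth_conn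
  have hΓ2 : ContDiffAt ℝ ∞ (fderiv ℝ Γ) y := hΓ.fderiv_right (by norm_cast)
  have h1 : ∀ u v w, ContDiffAt ℝ ∞ (fun z => fderiv ℝ Γ z u v w) y := fun u v w =>
    ((hΓ2.clm_apply contDiffAt_const).clm_apply contDiffAt_const).clm_apply contDiffAt_const
  have h2 : ∀ u v w, ContDiffAt ℝ ∞ (fun z => Γ z u (Γ z v w)) y := fun u v w =>
    (hΓ.clm_apply contDiffAt_const).clm_apply
      ((hΓ.clm_apply contDiffAt_const).clm_apply contDiffAt_const)
  exact (((h1 _ _ _).sub (h1 _ _ _)).add (h2 _ _ _)).sub (h2 _ _ _)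

lemma IsLocalMetric.contDiffAt_lap (hm : IsLocalMetric b Γ y) {f : Eu n → ℝ}
    (hf : ContDiffAt ℝ ∞ f y) : ContDiffAt ℝ ∞ (fun z => lap b Γ f z) y := by
  refine hm.contDiffAt_metricTrace fun v w => ?_
  have hf2 : ContDiffAt ℝ ∞ (fderiv ℝ f) y := hf.fderiv_right (by norm_cast)
  have hf3 : ContDiffAt ℝ ∞ (fderiv ℝ (fderiv ℝ f)) y := hf2.fderiv_right (by norm_cast)
  simp only [hess_apply]
  exact ((hf3.clm_apply contDiffAt_const).clm_apply contDiffAt_const).sub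
    (hf2.clm_apply ((hm.smooth_conn.clm_apply contDiffAt_const).clm_apply contDiffAt_const))

lemma IsLocalMetric.contDiffAt_gradInner (hm : IsLocalMetric b Γ y) {f k : Eu n → ℝ}
    (hf : ContDiffAt ℝ ∞ f y) (hk : ContDiffAt ℝ ∞ k y) :
    ContDiffAt ℝ ∞ (fun z => gradInner b f k z) y :=
  (hf.fderiv_right (m := ∞) (by norm_cast)).clm_apply
    (hm.sharp_smooth le_rfl (hk.fderiv_right (m := ∞) (by norm_cast)))

end SmoothInvariants

section Charts

variable {n : ℕ} {M : Type*} [TopologicalSpace M] [ChartedSpace (Eu n) M]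

/-- The change of coordinates from the preferred chart at `p` to the one at `q`. -/
def coordTransition (p q : M) : Eu n → Eu n := extChartAt (𝓡 n) q ∘ (extChartAt (𝓡 n) p).symm

lemma coordTransition_mem {p q : M} {y : Eu n}
    (hq : (extChartAt (𝓡 n) p).symm y ∈ (extChartAt (𝓡 n) q).source) :
    coordTransition p q y ∈ (extChartAt (𝓡 n) q).target :=
  (extChartAt (𝓡 n) q).map_source hq

lemma comp_symm_transition (u : M → ℝ) {p q : M} {y : Eu n}
    (hy : y ∈ (extChartAt (𝓡 n) p).target)
    (hq : (extChartAt (𝓡 n) p).symm y ∈ (extChartAt (𝓡 n) q).source) :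
    (u ∘ (extChartAt (𝓡 n) p).symm) =ᶠ[𝓝 y]
      (u ∘ (extChartAt (𝓡 n) q).symm) ∘ coordTransition p q := by
  have hc : ContinuousAt (extChartAt (𝓡 n) p).symm y :=
    (continuousOn_extChartAt_symm p).continuousAt ((isOpen_extChartAt_target p).mem_nhds hy)
  filter_upwards [hc.eventually ((isOpen_extChartAt_source q).mem_nhds hq)] with z hz
  simp only [Function.comp_apply, coordTransition]
  rw [(extChartAt (𝓡 n) q).left_inv hz]

lemma transition_data {p x : M} (hx : x ∈ (extChartAt (𝓡 n) p).source) :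
    (extChartAt (𝓡 n) x).symm (extChartAt (𝓡 n) x x) ∈ (extChartAt (𝓡 n) p).source ∧
      coordTransition x p (extChartAt (𝓡 n) x x) = extChartAt (𝓡 n) p x := by
  rw [coordTransition, Function.comp_apply, extChartAt_to_inv]
  exact ⟨hx, rfl⟩

/-- A function is smooth if near each point it is smooth in the preferred chart at this point. -/
lemma contMDiff_of_chart {F : M → ℝ} {k : M → Eu n → ℝ}
    (hk : ∀ p, ContDiffAt ℝ ∞ (k p) (extChartAt (𝓡 n) p p))
    (h : ∀ p, ∀ x ∈ (extChartAt (𝓡 n) p).source, F x = k p (extChartAt (𝓡 n) p x)) :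
    ContMDiff (𝓡 n) 𝓘(ℝ) ∞ F := by
  intro p
  have h1 : ContMDiffAt (𝓡 n) 𝓘(ℝ) ∞ (k p ∘ extChartAt (𝓡 n) p) p :=
    (contMDiffAt_iff_contDiffAt.2 (hk p)).comp p contMDiffAt_extChartAt
  refine h1.congr_of_eventuallyEq ?_
  filter_upwards [extChartAt_source_mem_nhds (I := 𝓡 n) p] with x hx using h p x hx

variable [IsManifold (𝓡 n) ∞ M]

/-- The metric in the preferred chart at `p`, as a field of bilinear forms. -/
def metricIn (g : Metric n M) (p : M) (y : Eu n) : Eu n →L[ℝ] Eu n →L[ℝ] ℝ := formOf (gMat g p y)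

/-- The Levi-Civita connection in the preferred chart at `p`. -/
def connIn (g : Metric n M) (p : M) (y : Eu n) : Eu n →L[ℝ] Eu n →L[ℝ] Eu n :=
  bilMapOf fun k i j => christoffel g p k i j y

lemma coordVec_contMDiffAt (p : M) (i : Fin n) {x : M} (hx : x ∈ (chartAt (Eu n) p).source) :
    ContMDiffAt (𝓡 n) ((𝓡 n).prod 𝓘(ℝ, Eu n)) ∞
      (fun x => Bundle.TotalSpace.mk' (Eu n) (E := (TangentSpace (𝓡 n) : M → Type _)) x
        (coordVec p i x)) x := by
  have hb : x ∈ (trivializationAt (Eu n) (TangentSpace (𝓡 n) : M → Type _) p).baseSet := hx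
  rw [(trivializationAt (Eu n) (TangentSpace (𝓡 n) : M → Type _) p).contMDiffAt_section_iff hb]
  refine (contMDiffAt_const
    (c := (EuclideanSpace.single i (1 : ℝ) : Eu n))).congr_of_eventuallyEq ?_
  filter_upwards [(chartAt (Eu n) p).open_source.mem_nhds hx] with z hz
  have hz' : z ∈ (trivializationAt (Eu n) (TangentSpace (𝓡 n) : M → Type _) p).baseSet := hz
  simp only [coordVec]
  rw [Bundle.Trivialization.symmL_apply _ hz', Bundle.Trivialization.apply_mk_symm _ hz']

lemma inner_coordVec_contMDiffAt (g : Metric n M) (p : M) (i j : Fin n) {x : M}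
    (hx : x ∈ (chartAt (Eu n) p).source) :
    ContMDiffAt (𝓡 n) 𝓘(ℝ) ∞ (fun x => g.inner x (coordVec p i x) (coordVec p j x)) x := by
  have h := ContMDiffAt.clm_bundle_apply₂ (F₃ := ℝ) (E₃ := Bundle.Trivial M ℝ) (b := fun x : M => x)
    (ψ := g.inner) g.contMDiff.contMDiffAt (coordVec_contMDiffAt p i hx)
    (coordVec_contMDiffAt p j hx)
  rw [Bundle.contMDiffAt_totalSpace] at h
  exact h.2

lemma gMat_contDiffOn (g : Metric n M) (p : M) (i j : Fin n) :
    ContDiffOn ℝ ∞ (fun y => gMat g p y i j) (extChartAt (𝓡 n) p).target := by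
  rw [← contMDiffOn_iff_contDiffOn]
  intro y hy
  have hx : (extChartAt (𝓡 n) p).symm y ∈ (chartAt (Eu n) p).source := by
    rw [← extChartAt_source (𝓡 n)]; exact (extChartAt (𝓡 n) p).map_target hy
  exact (inner_coordVec_contMDiffAt g p i j hx).comp_contMDiffWithinAt y
    (contMDiffOn_extChartAt_symm p y hy)

/-- The metric in a chart, through the trivialization of the tangent bundle. -/
lemma metricIn_apply (g : Metric n M) (p : M) (y v w : Eu n) :
    metricIn g p y v w = g.inner ((extChartAt (𝓡 n) p).symm y)
      ((trivializationAt (Eu n) (TangentSpace (𝓡 n) : M → Type _) p).symmL ℝ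
        ((extChartAt (𝓡 n) p).symm y) v)
      ((trivializationAt (Eu n) (TangentSpace (𝓡 n) : M → Type _) p).symmL ℝ
        ((extChartAt (𝓡 n) p).symm y) w) := by
  conv_rhs => rw [sum_single v, sum_single w]
  rw [metricIn, formOf_apply]
  simp only [map_sum, map_smul, sum_apply, smul_apply, smul_eq_mul, gMat, Matrix.of_apply,
    Finset.mul_sum, coordVec]
  rw [Finset.sum_comm]
  refine Finset.sum_congr rfl fun i _ => Finset.sum_congr rfl fun j _ => ?_
  ring

lemma symmL_injective (p : M) {x : M} (hx : x ∈ (chartAt (Eu n) p).source) {v : Eu n}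
    (h : (trivializationAt (Eu n) (TangentSpace (𝓡 n) : M → Type _) p).symmL ℝ x v = 0) :
    v = 0 := by
  have hb : x ∈ (trivializationAt (Eu n) (TangentSpace (𝓡 n) : M → Type _) p).baseSet := hx
  have h1 := (trivializationAt (Eu n) (TangentSpace (𝓡 n) : M →
    Type _) p).continuousLinearMapAt_symmL (R := ℝ) hb v
  rw [h, map_zero] at h1
  exact h1.symm

lemma isScalarProduct_metricIn (g : Metric n M) (p : M) {y : Eu n}
    (hy : y ∈ (extChartAt (𝓡 n) p).target) : IsScalarProduct (metricIn g p y) := by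
  have hx : (extChartAt (𝓡 n) p).symm y ∈ (chartAt (Eu n) p).source := by
    rw [← extChartAt_source (𝓡 n)]; exact (extChartAt (𝓡 n) p).map_target hy
  constructor
  · intro v w
    rw [metricIn_apply, metricIn_apply, g.symm]
  · intro v hv
    rw [metricIn_apply]
    exact g.pos _ _ fun h => hv (symmL_injective p hx h)

lemma isLocalMetric_metricIn (g : Metric n M) (p : M) {y : Eu n}
    (hy : y ∈ (extChartAt (𝓡 n) p).target) : IsLocalMetric (metricIn g p) (connIn g p) y :=
  isLocalMetric_formOf (isOpen_extChartAt_target p) (gMat_contDiffOn g p)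
    (fun z hz => by
      have := (isScalarProduct_metricIn g p hz).posDef
      rwa [metricIn, gram_formOf] at this) hy

lemma coordTransition_contDiffAt {p q : M} {y : Eu n} (hy : y ∈ (extChartAt (𝓡 n) p).target)
    (hq : (extChartAt (𝓡 n) p).symm y ∈ (extChartAt (𝓡 n) q).source) :
    ContDiffAt ℝ ∞ (coordTransition p q) y := by
  rw [← contMDiffAt_iff_contDiffAt]
  rw [extChartAt_source] at hq
  exact (contMDiffAt_extChartAt' hq).comp y ((contMDiffOn_extChartAt_symm p).contMDiffAt
    ((isOpen_extChartAt_target p).mem_nhds hy))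

/-- The transformation law of the metric under a change of charts. -/
lemma metricIn_transition (g : Metric n M) {p q : M} {y : Eu n}
    (hy : y ∈ (extChartAt (𝓡 n) p).target)
    (hq : (extChartAt (𝓡 n) p).symm y ∈ (extChartAt (𝓡 n) q).source) (v w : Eu n) :
    metricIn g p y v w = metricIn g q (coordTransition p q y)
      (fderiv ℝ (coordTransition p q) y v) (fderiv ℝ (coordTransition p q) y w) := by
  set x := (extChartAt (𝓡 n) p).symm y with hxdef
  have hxp : x ∈ (extChartAt (𝓡 n) p).source := (extChartAt (𝓡 n) p).map_target hy
  have hxp' : x ∈ (chartAt (Eu n) p).source := by rwa [← extChartAt_source (𝓡 n)]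
  have hxq' : x ∈ (chartAt (Eu n) q).source := by rwa [← extChartAt_source (𝓡 n)]
  have hback : (extChartAt (𝓡 n) q).symm (coordTransition p q y) = x :=
    (extChartAt (𝓡 n) q).left_inv hq
  have hyx : extChartAt (𝓡 n) p x = y := (extChartAt (𝓡 n) p).right_inv hy
  have hf : ∀ v, fderiv ℝ (coordTransition p q) y v = tangentCoordChange (𝓡 n) p q x v := by
    intro v
    rw [tangentCoordChange_def, hyx]
    simp [coordTransition]
  have hs : ∀ v : Eu n,
      (trivializationAt (Eu n) (TangentSpace (𝓡 n) : M → Type _) p).symmL ℝ x v =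
      (trivializationAt (Eu n) (TangentSpace (𝓡 n) : M → Type _) q).symmL ℝ x
        (tangentCoordChange (𝓡 n) p q x v) := by
    intro v
    rw [TangentBundle.symmL_trivializationAt_eq_core hxp',
      TangentBundle.symmL_trivializationAt_eq_core hxq']
    exact (tangentCoordChange_comp ⟨⟨hxp, hq⟩, mem_extChartAt_source x⟩).symm
  rw [metricIn_apply, metricIn_apply, hback, hf, hf, ← hs, ← hs]

lemma metricIn_transition_eventually (g : Metric n M) {p q : M} {y : Eu n}
    (hy : y ∈ (extChartAt (𝓡 n) p).target)
    (hq : (extChartAt (𝓡 n) p).symm y ∈ (extChartAt (𝓡 n) q).source) :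
    ∀ᶠ z in 𝓝 y, ∀ v w, metricIn g p z v w = metricIn g q (coordTransition p q z)
      (fderiv ℝ (coordTransition p q) z v) (fderiv ℝ (coordTransition p q) z w) := by
  have hc : ContinuousAt (extChartAt (𝓡 n) p).symm y :=
    (continuousOn_extChartAt_symm p).continuousAt ((isOpen_extChartAt_target p).mem_nhds hy)
  filter_upwards [(isOpen_extChartAt_target p).mem_nhds hy,
    hc.eventually ((isOpen_extChartAt_source q).mem_nhds hq)] with z hz hz' v w
  exact metricIn_transition g hz hz' v w

lemma contDiffAt_comp_symm {u : M → ℝ} (hu : ContMDiff (𝓡 n) 𝓘(ℝ) ∞ u) {p : M} {y : Eu n}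
    (hy : y ∈ (extChartAt (𝓡 n) p).target) :
    ContDiffAt ℝ ∞ (u ∘ (extChartAt (𝓡 n) p).symm) y := by
  rw [← contMDiffAt_iff_contDiffAt]
  exact hu.contMDiffAt.comp y ((contMDiffOn_extChartAt_symm p).contMDiffAt
    ((isOpen_extChartAt_target p).mem_nhds hy))

lemma christoffel_contDiffAt (g : Metric n M) (p : M) {y : Eu n}
    (hy : y ∈ (extChartAt (𝓡 n) p).target) (k i j : Fin n) :
    ContDiffAt ℝ ∞ (christoffel g p k i j) y := by
  have h := contDiffAt_coord (((isLocalMetric_metricIn g p hy).smooth_conn.clm_apply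
    (contDiffAt_const (c := EuclideanSpace.single i 1))).clm_apply
    (contDiffAt_const (c := EuclideanSpace.single j 1))) k
  simpa only [connIn, bilMapOf_single] using h

lemma ricci_eq (g : Metric n M) (p : M) {y : Eu n} (hy : y ∈ (extChartAt (𝓡 n) p).target)
    (j k : Fin n) : ricci g p j k y =
      ricciForm (connIn g p) y (EuclideanSpace.single j 1) (EuclideanSpace.single k 1) := by
  have hd : ∀ k i j, DifferentiableAt ℝ (fun z => christoffel g p k i j z) y := fun k i j =>
    (christoffel_contDiffAt g p hy k i j).differentiableAt (by simp)
  rw [ricciForm_apply, trace_eq_sum, ricci]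
  refine Finset.sum_congr rfl fun i _ => ?_
  change _ = riemann (connIn g p) y (EuclideanSpace.single i 1) (EuclideanSpace.single j 1)
    (EuclideanSpace.single k 1) i
  have h1 : ∀ (u : Eu n) i j k, fderiv ℝ (connIn g p) y u (EuclideanSpace.single i 1)
      (EuclideanSpace.single j 1) k = fderiv ℝ (fun z => christoffel g p k i j z) y u :=
    fun u i j k => fderiv_bilMapOf_single hd u i j k
  have h2 : ∀ i j k l, connIn g p y (EuclideanSpace.single i 1)
      (connIn g p y (EuclideanSpace.single j 1) (EuclideanSpace.single k 1)) l =
      ∑ m, christoffel g p l i m y * christoffel g p m j k y := by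
    intro i j k l
    conv_lhs => rw [connIn, bilMapOf_apply]
    rw [Finset.sum_eq_single i]
    · simp
    · intro i' _ hi'
      simp [hi']
    · simp
  rw [riemann]
  simp only [PiLp.sub_apply, PiLp.add_apply, h1, h2, partialD, Finset.sum_sub_distrib]
  ring

lemma scalarCurvature_eq_center (g : Metric n M) (x : M) :
    scalarCurvature g x = scal (metricIn g x) (connIn g x) (extChartAt (𝓡 n) x x) := by
  simp only [scalarCurvature, scal, metricTrace, metricIn, gram_formOf, gInv,
    ricci_eq g x (mem_extChartAt_target x)]

/-- The scalar curvature may be computed in any preferred chart. -/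
theorem scalarCurvature_eq (g : Metric n M) {p x : M} (hx : x ∈ (extChartAt (𝓡 n) p).source) :
    scalarCurvature g x = scal (metricIn g p) (connIn g p) (extChartAt (𝓡 n) p x) := by
  obtain ⟨h1, h2⟩ := transition_data hx
  have hy := mem_extChartAt_target (I := 𝓡 n) x
  rw [scalarCurvature_eq_center, ← h2]
  exact (isLocalMetric_metricIn g p (coordTransition_mem h1)).scal_pullback
    (isLocalMetric_metricIn g x hy) (coordTransition_contDiffAt hy h1)
    (metricIn_transition_eventually g hy h1)

/-- The Laplacian in divergence form in the preferred chart at `p`. -/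
lemma divergence_chart (g : Metric n M) (p : M) {f : Eu n → ℝ} {y : Eu n}
    (hy : y ∈ (extChartAt (𝓡 n) p).target) (hf : ContDiffAt ℝ ∞ f y) :
    (density g p y)⁻¹ * ∑ i, partialD i (fun y => density g p y *
      ∑ j, gInv g p y i j * partialD j f y) y = lap (metricIn g p) (connIn g p) f y := by
  rw [← (isLocalMetric_metricIn g p hy).divergence_eq_lap hf]
  have h1 : ∀ i, (fun y => density g p y * ∑ j, gInv g p y i j * partialD j f y) =ᶠ[𝓝 y]
      fun z => Real.sqrt (gram (metricIn g p z)).det * sharp (metricIn g p z) (fderiv ℝ f z) i := by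
    intro i
    filter_upwards [(isOpen_extChartAt_target p).mem_nhds hy] with z hz
    rw [(isScalarProduct_metricIn g p hz).sharp_apply]
    simp only [metricIn, gram_formOf, density, gInv, partialD]
  congr 1
  · simp only [metricIn, gram_formOf, density]
  · refine Finset.sum_congr rfl fun i _ => ?_
    rw [partialD, (h1 i).fderiv_eq]; rfl

/-- The Laplacian may be computed in any preferred chart. -/
theorem laplacian_eq (g : Metric n M) {u : M → ℝ} (hu : ContMDiff (𝓡 n) 𝓘(ℝ) ∞ u) {p x : M}
    (hx : x ∈ (extChartAt (𝓡 n) p).source) :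
    laplacian g u x = lap (metricIn g p) (connIn g p) (u ∘ (extChartAt (𝓡 n) p).symm)
      (extChartAt (𝓡 n) p x) := by
  obtain ⟨h1, h2⟩ := transition_data hx
  have hy := mem_extChartAt_target (I := 𝓡 n) x
  rw [laplacian, divergence_chart g x hy (contDiffAt_comp_symm hu hy), ← h2]
  exact (isLocalMetric_metricIn g p (coordTransition_mem h1)).lap_pullback
    (isLocalMetric_metricIn g x hy) (coordTransition_contDiffAt hy h1)
    (metricIn_transition_eventually g hy h1) (contDiffAt_comp_symm hu (coordTransition_mem h1))
    (comp_symm_transition u hy h1)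

/-- The scalar product of gradients `⟨∇u, ∇v⟩_g` on the manifold. -/
def gradDot (g : Metric n M) (u v : M → ℝ) (x : M) : ℝ :=
  gradInner (metricIn g x) (u ∘ (extChartAt (𝓡 n) x).symm) (v ∘ (extChartAt (𝓡 n) x).symm)
    (extChartAt (𝓡 n) x x)

lemma fderiv_apply_eq_sum (f : Eu n → ℝ) (y v : Eu n) :
    fderiv ℝ f y v = ∑ i, v i * partialD i f y := by
  conv_lhs => rw [sum_single v]
  simp [partialD]

lemma gradSq_eq_gradDot (g : Metric n M) (u : M → ℝ) (x : M) : gradSq g u x = gradDot g u u x := by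
  rw [gradDot, gradInner, fderiv_apply_eq_sum, gradSq]
  refine Finset.sum_congr rfl fun i _ => ?_
  rw [(isScalarProduct_metricIn g x (mem_extChartAt_target x)).sharp_apply, Finset.sum_mul]
  refine Finset.sum_congr rfl fun j _ => ?_
  rw [metricIn, gram_formOf, gInv]
  simp only [partialD]
  ring

theorem gradDot_eq (g : Metric n M) {u v : M → ℝ} (hu : ContMDiff (𝓡 n) 𝓘(ℝ) ∞ u)
    (hv : ContMDiff (𝓡 n) 𝓘(ℝ) ∞ v) {p x : M} (hx : x ∈ (extChartAt (𝓡 n) p).source) :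
    gradDot g u v x = gradInner (metricIn g p) (u ∘ (extChartAt (𝓡 n) p).symm)
      (v ∘ (extChartAt (𝓡 n) p).symm) (extChartAt (𝓡 n) p x) := by
  obtain ⟨h1, h2⟩ := transition_data hx
  have hy := mem_extChartAt_target (I := 𝓡 n) x
  have hy' := coordTransition_mem h1
  rw [gradDot, ← h2]
  exact gradInner_pullback (isScalarProduct_metricIn g p hy') (isScalarProduct_metricIn g x hy)
    ((coordTransition_contDiffAt hy h1).differentiableAt (by simp))
    (metricIn_transition g hy h1)
    ((contDiffAt_comp_symm hu hy').differentiableAt (by simp)) (comp_symm_transition u hy h1)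
    ((contDiffAt_comp_symm hv hy').differentiableAt (by simp)) (comp_symm_transition v hy h1)

lemma scalarCurvature_contMDiff (g : Metric n M) :
    ContMDiff (𝓡 n) 𝓘(ℝ) ∞ (scalarCurvature g) :=
  contMDiff_of_chart
    (fun p => (isLocalMetric_metricIn g p (mem_extChartAt_target p)).contDiffAt_scal)
    (fun _ _ hx => scalarCurvature_eq g hx)

lemma laplacian_contMDiff (g : Metric n M) {u : M → ℝ} (hu : ContMDiff (𝓡 n) 𝓘(ℝ) ∞ u) :
    ContMDiff (𝓡 n) 𝓘(ℝ) ∞ (laplacian g u) :=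
  contMDiff_of_chart
    (fun p => (isLocalMetric_metricIn g p (mem_extChartAt_target p)).contDiffAt_lap
      (contDiffAt_comp_symm hu (mem_extChartAt_target p)))
    (fun _ _ hx => laplacian_eq g hu hx)

lemma gradDot_contMDiff (g : Metric n M) {u v : M → ℝ} (hu : ContMDiff (𝓡 n) 𝓘(ℝ) ∞ u)
    (hv : ContMDiff (𝓡 n) 𝓘(ℝ) ∞ v) : ContMDiff (𝓡 n) 𝓘(ℝ) ∞ (gradDot g u v) :=
  contMDiff_of_chart
    (fun p => (isLocalMetric_metricIn g p (mem_extChartAt_target p)).contDiffAt_gradInner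
      (contDiffAt_comp_symm hu (mem_extChartAt_target p))
      (contDiffAt_comp_symm hv (mem_extChartAt_target p)))
    (fun _ _ hx => gradDot_eq g hu hv hx)

lemma confLaplacian_contMDiff (g : Metric n M) {u : M → ℝ} (hu : ContMDiff (𝓡 n) 𝓘(ℝ) ∞ u) :
    ContMDiff (𝓡 n) 𝓘(ℝ) ∞ (confLaplacian g u) :=
  (laplacian_contMDiff g hu).neg.add
    ((contMDiff_const.mul (scalarCurvature_contMDiff g)).mul hu)

lemma metricIn_conformal (g : Metric n M) (μ : ConformalFactor n M) (p : M) (y v w : Eu n) :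
    metricIn (conformal g μ) p y v w =
      μ.toFun ((extChartAt (𝓡 n) p).symm y) ^ (4 / ((n : ℝ) - 2)) * metricIn g p y v w := by
  rw [metricIn_apply, metricIn_apply]
  rfl

/-- The conformal covariance of the conformal Laplacian, written as
`f μ L_{f g} u = L_g (μ u)` with `f = μ^{4/(n-2)}`. -/
theorem confLaplacian_conformal (hn : 3 ≤ n) (g : Metric n M) (μ : ConformalFactor n M)
    {u : M → ℝ} (hu : ContMDiff (𝓡 n) 𝓘(ℝ) ∞ u) (x : M) :
    μ.toFun x ^ (4 / ((n : ℝ) - 2)) * μ.toFun x * confLaplacian (conformal g μ) u x =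
      confLaplacian g (fun z => μ.toFun z * u z) x := by
  have hy := mem_extChartAt_target (I := 𝓡 n) x
  have hx := mem_extChartAt_source (I := 𝓡 n) x
  have h := (isLocalMetric_metricIn g x hy).conformal_covariance hn
    (isLocalMetric_metricIn (conformal g μ) x hy) (contDiffAt_comp_symm μ.smooth hy)
    (μ.pos _) (Filter.Eventually.of_forall fun z v w => metricIn_conformal g μ x z v w)
    (contDiffAt_comp_symm hu hy)
  simp only [Function.comp_apply, extChartAt_to_inv] at h
  have hμu : ContMDiff (𝓡 n) 𝓘(ℝ) ∞ fun z => μ.toFun z * u z := μ.smooth.mul hu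
  rw [confLaplacian, confLaplacian, laplacian_eq _ hu hx, laplacian_eq _ hμu hx,
    scalarCurvature_eq _ hx, scalarCurvature_eq _ hx]
  exact h

end Charts

open MeasureTheory

/-! ### The Riemannian measure -/

section Density

variable {n : ℕ}

lemma det_gram_pullback {B B' : Eu n →L[ℝ] Eu n →L[ℝ] ℝ} {A : Eu n →L[ℝ] Eu n}
    (h : ∀ v w, B' v w = B (A v) (A w)) : (gram B').det = A.det ^ 2 * (gram B).det := by
  set P : Matrix (Fin n) (Fin n) ℝ := LinearMap.toMatrix (EuclideanSpace.basisFun (Fin n) ℝ).toBasis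
    (EuclideanSpace.basisFun (Fin n) ℝ).toBasis (A : Eu n →ₗ[ℝ] Eu n) with hP
  have hPa : ∀ i j, P i j = A (EuclideanSpace.single j 1) i := by
    intro i j
    simp [hP, LinearMap.toMatrix_apply]
  have h1 : gram B' = P.transpose * gram B * P := by
    ext i j
    rw [Matrix.mul_apply]
    simp only [Matrix.mul_apply, Matrix.transpose_apply, hPa, Finset.sum_mul]
    conv_lhs => rw [gram, Matrix.of_apply, h, form_apply_eq]
    rw [Finset.sum_comm]
    refine Finset.sum_congr rfl fun k _ => Finset.sum_congr rfl fun l _ => ?_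
    simp only [gram, Matrix.of_apply]
    ring
  have h2 : P.det = A.det := by
    rw [hP, LinearMap.det_toMatrix]
  rw [h1, Matrix.det_mul, Matrix.det_mul, Matrix.det_transpose, h2]
  ring

end Density

section ChartMeasurability

variable {n : ℕ} {M : Type*} [TopologicalSpace M] [ChartedSpace (Eu n) M]

lemma conformalFactor_rpow_continuous (μ : ConformalFactor n M) (a : ℝ) :
    Continuous fun x => μ.toFun x ^ a :=
  μ.smooth.continuous.rpow_const fun x => Or.inl (μ.pos x).ne'

variable (n M) in
/-- Finitely many chart domains cover `M`; they are listed, with repetitions, as a sequence. -/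
lemma exists_chart_cover [CompactSpace M] [Nonempty M] :
    ∃ p : ℕ → M, ⋃ i, (extChartAt (𝓡 n) (p i)).source = Set.univ := by
  obtain ⟨t, ht⟩ := CompactSpace.elim_nhds_subcover (fun x : M => (extChartAt (𝓡 n) x).source)
    (fun x : M => extChartAt_source_mem_nhds (I := 𝓡 n) x)
  have hne : (t : Set M).Nonempty := by
    by_contra h
    have he : t = ∅ := by simpa using h
    rw [he] at ht
    simp only [Finset.notMem_empty, Set.iUnion_of_empty, Set.iUnion_empty, Set.top_eq_univ] at ht
    exact Set.empty_ne_univ ht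
  obtain ⟨p, hp⟩ := t.countable_toSet.exists_eq_range hne
  refine ⟨p, Set.eq_univ_of_forall fun x => ?_⟩
  have hx : x ∈ ⋃ y ∈ t, (extChartAt (𝓡 n) y).source := ht ▸ Set.mem_univ x
  simp only [Set.mem_iUnion] at hx
  obtain ⟨y, hy, hxy⟩ := hx
  obtain ⟨i, rfl⟩ : y ∈ Set.range p := hp ▸ hy
  exact Set.mem_iUnion.2 ⟨i, hxy⟩

variable [MeasurableSpace M]

/-- Measures which agree on all chart domains are equal. -/
lemma measure_ext_of_charts [CompactSpace M] [Nonempty M] {ν ν' : Measure M}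
    (h : ∀ p : M, ν.restrict (extChartAt (𝓡 n) p).source =
      ν'.restrict (extChartAt (𝓡 n) p).source) :
    ν = ν' := by
  obtain ⟨c, hc⟩ := exists_chart_cover n M
  exact (Measure.ext_iff_of_iUnion_eq_univ hc).2 fun i => h (c i)

variable [BorelSpace M]

lemma aemeasurable_chart_symm (p : M) : AEMeasurable (extChartAt (𝓡 n) p).symm
    ((volume : Measure (Eu n)).restrict (extChartAt (𝓡 n) p).target) :=
  (continuousOn_extChartAt_symm p).aemeasurable (isOpen_extChartAt_target p).measurableSet

lemma measurableSet_chart_preimage (p : M) {s : Set M} (hs : MeasurableSet s) :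
    MeasurableSet ((extChartAt (𝓡 n) p).target ∩ (extChartAt (𝓡 n) p).symm ⁻¹' s) := by
  have h1 : Measurable ((extChartAt (𝓡 n) p).target.domRestrict (extChartAt (𝓡 n) p).symm) :=
    (continuousOn_iff_continuous_domRestrict.1 (continuousOn_extChartAt_symm p)).measurable
  have h2 := (isOpen_extChartAt_target (I := 𝓡 n) p).measurableSet.subtype_image (h1 hs)
  convert h2 using 1
  ext y
  constructor
  · rintro ⟨hy, hys⟩
    exact ⟨⟨y, hy⟩, hys, rfl⟩
  · rintro ⟨⟨y, hy⟩, hys, rfl⟩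
    exact ⟨hy, hys⟩

end ChartMeasurability

section Volume

variable {n : ℕ} {M : Type*} [TopologicalSpace M] [ChartedSpace (Eu n) M]
  [IsManifold (𝓡 n) ∞ M]

lemma density_eq_sqrt_gram (g : Metric n M) (p : M) (y : Eu n) :
    density g p y = Real.sqrt (gram (metricIn g p y)).det := by
  rw [density, metricIn, gram_formOf]

lemma density_pos (g : Metric n M) (p : M) {y : Eu n} (hy : y ∈ (extChartAt (𝓡 n) p).target) :
    0 < density g p y := by
  rw [density_eq_sqrt_gram]
  exact Real.sqrt_pos.2 (isScalarProduct_metricIn g p hy).det_pos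

lemma density_contDiffAt (g : Metric n M) (p : M) {y : Eu n}
    (hy : y ∈ (extChartAt (𝓡 n) p).target) : ContDiffAt ℝ ∞ (density g p) y := by
  have hm := isLocalMetric_metricIn g p hy
  have h : density g p = fun y => Real.sqrt (gram (metricIn g p y)).det :=
    funext fun y => density_eq_sqrt_gram g p y
  rw [h]
  exact (contDiffAt_det hm.gram_smooth).sqrt hm.scalarProduct.self_of_nhds.det_pos.ne'

lemma density_continuousOn (g : Metric n M) (p : M) :
    ContinuousOn (density g p) (extChartAt (𝓡 n) p).target := fun _ hy =>
  (density_contDiffAt g p hy).continuousAt.continuousWithinAt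

/-- The density transforms with the Jacobian determinant of the change of charts. -/
lemma density_transition (g : Metric n M) {p q : M} {y : Eu n}
    (hy : y ∈ (extChartAt (𝓡 n) p).target)
    (hq : (extChartAt (𝓡 n) p).symm y ∈ (extChartAt (𝓡 n) q).source) :
    density g p y = |(fderiv ℝ (coordTransition p q) y).det| *
      density g q (coordTransition p q y) := by
  rw [density_eq_sqrt_gram, density_eq_sqrt_gram,
    det_gram_pullback (metricIn_transition g hy hq), Real.sqrt_mul (sq_nonneg _),
    Real.sqrt_sq_eq_abs]

/-- The density of `μ^{4/(n-2)} g`. -/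
lemma density_conformal (hn : 3 ≤ n) (g : Metric n M) (μ : ConformalFactor n M) (p : M)
    (y : Eu n) : density (conformal g μ) p y =
      (μ.toFun ((extChartAt (𝓡 n) p).symm y) ^ 2 *
        μ.toFun ((extChartAt (𝓡 n) p).symm y) ^ (4 / ((n : ℝ) - 2))) * density g p y := by
  have hn2 : (0 : ℝ) < (n : ℝ) - 2 := by
    have : (3 : ℝ) ≤ n := by exact_mod_cast hn
    linarith
  set m := μ.toFun ((extChartAt (𝓡 n) p).symm y) with hm
  have hm0 : 0 < m := μ.pos _
  have h1 : gram (metricIn (conformal g μ) p y) =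
      (m ^ (4 / ((n : ℝ) - 2))) • gram (metricIn g p y) := by
    ext i j
    simp only [gram, Matrix.of_apply, Matrix.smul_apply, smul_eq_mul]
    exact metricIn_conformal g μ p y _ _
  have h2 : (m ^ (4 / ((n : ℝ) - 2))) ^ n = (m ^ 2 * m ^ (4 / ((n : ℝ) - 2))) ^ 2 := by
    rw [← Real.rpow_natCast, ← Real.rpow_mul hm0.le, ← Real.rpow_natCast m 2,
      ← Real.rpow_add hm0, ← Real.rpow_natCast, ← Real.rpow_mul hm0.le]
    congr 1
    push_cast
    field_simp
    ring
  rw [density_eq_sqrt_gram, density_eq_sqrt_gram, h1, Matrix.det_smul, Fintype.card_fin, h2,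
    Real.sqrt_mul (sq_nonneg _), Real.sqrt_sq (by positivity)]

lemma aemeasurable_density (g : Metric n M) (p : M) : AEMeasurable (density g p)
    ((volume : Measure (Eu n)).restrict (extChartAt (𝓡 n) p).target) :=
  (density_continuousOn g p).aemeasurable (isOpen_extChartAt_target p).measurableSet

variable [MeasurableSpace M] [BorelSpace M]

lemma lintegral_chartVolume (g : Metric n M) (p : M) {F : M → ENNReal} (hF : Measurable F) :
    ∫⁻ x, F x ∂(chartVolume g p) = ∫⁻ y in (extChartAt (𝓡 n) p).target,
      ENNReal.ofReal (density g p y) * F ((extChartAt (𝓡 n) p).symm y) := by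
  rw [chartVolume, lintegral_map' hF.aemeasurable
    ((aemeasurable_chart_symm p).mono_ac (withDensity_absolutelyContinuous _ _))]
  exact lintegral_withDensity_eq_lintegral_mul₀ (aemeasurable_density g p).ennreal_ofReal
    (hF.comp_aemeasurable (aemeasurable_chart_symm p))

lemma chartVolume_apply (g : Metric n M) (p : M) {s : Set M} (hs : MeasurableSet s) :
    chartVolume g p s = ∫⁻ y in (extChartAt (𝓡 n) p).target ∩ (extChartAt (𝓡 n) p).symm ⁻¹' s,
      ENNReal.ofReal (density g p y) := by
  rw [chartVolume, Measure.map_apply_of_aemeasurable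
    ((aemeasurable_chart_symm p).mono_ac (withDensity_absolutelyContinuous _ _)) hs,
    withDensity_apply', Measure.restrict_restrict' (isOpen_extChartAt_target p).measurableSet,
    Set.inter_comm]

lemma chartVolume_inter_source (g : Metric n M) (p : M) {s : Set M} (hs : MeasurableSet s) :
    chartVolume g p (s ∩ (extChartAt (𝓡 n) p).source) = chartVolume g p s := by
  rw [chartVolume_apply g p hs,
    chartVolume_apply g p (hs.inter (isOpen_extChartAt_source p).measurableSet)]
  congr 2
  ext y
  simp only [Set.mem_inter_iff, Set.mem_preimage]
  exact ⟨fun h => ⟨h.1, h.2.1⟩, fun h => ⟨h.1, h.2, (extChartAt (𝓡 n) p).map_target h.1⟩⟩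

/-- The chart measures agree on overlaps of charts: change of variables. -/
lemma chartVolume_agree (g : Metric n M) {p q : M} {s : Set M} (hs : MeasurableSet s)
    (hp : s ⊆ (extChartAt (𝓡 n) p).source) (hq : s ⊆ (extChartAt (𝓡 n) q).source) :
    chartVolume g p s = chartVolume g q s := by
  rw [chartVolume_apply g p hs, chartVolume_apply g q hs]
  set S := (extChartAt (𝓡 n) p).target ∩ (extChartAt (𝓡 n) p).symm ⁻¹' s with hS
  have hSm : MeasurableSet S := measurableSet_chart_preimage p hs
  have himage : coordTransition p q '' S =
      (extChartAt (𝓡 n) q).target ∩ (extChartAt (𝓡 n) q).symm ⁻¹' s := by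
    ext z
    constructor
    · rintro ⟨y, ⟨hy, hys⟩, rfl⟩
      refine ⟨coordTransition_mem (hq hys), ?_⟩
      change (extChartAt (𝓡 n) q).symm (extChartAt (𝓡 n) q ((extChartAt (𝓡 n) p).symm y)) ∈ s
      rwa [(extChartAt (𝓡 n) q).left_inv (hq hys)]
    · rintro ⟨hz, hzs⟩
      refine ⟨extChartAt (𝓡 n) p ((extChartAt (𝓡 n) q).symm z), ⟨?_, ?_⟩, ?_⟩
      · exact (extChartAt (𝓡 n) p).map_source (hp hzs)
      · change (extChartAt (𝓡 n) p).symm _ ∈ s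
        rwa [(extChartAt (𝓡 n) p).left_inv (hp hzs)]
      · rw [coordTransition, Function.comp_apply, (extChartAt (𝓡 n) p).left_inv (hp hzs),
          (extChartAt (𝓡 n) q).right_inv hz]
  have hinj : Set.InjOn (coordTransition p q) S := by
    rintro y ⟨hy, hys⟩ z ⟨hz, hzs⟩ hyz
    have h1 := (extChartAt (𝓡 n) q).injOn (hq hys) (hq hzs) hyz
    exact (extChartAt (𝓡 n) p).symm.injOn hy hz h1
  rw [← himage, lintegral_image_eq_lintegral_abs_det_fderiv_mul volume hSm
    (fun y hy => ((coordTransition_contDiffAt hy.1 (hq hy.2)).differentiableAt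
      (by simp)).hasFDerivAt.hasFDerivWithinAt) hinj]
  refine setLIntegral_congr_fun hSm fun y hy => ?_
  rw [density_transition g hy.1 (hq hy.2), ENNReal.ofReal_mul (abs_nonneg _)]

variable [CompactSpace M] [Nonempty M]

/-- The Riemannian measure restricts to the chart measure on each chart domain. -/
lemma vol_apply_of_subset (g : Metric n M) {p : M} {s : Set M} (hs : MeasurableSet s)
    (hp : s ⊆ (extChartAt (𝓡 n) p).source) : vol g s = chartVolume g p s := by
  obtain ⟨c, hc⟩ := exists_chart_cover n M
  set A : ℕ → Set M := disjointed fun i => (extChartAt (𝓡 n) (c i)).source with hA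
  have hAm : ∀ i, MeasurableSet (A i) := fun i =>
    MeasurableSet.disjointed (fun i => (isOpen_extChartAt_source (c i)).measurableSet) i
  have hAs : ∀ i, A i ⊆ (extChartAt (𝓡 n) (c i)).source := fun i => disjointed_subset _ i
  have hAu : ⋃ i, A i = Set.univ := by rw [hA, iUnion_disjointed, hc]
  have hAd : Pairwise (Function.onFun Disjoint A) := disjoint_disjointed _
  -- gluing the chart measures along a measurable partition gives a measure `ν` which restricts to
  -- all of them; the supremum `vol g` lies between each chart measure and `ν`
  set ν : Measure M := Measure.sum fun i => (chartVolume g (c i)).restrict (A i) with hν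
  have h1 : ∀ q : M, ∀ s : Set M, MeasurableSet s → s ⊆ (extChartAt (𝓡 n) q).source →
      ν s = chartVolume g q s := by
    intro q s hs hq
    have h2 : s = ⋃ i, s ∩ A i := by rw [← Set.inter_iUnion, hAu, Set.inter_univ]
    conv_rhs => rw [h2]
    rw [measure_iUnion (fun i j hij => (hAd hij).mono Set.inter_subset_right Set.inter_subset_right)
      (fun i => hs.inter (hAm i)), hν, Measure.sum_apply _ hs]
    refine tsum_congr fun i => ?_
    rw [Measure.restrict_apply hs]
    exact chartVolume_agree g (hs.inter (hAm i)) (Set.inter_subset_right.trans (hAs i))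
      (Set.inter_subset_left.trans hq)
  refine le_antisymm ?_ ?_
  · rw [← h1 p s hs hp]
    have h3 : vol g ≤ ν := by
      refine iSup_le fun q => Measure.le_iff.2 fun s hs => ?_
      rw [← chartVolume_inter_source g q hs, ← h1 q _
        (hs.inter (isOpen_extChartAt_source q).measurableSet) Set.inter_subset_right]
      exact measure_mono Set.inter_subset_left
    exact h3 s
  · exact (le_iSup (chartVolume g) p) s

lemma vol_restrict (g : Metric n M) (p : M) :
    (vol g).restrict (extChartAt (𝓡 n) p).source = chartVolume g p := by
  ext s hs
  rw [Measure.restrict_apply hs, vol_apply_of_subset g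
    (hs.inter (isOpen_extChartAt_source p).measurableSet) Set.inter_subset_right,
    chartVolume_inter_source g p hs]

instance isFiniteMeasure_vol (g : Metric n M) : IsFiniteMeasure (vol g) := by
  refine ⟨isCompact_univ.measure_lt_top_of_nhdsWithin fun x _ => ?_⟩
  have hy := mem_extChartAt_target (I := 𝓡 n) x
  set y := extChartAt (𝓡 n) x x with hydef
  have h1 : ∀ᶠ z in 𝓝 y, z ∈ (extChartAt (𝓡 n) x).target ∧ density g x z < density g x y + 1 :=
    Filter.Eventually.and ((isOpen_extChartAt_target x).mem_nhds hy)
      ((density_contDiffAt g x hy).continuousAt.eventually_lt continuousAt_const (by linarith))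
  obtain ⟨r, hr, hball⟩ := Metric.eventually_nhds_iff_ball.1 h1
  have hU : (extChartAt (𝓡 n) x).source ∩ extChartAt (𝓡 n) x ⁻¹' Metric.ball y r ∈ 𝓝 x :=
    Filter.inter_mem (extChartAt_source_mem_nhds x)
      ((continuousAt_extChartAt x).preimage_mem_nhds (Metric.ball_mem_nhds y hr))
  have hUm : MeasurableSet ((extChartAt (𝓡 n) x).source ∩
      extChartAt (𝓡 n) x ⁻¹' Metric.ball y r) :=
    ((continuousOn_extChartAt x).isOpen_inter_preimage (isOpen_extChartAt_source x)
      Metric.isOpen_ball).measurableSet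
  refine ⟨_, mem_nhdsWithin_of_mem_nhds hU, ?_⟩
  rw [vol_apply_of_subset g hUm Set.inter_subset_left, chartVolume_apply g x hUm]
  refine lt_of_le_of_lt (lintegral_mono_set (t := Metric.ball y r) ?_) ?_
  · rintro z ⟨hz, hz1, hz2⟩
    rwa [Set.mem_preimage, (extChartAt (𝓡 n) x).right_inv hz] at hz2
  · refine lt_of_le_of_lt (setLIntegral_mono (g := fun _ => ENNReal.ofReal (density g x y + 1))
      measurable_const fun z hz => ENNReal.ofReal_le_ofReal (hball z hz).2.le) ?_
    rw [setLIntegral_const]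
    exact ENNReal.mul_lt_top ENNReal.ofReal_lt_top measure_ball_lt_top

lemma vol_univ_pos (g : Metric n M) : 0 < vol g Set.univ := by
  obtain ⟨x⟩ := ‹Nonempty M›
  refine lt_of_lt_of_le (pos_iff_ne_zero.2 fun h => ?_)
    (measure_mono (Set.subset_univ (extChartAt (𝓡 n) x).source))
  rw [vol_apply_of_subset g (isOpen_extChartAt_source x).measurableSet subset_rfl,
    ← Set.univ_inter (extChartAt (𝓡 n) x).source, chartVolume_inter_source g x MeasurableSet.univ,
    chartVolume_apply g x MeasurableSet.univ, Set.preimage_univ, Set.inter_univ,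
    lintegral_eq_zero_iff' (aemeasurable_density g x).ennreal_ofReal] at h
  have h1 : ∀ᵐ y ∂((volume : Measure (Eu n)).restrict (extChartAt (𝓡 n) x).target), False := by
    filter_upwards [h, ae_restrict_mem (isOpen_extChartAt_target x).measurableSet] with y hy hyt
    exact (ENNReal.ofReal_pos.2 (density_pos g x hyt)).ne' hy
  rw [Filter.eventually_false_iff_eq_bot, ae_eq_bot, Measure.restrict_eq_zero] at h1
  exact ((isOpen_extChartAt_target x).measure_pos volume
    ⟨_, mem_extChartAt_target (I := 𝓡 n) x⟩).ne' h1

/-- Continuous functions on a closed manifold are integrable. -/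
lemma integrable_of_continuous (g : Metric n M) {F : M → ℝ} (hF : Continuous F) :
    Integrable F (vol g) := by
  obtain ⟨C, hC⟩ := isCompact_univ.exists_bound_of_continuousOn hF.continuousOn
  exact Integrable.of_bound hF.aestronglyMeasurable C
    (Filter.Eventually.of_forall fun x => hC x (Set.mem_univ x))

lemma memLp_of_continuous (g : Metric n M) {F : M → ℝ} (hF : Continuous F) (r : ENNReal) :
    MemLp F r (vol g) := by
  obtain ⟨C, hC⟩ := isCompact_univ.exists_bound_of_continuousOn hF.continuousOn
  exact MemLp.of_bound hF.aestronglyMeasurable C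
    (Filter.Eventually.of_forall fun x => hC x (Set.mem_univ x))

/-- The integral of a function supported in a chart domain, in coordinates. -/
lemma integral_vol_of_support (g : Metric n M) (p : M) {F : M → ℝ} (hF : Continuous F)
    (hs : ∀ x, x ∉ (extChartAt (𝓡 n) p).source → F x = 0) :
    ∫ x, F x ∂(vol g) = ∫ y in (extChartAt (𝓡 n) p).target,
      density g p y * F ((extChartAt (𝓡 n) p).symm y) := by
  rw [← setIntegral_eq_integral_of_forall_compl_eq_zero (s := (extChartAt (𝓡 n) p).source) hs,
    vol_restrict, chartVolume, integral_map
    ((aemeasurable_chart_symm p).mono_ac (withDensity_absolutelyContinuous _ _))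
    hF.aestronglyMeasurable]
  have h1 : (fun y => ENNReal.ofReal (density g p y)) =
    fun y => ((Real.toNNReal (density g p y) : NNReal) : ENNReal) := rfl
  rw [h1, integral_withDensity_eq_integral_smul₀ (aemeasurable_density g p).real_toNNReal]
  refine setIntegral_congr_fun (isOpen_extChartAt_target p).measurableSet fun y hy => ?_
  simp only [NNReal.smul_def, Real.coe_toNNReal _ (density_pos g p hy).le, smul_eq_mul]

/-- The Riemannian measure of `μ^{4/(n-2)} g` is `μ^{2n/(n-2)} dv_g`; here `2n/(n-2)` is written as
`2 + 4/(n-2)`. -/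
lemma vol_conformal (hn : 3 ≤ n) (g : Metric n M) (μ : ConformalFactor n M) :
    vol (conformal g μ) = (vol g).withDensity fun x =>
      ENNReal.ofReal (μ.toFun x ^ 2 * μ.toFun x ^ (4 / ((n : ℝ) - 2))) := by
  have hc : Continuous fun x => μ.toFun x ^ 2 * μ.toFun x ^ (4 / ((n : ℝ) - 2)) :=
    (μ.smooth.continuous.pow 2).mul (conformalFactor_rpow_continuous μ _)
  refine measure_ext_of_charts (n := n) fun p => ?_
  rw [vol_restrict, restrict_withDensity (isOpen_extChartAt_source p).measurableSet, vol_restrict]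
  ext s hs
  rw [withDensity_apply _ hs, ← lintegral_indicator hs, lintegral_chartVolume g p
    (hc.measurable.ennreal_ofReal.indicator hs), ← lintegral_indicator_one hs,
    lintegral_chartVolume _ p (measurable_one.indicator hs)]
  refine setLIntegral_congr_fun (isOpen_extChartAt_target p).measurableSet fun y hy => ?_
  have h0 : 0 ≤ μ.toFun ((extChartAt (𝓡 n) p).symm y) ^ 2 *
      μ.toFun ((extChartAt (𝓡 n) p).symm y) ^ (4 / ((n : ℝ) - 2)) :=
    mul_nonneg (sq_nonneg _) (Real.rpow_nonneg (μ.pos _).le _)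
  by_cases hys : (extChartAt (𝓡 n) p).symm y ∈ s
  · simp only [Set.indicator_of_mem hys, Pi.one_apply, mul_one]
    rw [density_conformal hn, ENNReal.ofReal_mul h0, mul_comm]
  · simp only [Set.indicator_of_notMem hys, mul_zero]

lemma integral_vol_conformal (hn : 3 ≤ n) (g : Metric n M) (μ : ConformalFactor n M)
    (F : M → ℝ) : ∫ x, F x ∂(vol (conformal g μ)) =
      ∫ x, (μ.toFun x ^ 2 * μ.toFun x ^ (4 / ((n : ℝ) - 2))) * F x ∂(vol g) := by
  have hc : Continuous fun x => μ.toFun x ^ 2 * μ.toFun x ^ (4 / ((n : ℝ) - 2)) :=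
    (μ.smooth.continuous.pow 2).mul (conformalFactor_rpow_continuous μ _)
  have h1 : (fun x => ENNReal.ofReal (μ.toFun x ^ 2 * μ.toFun x ^ (4 / ((n : ℝ) - 2)))) =
    fun x => ((Real.toNNReal (μ.toFun x ^ 2 * μ.toFun x ^ (4 / ((n : ℝ) - 2))) : NNReal) : ENNReal)
    := rfl
  rw [vol_conformal hn g μ, h1, integral_withDensity_eq_integral_smul hc.measurable.real_toNNReal]
  refine integral_congr_ae (Filter.Eventually.of_forall fun x => ?_)
  have h0 : 0 ≤ μ.toFun x ^ 2 * μ.toFun x ^ (4 / ((n : ℝ) - 2)) :=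
    mul_nonneg (sq_nonneg _) (Real.rpow_nonneg (μ.pos x).le _)
  simp only [NNReal.smul_def, Real.coe_toNNReal _ h0, smul_eq_mul]

end Volume

/-! ### Green's formula -/

section EuclideanParts

variable {n : ℕ}

lemma integral_fderiv_eq_zero {h : Eu n → ℝ} (hh : ContDiff ℝ 1 h) (hc : HasCompactSupport h)
    (v : Eu n) : ∫ y, fderiv ℝ h y v = 0 := by
  have hi : Integrable h := hh.continuous.integrable_of_hasCompactSupport hc
  have hi' : Integrable fun y => fderiv ℝ h y v :=
    ((hh.continuous_fderiv (by simp)).clm_apply continuous_const).integrable_of_hasCompactSupport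
      (hc.fderiv_apply (𝕜 := ℝ) v)
  have := integral_mul_fderiv_eq_neg_fderiv_mul_of_integrable (μ := (volume : Measure (Eu n)))
    (f := fun _ : Eu n => (1 : ℝ)) (g := h) (v := v) (by simp) (by simpa using hi')
    (by simpa using hi) (fun x _ => differentiableAt_const _)
    (fun x _ => (hh.differentiable (by simp)) x)
  simpa using this

/-- The integral over `U` of a derivative of a function supported in a compact subset of `U`. -/
lemma setIntegral_fderiv_eq_zero {U K : Set (Eu n)} (hU : IsOpen U) (hK : IsCompact K)
    (hKU : K ⊆ U) {F : Eu n → ℝ} (hF : ∀ y ∈ U, ContDiffAt ℝ 1 F y)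
    (h0 : ∀ y ∈ U, y ∉ K → F y = 0) (v : Eu n) : ∫ y in U, fderiv ℝ F y v = 0 := by
  set h : Eu n → ℝ := U.indicator F with hh
  have hhU : ∀ y ∈ U, h =ᶠ[𝓝 y] F := fun y hy => by
    filter_upwards [hU.mem_nhds hy] with z hz using Set.indicator_of_mem hz F
  have hhK : ∀ y, y ∉ K → h y = 0 := fun y hy => by
    by_cases hyU : y ∈ U
    · rw [hh, Set.indicator_of_mem hyU, h0 y hyU hy]
    · exact Set.indicator_of_notMem hyU F
  have hcd : ContDiff ℝ 1 h := by
    rw [contDiff_iff_contDiffAt]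
    intro y
    by_cases hy : y ∈ U
    · exact (hF y hy).congr_of_eventuallyEq (hhU y hy)
    · have hz : h =ᶠ[𝓝 y] fun _ => 0 := by
        filter_upwards [hK.isClosed.isOpen_compl.mem_nhds fun hyK => hy (hKU hyK)] with z hz
        exact hhK z hz
      exact contDiffAt_const.congr_of_eventuallyEq hz
  have hc : HasCompactSupport h := HasCompactSupport.intro hK hhK
  rw [← integral_fderiv_eq_zero hcd hc v,
    ← setIntegral_eq_integral_of_forall_compl_eq_zero (s := U) (f := fun y => fderiv ℝ h y v)]
  · refine setIntegral_congr_fun hU.measurableSet fun y hy => ?_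
    rw [(hhU y hy).fderiv_eq]
  · intro y hy
    have hz : h =ᶠ[𝓝 y] fun _ => 0 := by
      filter_upwards [hK.isClosed.isOpen_compl.mem_nhds fun hyK => hy (hKU hyK)] with z hz
      exact hhK z hz
    rw [hz.fderiv_eq]
    simp

end EuclideanParts

section Green

variable {n : ℕ} {M : Type*} [TopologicalSpace M] [ChartedSpace (Eu n) M]
  [IsManifold (𝓡 n) ∞ M]

lemma gradDot_eq_zero (g : Metric n M) {u : M → ℝ} (v : M → ℝ) {x : M} (h : u =ᶠ[𝓝 x] 0) :
    gradDot g u v x = 0 := by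
  have hc : Filter.Tendsto (extChartAt (𝓡 n) x).symm (𝓝 (extChartAt (𝓡 n) x x)) (𝓝 x) := by
    have := continuousAt_extChartAt_symm (I := 𝓡 n) x
    rw [ContinuousAt, extChartAt_to_inv] at this
    exact this
  have h1 : (u ∘ (extChartAt (𝓡 n) x).symm) =ᶠ[𝓝 (extChartAt (𝓡 n) x x)] fun _ => 0 :=
    hc.eventually h
  rw [gradDot, gradInner, h1.fderiv_eq]
  simp

lemma gradDot_sum (g : Metric n M) {ι : Type*} (t : Finset ι) {u : ι → M → ℝ}
    (hu : ∀ i, ContMDiff (𝓡 n) 𝓘(ℝ) ∞ (u i)) (v : M → ℝ) (x : M) :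
    gradDot g (fun x => ∑ i ∈ t, u i x) v x = ∑ i ∈ t, gradDot g (u i) v x := by
  have h1 : (fun x => ∑ i ∈ t, u i x) ∘ (extChartAt (𝓡 n) x).symm =
      fun y => ∑ i ∈ t, (u i ∘ (extChartAt (𝓡 n) x).symm) y := rfl
  simp only [gradDot, gradInner]
  rw [h1, fderiv_fun_sum fun i _ => (contDiffAt_comp_symm (hu i)
    (mem_extChartAt_target x)).differentiableAt (by simp), sum_apply]

variable [MeasurableSpace M] [BorelSpace M] [CompactSpace M] [Nonempty M]

/-- Green's formula for a function supported in a chart domain. -/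
lemma green_of_support (g : Metric n M) {φ v : M → ℝ} (hφ : ContMDiff (𝓡 n) 𝓘(ℝ) ∞ φ)
    (hv : ContMDiff (𝓡 n) 𝓘(ℝ) ∞ v) {p : M} (hp : tsupport φ ⊆ (extChartAt (𝓡 n) p).source) :
    ∫ x, (φ x * laplacian g v x + gradDot g φ v x) ∂(vol g) = 0 := by
  have hcont : Continuous fun x => φ x * laplacian g v x + gradDot g φ v x :=
    (hφ.continuous.mul (laplacian_contMDiff g hv).continuous).add
      (gradDot_contMDiff g hφ hv).continuous
  have hzero : ∀ x, x ∉ tsupport φ → φ x = 0 ∧ gradDot g φ v x = 0 := fun x hx =>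
    ⟨image_eq_zero_of_notMem_tsupport hx,
      gradDot_eq_zero g v (notMem_tsupport_iff_eventuallyEq.1 hx)⟩
  rw [integral_vol_of_support g p hcont fun x hx => by
    have := hzero x fun h => hx (hp h)
    rw [this.1, this.2]; ring]
  set U := (extChartAt (𝓡 n) p).target with hUdef
  have hU : IsOpen U := isOpen_extChartAt_target p
  set φ' := φ ∘ (extChartAt (𝓡 n) p).symm with hφ'
  set v' := v ∘ (extChartAt (𝓡 n) p).symm with hv'
  -- the components of `∇v`, weighted by the density: the integrand is the Euclidean divergence
  -- of `φ W`
  set W : Fin n → Eu n → ℝ := fun i y =>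
    density g p y * ∑ j, gInv g p y i j * partialD j v' y with hW
  have hφs : ∀ y ∈ U, ContDiffAt ℝ ∞ φ' y := fun y hy => contDiffAt_comp_symm hφ hy
  have hvs : ∀ y ∈ U, ContDiffAt ℝ ∞ v' y := fun y hy => contDiffAt_comp_symm hv hy
  have hWs : ∀ i, ∀ y ∈ U, ContDiffAt ℝ ∞ (W i) y := by
    intro i y hy
    refine (density_contDiffAt g p hy).mul (ContDiffAt.sum fun j _ => ?_)
    have hG : ∀ i j, ContDiffAt ℝ ∞ (fun z => gMat g p z i j) y := fun i j =>
      (gMat_contDiffOn g p i j).contDiffAt (hU.mem_nhds hy)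
    have hdet : (gMat g p y).det ≠ 0 := by
      have := (isScalarProduct_metricIn g p hy).det_pos.ne'
      rwa [metricIn, gram_formOf] at this
    exact (contDiffAt_inv_apply hG hdet i j).mul (contDiffAt_partialD (hvs y hy) j)
  set K : Set (Eu n) := extChartAt (𝓡 n) p '' tsupport φ with hK
  have hKc : IsCompact K := (isClosed_tsupport φ).isCompact.image_of_continuousOn
    ((continuousOn_extChartAt p).mono hp)
  have hKU : K ⊆ U := by
    rintro _ ⟨x, hx, rfl⟩
    exact (extChartAt (𝓡 n) p).map_source (hp hx)
  have hφK : ∀ y ∈ U, y ∉ K → φ' y = 0 := by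
    intro y hy hyK
    refine (hzero _ fun h => hyK ⟨_, h, (extChartAt (𝓡 n) p).right_inv hy⟩).1
  have hpt : ∀ y ∈ U, density g p y * (φ ((extChartAt (𝓡 n) p).symm y) *
      laplacian g v ((extChartAt (𝓡 n) p).symm y) +
      gradDot g φ v ((extChartAt (𝓡 n) p).symm y)) =
      ∑ i, fderiv ℝ (fun y => φ' y * W i y) y (EuclideanSpace.single i 1) := by
    intro y hy
    have hx : (extChartAt (𝓡 n) p).symm y ∈ (extChartAt (𝓡 n) p).source :=
      (extChartAt (𝓡 n) p).map_target hy
    have hD := (density_pos g p hy).ne'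
    rw [laplacian_eq g hv hx, gradDot_eq g hφ hv hx, (extChartAt (𝓡 n) p).right_inv hy, ← hv',
      ← hφ', ← divergence_chart g p hy (hvs y hy), gradInner, fderiv_apply_eq_sum, mul_add]
    have e1 : ∀ i, fderiv ℝ (fun y => φ' y * W i y) y (EuclideanSpace.single i 1) =
        φ' y * partialD i (W i) y + W i y * partialD i φ' y := by
      intro i
      rw [(((hφs y hy).differentiableAt (by simp)).hasFDerivAt.fun_mul
        ((hWs i y hy).differentiableAt (by simp)).hasFDerivAt).fderiv]
      rfl
    simp only [e1, Finset.sum_add_distrib, ← Finset.mul_sum]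
    congr 1
    · rw [hφ', Function.comp_apply]
      field_simp
      rfl
    · rw [Finset.mul_sum]
      refine Finset.sum_congr rfl fun i _ => ?_
      rw [(isScalarProduct_metricIn g p hy).sharp_apply, hW, metricIn, gram_formOf, ← gInv]
      simp only [partialD]
      ring
  have hdi : ∀ i, ContDiffOn ℝ ∞ (fun y => φ' y * W i y) U := fun i y hy =>
    ((hφs y hy).mul (hWs i y hy)).contDiffWithinAt
  have h1 : (1 : ℕ∞ω) ≤ ∞ := by norm_cast
  rw [setIntegral_congr_fun hU.measurableSet hpt, integral_finsetSum]
  · refine Finset.sum_eq_zero fun i _ => setIntegral_fderiv_eq_zero hU hKc hKU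
      (fun y hy => ((hφs y hy).mul (hWs i y hy)).of_le h1)
      (fun y hy hyK => by rw [hφK y hy hyK, zero_mul]) _
  · intro i _
    have hco : ContinuousOn (fun y => fderiv ℝ (fun y => φ' y * W i y) y
        (EuclideanSpace.single i 1)) U := fun y hy =>
      ((((hφs y hy).mul (hWs i y hy)).fderiv_right (m := 0) (by norm_cast)).continuousAt.clm_apply
        continuousAt_const).continuousWithinAt
    have hint : IntegrableOn (fun y => fderiv ℝ (fun y => φ' y * W i y) y
        (EuclideanSpace.single i 1)) K := (hco.mono hKU).integrableOn_compact hKc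
    refine hint.of_forall_sdiff_eq_zero hU.measurableSet fun y hy => ?_
    have hz : (fun y => φ' y * W i y) =ᶠ[𝓝 y] fun _ => 0 := by
      filter_upwards [hU.mem_nhds hy.1, hKc.isClosed.isOpen_compl.mem_nhds hy.2] with z hz hzK
      rw [hφK z hz hzK, zero_mul]
    rw [hz.fderiv_eq]
    simp

/-- Green's formula on a closed manifold. -/
theorem green [T2Space M] (g : Metric n M) {φ v : M → ℝ} (hφ : ContMDiff (𝓡 n) 𝓘(ℝ) ∞ φ)
    (hv : ContMDiff (𝓡 n) 𝓘(ℝ) ∞ v) :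
    ∫ x, φ x * laplacian g v x ∂(vol g) = -∫ x, gradDot g φ v x ∂(vol g) := by
  obtain ⟨t, ht⟩ := CompactSpace.elim_nhds_subcover (fun x : M => (extChartAt (𝓡 n) x).source)
    (fun x : M => extChartAt_source_mem_nhds (I := 𝓡 n) x)
  obtain ⟨ρ, hρ⟩ := SmoothPartitionOfUnity.exists_isSubordinate (𝓡 n) (isClosed_univ (X := M))
    (fun i : t => (extChartAt (𝓡 n) (i : M)).source) (fun i => isOpen_extChartAt_source (i : M))
    (by
      intro x _
      have hx : x ∈ ⋃ y ∈ t, (extChartAt (𝓡 n) y).source := ht ▸ Set.mem_univ x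
      simp only [Set.mem_iUnion] at hx ⊢
      obtain ⟨y, hy, hxy⟩ := hx
      exact ⟨⟨y, hy⟩, hxy⟩)
  have hsum : ∀ x, ∑ i : t, ρ i x = 1 := fun x => by
    rw [← finsum_eq_sum_of_fintype]
    exact ρ.sum_eq_one (Set.mem_univ x)
  have hsm : ∀ i : t, ContMDiff (𝓡 n) 𝓘(ℝ) ∞ fun x => ρ i x * φ x := fun i =>
    (ρ i).contMDiff.mul hφ
  have hφsum : (fun x => ∑ i : t, ρ i x * φ x) = φ := by
    ext x
    rw [← Finset.sum_mul, hsum, one_mul]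
  have hpart : ∀ i : t, ∫ x, (ρ i x * φ x * laplacian g v x +
      gradDot g (fun x => ρ i x * φ x) v x) ∂(vol g) = 0 := fun i =>
    green_of_support g (hsm i) hv ((tsupport_mul_subset_left (f := ρ i) (g := φ)).trans (hρ i))
  have hi1 : Integrable (fun x => φ x * laplacian g v x) (vol g) :=
    integrable_of_continuous g (hφ.continuous.mul (laplacian_contMDiff g hv).continuous)
  have hi2 : Integrable (fun x => gradDot g φ v x) (vol g) :=
    integrable_of_continuous g (gradDot_contMDiff g hφ hv).continuous
  have htot : ∫ x, (φ x * laplacian g v x + gradDot g φ v x) ∂(vol g) = 0 := by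
    rw [← Finset.sum_eq_zero fun i (_ : i ∈ Finset.univ) => hpart i, ← integral_finsetSum]
    · refine integral_congr_ae (Filter.Eventually.of_forall fun x => ?_)
      simp only [Finset.sum_add_distrib]
      rw [← gradDot_sum g Finset.univ hsm, hφsum, ← Finset.sum_mul, ← Finset.sum_mul, hsum, one_mul]
    · intro i _
      exact integrable_of_continuous g
        (((hsm i).continuous.mul (laplacian_contMDiff g hv).continuous).add
          (gradDot_contMDiff g (hsm i) hv).continuous)
  rw [integral_add hi1 hi2] at htot
  linarith

end Green

/-! ### Spectral theory of semibounded forms -/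

section AbstractForm

open scoped RealInnerProductSpace

variable {D H : Type*} [AddCommGroup D] [Module ℝ D] [NormedAddCommGroup H] [InnerProductSpace ℝ H]
  {ι P : D →ₗ[ℝ] H}

/-- The sequence `φ` converges to `U` in the Hilbert space and is a Cauchy sequence for the
quadratic form `⟪ι v, P v⟫`. -/
structure IsFormApprox (ι P : D →ₗ[ℝ] H) (U : H) (φ : ℕ → D) : Prop where
  tendsto : Filter.Tendsto (fun k => ι (φ k)) Filter.atTop (𝓝 U)
  cauchy : ∀ ε > 0, ∃ N, ∀ k ≥ N, ∀ l ≥ N, ⟪ι (φ k - φ l), P (φ k - φ l)⟫ < ε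

/-- `U` lies in the form domain and is a weak solution of `P U = f`. -/
def IsFormSolution (ι P : D →ₗ[ℝ] H) (f U : H) : Prop :=
  (∃ φ, IsFormApprox ι P U φ) ∧ ∀ v, ⟪U, P v⟫ = ⟪f, ι v⟫

/-- Lax-Milgram: a coercive symmetric form has a weak solution for every right-hand side. -/
theorem exists_isFormSolution [CompleteSpace H] (hsymm : ∀ u v, ⟪ι u, P v⟫ = ⟪ι v, P u⟫) {c : ℝ}
    (hc : 0 < c) (hcoer : ∀ v, c * ‖ι v‖ ^ 2 ≤ ⟪ι v, P v⟫) (f : H) :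
    ∃ U, IsFormSolution ι P f U := by
  have hnn : ∀ v, 0 ≤ ⟪ι v, P v⟫ := fun v => (by positivity : 0 ≤ c * ‖ι v‖ ^ 2).trans (hcoer v)
  -- the form itself is the inner product; the solution comes from the Riesz theorem in the
  -- completion
  let core : PreInnerProductSpace.Core ℝ D :=
    { inner := fun u v => ⟪ι u, P v⟫
      conj_inner_symm := fun u v => by simpa using hsymm v u
      re_inner_nonneg := fun v => by simpa using hnn v
      add_left := fun u v w => by simp only [map_add, inner_add_left]
      smul_left := fun u v r => by simp only [map_smul, real_inner_smul_left]; rfl }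
  let : SeminormedAddCommGroup D := @InnerProductSpace.Core.toSeminormedAddCommGroup ℝ D _ _ _ core
  let : InnerProductSpace ℝ D := InnerProductSpace.ofCore core
  have hin : ∀ u v : D, ⟪u, v⟫ = ⟪ι u, P v⟫ := fun u v => rfl
  have hnorm : ∀ v : D, ‖v‖ ^ 2 = ⟪ι v, P v⟫ := fun v => by
    rw [← hin, real_inner_self_eq_norm_sq]
  have hbound : ∀ v : D, ‖ι v‖ ≤ (Real.sqrt c)⁻¹ * ‖v‖ := by
    intro v
    have h1 := hcoer v
    rw [← hnorm] at h1
    have h2 : (Real.sqrt c * ‖ι v‖) ^ 2 ≤ ‖v‖ ^ 2 := by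
      rw [mul_pow, Real.sq_sqrt hc.le]; exact h1
    have h3 := abs_le_of_sq_le_sq h2 (norm_nonneg v)
    rw [inv_mul_eq_div, le_div_iff₀ (Real.sqrt_pos.2 hc), mul_comm]
    exact (le_abs_self _).trans h3
  let ιc : D →L[ℝ] H := ι.mkContinuous _ hbound
  let T : D →L[ℝ] ℝ := (innerSL ℝ f).comp ιc
  let e : D →L[ℝ] UniformSpace.Completion D := UniformSpace.Completion.toComplL
  have hde : DenseRange e := UniformSpace.Completion.denseRange_coe
  have hue : IsUniformInducing e := UniformSpace.Completion.isUniformInducing_coe D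
  let T' : UniformSpace.Completion D →L[ℝ] ℝ := T.extend e
  let V : UniformSpace.Completion D := (InnerProductSpace.toDual ℝ _).symm T'
  have hV : ∀ v : D, ⟪V, (v : UniformSpace.Completion D)⟫ = ⟪f, ι v⟫ := by
    intro v
    rw [InnerProductSpace.toDual_symm_apply]
    exact ContinuousLinearMap.extend_eq T hde hue v
  -- a sequence in `D` which converges to `V` in the completion
  have happrox : ∀ k : ℕ, ∃ v : D, dist V (v : UniformSpace.Completion D) < 1 / ((k : ℝ) + 1) :=
    fun k => UniformSpace.Completion.denseRange_coe.exists_dist_lt V (by positivity)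
  choose φ hφ using happrox
  have hφlim : Filter.Tendsto (fun k => (φ k : UniformSpace.Completion D)) Filter.atTop (𝓝 V) := by
    rw [tendsto_iff_dist_tendsto_zero]
    refine squeeze_zero (fun _ => dist_nonneg) (fun k => ?_) tendsto_one_div_add_atTop_nhds_zero_nat
    rw [dist_comm]; exact (hφ k).le
  have hφc : CauchySeq φ := by
    refine Metric.cauchySeq_iff.2 fun ε hε => ?_
    obtain ⟨N, hN⟩ := Metric.cauchySeq_iff.1 hφlim.cauchySeq ε hε
    exact ⟨N, fun k hk l hl => by simpa only [UniformSpace.Completion.dist_eq] using hN k hk l hl⟩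
  obtain ⟨U, hU⟩ := cauchySeq_tendsto_of_complete (ιc.uniformContinuous.comp_cauchySeq hφc)
  refine ⟨U, ⟨φ, hU, fun ε hε => ?_⟩, fun v => ?_⟩
  · obtain ⟨N, hN⟩ := Metric.cauchySeq_iff.1 hφc (Real.sqrt ε) (Real.sqrt_pos.2 hε)
    refine ⟨N, fun k hk l hl => ?_⟩
    have h1 := hN k hk l hl
    rw [dist_eq_norm] at h1
    rw [← hnorm, ← Real.sq_sqrt hε.le]
    exact pow_lt_pow_left₀ h1 (norm_nonneg _) two_ne_zero
  · have h1 : Filter.Tendsto (fun k => ⟪ι (φ k), P v⟫) Filter.atTop (𝓝 ⟪U, P v⟫) :=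
      hU.inner tendsto_const_nhds
    have h2 : Filter.Tendsto (fun k => ⟪ι (φ k), P v⟫) Filter.atTop (𝓝 ⟪f, ι v⟫) := by
      rw [← hV v]
      refine (hφlim.inner (tendsto_const_nhds (x := (v : UniformSpace.Completion D)))).congr
        fun k => ?_
      rw [UniformSpace.Completion.inner_coe, hin]
    exact tendsto_nhds_unique h1 h2

/-- Weak solutions of a coercive form are unique. -/
theorem IsFormApprox.eq_zero (hsymm : ∀ u v, ⟪ι u, P v⟫ = ⟪ι v, P u⟫) {c : ℝ}
    (hc : 0 < c) (hcoer : ∀ v, c * ‖ι v‖ ^ 2 ≤ ⟪ι v, P v⟫) {U : H} {φ : ℕ → D}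
    (h : IsFormApprox ι P U φ) (h0 : ∀ v, ⟪U, P v⟫ = 0) : U = 0 := by
  have hnn : ∀ v, 0 ≤ ⟪ι v, P v⟫ := fun v => (by positivity : 0 ≤ c * ‖ι v‖ ^ 2).trans (hcoer v)
  -- expand `Q (φ k - φ N) < ε`: as `k → ∞` the mixed term tends to `⟪U, P (φ N)⟫ = 0`
  have key : c * ‖U‖ ^ 2 ≤ 0 := by
    refine le_of_forall_pos_le_add fun ε hε => ?_
    obtain ⟨N, hN⟩ := h.cauchy ε hε
    have h1 : ∀ᶠ k in Filter.atTop, c * ‖ι (φ k)‖ ^ 2 ≤ ε + 2 * ⟪ι (φ k), P (φ N)⟫ := by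
      filter_upwards [Filter.eventually_ge_atTop N] with k hk
      have h2 := hN k hk N le_rfl
      simp only [map_sub, inner_sub_left, inner_sub_right] at h2
      rw [hsymm (φ N) (φ k)] at h2
      linarith [hcoer (φ k), hnn (φ N)]
    have h2 : Filter.Tendsto (fun k => c * ‖ι (φ k)‖ ^ 2) Filter.atTop (𝓝 (c * ‖U‖ ^ 2)) :=
      (h.tendsto.norm.pow 2).const_mul c
    have h3 : Filter.Tendsto (fun k => ε + 2 * ⟪ι (φ k), P (φ N)⟫) Filter.atTop
        (𝓝 (ε + 2 * ⟪U, P (φ N)⟫)) :=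
      ((h.tendsto.inner tendsto_const_nhds).const_mul 2).const_add ε
    have h4 := le_of_tendsto_of_tendsto h2 h3 h1
    rw [h0] at h4
    linarith
  have h5 : ‖U‖ ^ 2 ≤ 0 := by
    by_contra hlt
    push Not at hlt
    nlinarith
  have h6 : ‖U‖ = 0 := pow_eq_zero_iff two_ne_zero |>.1 (le_antisymm h5 (sq_nonneg _))
  exact norm_eq_zero.1 h6

lemma IsFormApprox.sub (hsymm : ∀ u v, ⟪ι u, P v⟫ = ⟪ι v, P u⟫) (hnn : ∀ v, 0 ≤ ⟪ι v, P v⟫)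
    {U V : H} {φ ψ : ℕ → D} (hU : IsFormApprox ι P U φ) (hV : IsFormApprox ι P V ψ) :
    IsFormApprox ι P (U - V) (fun k => φ k - ψ k) := by
  refine ⟨by simpa only [map_sub] using hU.tendsto.sub hV.tendsto, fun ε hε => ?_⟩
  obtain ⟨N, hN⟩ := hU.cauchy (ε / 4) (by positivity)
  obtain ⟨N', hN'⟩ := hV.cauchy (ε / 4) (by positivity)
  refine ⟨max N N', fun k hk l hl => ?_⟩
  have h1 := hN k (le_of_max_le_left hk) l (le_of_max_le_left hl)
  have h2 := hN' k (le_of_max_le_right hk) l (le_of_max_le_right hl)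
  rw [sub_sub_sub_comm]
  set a := φ k - φ l
  set b := ψ k - ψ l
  have h3 := hnn (a + b)
  simp only [map_sub, map_add, inner_sub_left, inner_sub_right, inner_add_left,
    inner_add_right] at h3 ⊢
  rw [hsymm b a] at h3 ⊢
  linarith

/-- If a nonnegative form is solvable for every right-hand side, then it is coercive. By the
uniform boundedness principle: a solution for the right-hand side `f` bounds `⟪f, ι v⟫` on
the set of all `v` with `⟪ι v, P v⟫ ≤ 1`. -/
theorem coercive_of_solvable [CompleteSpace H] (hsymm : ∀ u v, ⟪ι u, P v⟫ = ⟪ι v, P u⟫)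
    (hnn : ∀ v, 0 ≤ ⟪ι v, P v⟫) (hsolv : ∀ f, ∃ U, IsFormSolution ι P f U) :
    ∃ C > 0, ∀ v, ‖ι v‖ ^ 2 ≤ C * ⟪ι v, P v⟫ := by
  have hyoung : ∀ u v, |⟪ι u, P v⟫| ≤ ⟪ι u, P u⟫ + ⟪ι v, P v⟫ := by
    intro u v
    have h1 := hnn (u - v)
    have h2 := hnn (u + v)
    simp only [map_sub, map_add, inner_sub_left, inner_sub_right, inner_add_left,
      inner_add_right] at h1 h2
    rw [hsymm v u] at h1 h2
    have h3 := hnn u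
    have h4 := hnn v
    rw [abs_le]
    constructor <;> linarith
  have hpt : ∀ f : H, ∃ C, ∀ v : {v : D // ⟪ι v, P v⟫ ≤ 1}, ‖innerSL ℝ (ι v) f‖ ≤ C := by
    intro f
    obtain ⟨U, ⟨φ, hφ⟩, hU⟩ := hsolv f
    obtain ⟨N, hN⟩ := hφ.cauchy 1 one_pos
    -- `Q (φ k) ≤ 2 (Q (φ k - φ N) + Q (φ N))` bounds the form along the approximating sequence
    refine ⟨2 * (1 + ⟪ι (φ N), P (φ N)⟫) + 1, fun v => ?_⟩
    rw [innerSL_apply_apply, real_inner_comm, ← hU, Real.norm_eq_abs]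
    have h1 : Filter.Tendsto (fun k => |⟪ι (φ k), P (v : D)⟫|) Filter.atTop
        (𝓝 |⟪U, P (v : D)⟫|) := (hφ.tendsto.inner tendsto_const_nhds).abs
    refine le_of_tendsto h1 ?_
    filter_upwards [Filter.eventually_ge_atTop N] with k hk
    have h2 := hN k hk N le_rfl
    have h3 := hnn (φ k - φ N + -φ N)
    have h4 := hnn (φ k - φ N - φ N)
    have h5 : ⟪ι (φ k), P (φ k)⟫ ≤
        2 * (⟪ι (φ k - φ N), P (φ k - φ N)⟫ + ⟪ι (φ N), P (φ N)⟫) := by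
      simp only [map_sub, inner_sub_left, inner_sub_right] at h4 ⊢
      rw [hsymm (φ N) (φ k)] at h4 ⊢
      linarith
    linarith [hyoung (φ k) v, v.2]
  obtain ⟨C, hC⟩ := banach_steinhaus hpt
  have hC' : ∀ v : D, ⟪ι v, P v⟫ ≤ 1 → ‖ι v‖ ≤ |C| := fun v hv => by
    have := hC ⟨v, hv⟩
    rw [innerSL_apply_norm] at this
    exact this.trans (le_abs_self C)
  refine ⟨C ^ 2 + 1, by positivity, fun v => ?_⟩
  refine le_of_forall_pos_le_add fun δ hδ => ?_
  set q := ⟪ι v, P v⟫ with hq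
  have hq0 : 0 ≤ q := hnn v
  -- normalize `v`; the summand `δ / (C ^ 2 + 1)` avoids dividing by `q = 0`
  set s := q + δ / (C ^ 2 + 1) with hs
  have hs0 : 0 < s := by positivity
  have h1 : ⟪ι ((Real.sqrt s)⁻¹ • v), P ((Real.sqrt s)⁻¹ • v)⟫ ≤ 1 := by
    simp only [map_smul, real_inner_smul_left, real_inner_smul_right, ← hq]
    rw [← mul_assoc, ← mul_inv, Real.mul_self_sqrt hs0.le, inv_mul_le_iff₀ hs0]
    have : 0 ≤ δ / (C ^ 2 + 1) := by positivity
    linarith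
  have h2 := hC' _ h1
  rw [map_smul, norm_smul, norm_inv, Real.norm_of_nonneg (Real.sqrt_nonneg s),
    inv_mul_le_iff₀ (Real.sqrt_pos.2 hs0)] at h2
  have h3 : ‖ι v‖ ^ 2 ≤ s * C ^ 2 := by
    have := pow_le_pow_left₀ (norm_nonneg _) h2 2
    rwa [mul_pow, Real.sq_sqrt hs0.le, sq_abs] at this
  calc ‖ι v‖ ^ 2 ≤ s * C ^ 2 := h3
    _ ≤ s * (C ^ 2 + 1) := by nlinarith
    _ = (C ^ 2 + 1) * q + δ := by rw [hs]; field_simp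

/-- The infimum of the Rayleigh quotient belongs to the spectrum: at this value the equation is not
solvable for every right-hand side. -/
theorem exists_not_solvable [CompleteSpace H] (hsymm : ∀ u v, ⟪ι u, P v⟫ = ⟪ι v, P u⟫) {k a : ℝ}
    (hk : ∀ v, k * ‖ι v‖ ^ 2 ≤ ⟪ι v, P v⟫) {w : D} (hw : ι w ≠ 0)
    (ha : ⟪ι w, P w⟫ ≤ a * ‖ι w‖ ^ 2) :
    ∃ lam ≤ a, ¬ ∀ f, ∃ U, IsFormSolution ι (P - lam • ι) f U := by
  set S : Set ℝ := {r | ∃ v, ι v ≠ 0 ∧ r = ⟪ι v, P v⟫ / ‖ι v‖ ^ 2} with hS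
  have hpos : ∀ v, ι v ≠ 0 → 0 < ‖ι v‖ ^ 2 := fun v hv => by
    have := norm_pos_iff.2 hv
    positivity
  have hbdd : BddBelow S := ⟨k, by
    rintro _ ⟨v, hv, rfl⟩
    rw [le_div_iff₀ (hpos v hv)]
    exact hk v⟩
  have hne : S.Nonempty := ⟨_, w, hw, rfl⟩
  refine ⟨sInf S, (csInf_le hbdd ⟨w, hw, rfl⟩).trans ((div_le_iff₀ (hpos w hw)).2 ha),
    fun hsolv => ?_⟩
  have happ : ∀ u v, ⟪ι u, (P - sInf S • ι) v⟫ = ⟪ι u, P v⟫ - sInf S * ⟪ι u, ι v⟫ := fun u v => by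
    rw [LinearMap.sub_apply, LinearMap.smul_apply, inner_sub_right, real_inner_smul_right]
  obtain ⟨C, hC, hcoer⟩ := coercive_of_solvable
    (fun u v => by rw [happ, happ, hsymm u v, real_inner_comm (ι u) (ι v)])
    (fun v => by
      rw [happ, real_inner_self_eq_norm_sq]
      by_cases hv : ι v = 0
      · simp [hv]
      · have := (le_div_iff₀ (hpos v hv)).1 (csInf_le hbdd ⟨v, hv, rfl⟩)
        linarith) hsolv
  have h1 : sInf S + 1 / C ≤ sInf S := by
    refine le_csInf hne ?_
    rintro _ ⟨v, hv, rfl⟩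
    have h2 := hcoer v
    rw [happ, real_inner_self_eq_norm_sq] at h2
    rw [le_div_iff₀ (hpos v hv), add_mul, div_mul_eq_mul_div, one_mul]
    have h3 : ‖ι v‖ ^ 2 / C ≤ ⟪ι v, P v⟫ - sInf S * ‖ι v‖ ^ 2 := by
      rw [div_le_iff₀ hC, mul_comm]; exact h2
    linarith
  have : 0 < 1 / C := by positivity
  linarith

end AbstractForm

/-! ### The conformal Laplacian in `L²` -/

section EuclideanLaplacian

variable {n : ℕ}

lemma hess_add (Γ : Eu n → Eu n →L[ℝ] Eu n →L[ℝ] Eu n) {f k : Eu n → ℝ} {y : Eu n}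
    (hf : ContDiffAt ℝ 2 f y) (hk : ContDiffAt ℝ 2 k y) (v w : Eu n) :
    hess Γ (f + k) y v w = hess Γ f y v w + hess Γ k y v w := by
  have h1 : fderiv ℝ (f + k) =ᶠ[𝓝 y] fun z => fderiv ℝ f z + fderiv ℝ k z := by
    filter_upwards [hf.eventually (by simp), hk.eventually (by simp)] with z hz hz'
    exact fderiv_add (hz.differentiableAt (by simp)) (hz'.differentiableAt (by simp))
  have h2 : DifferentiableAt ℝ (fderiv ℝ f) y :=
    (hf.fderiv_right (m := 1) (by norm_num)).differentiableAt (by simp)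
  have h3 : DifferentiableAt ℝ (fderiv ℝ k) y :=
    (hk.fderiv_right (m := 1) (by norm_num)).differentiableAt (by simp)
  rw [hess_apply, hess_apply, hess_apply, h1.fderiv_eq, h1.self_of_nhds, fderiv_fun_add h2 h3]
  simp only [add_apply]
  ring

lemma hess_const_smul (Γ : Eu n → Eu n →L[ℝ] Eu n →L[ℝ] Eu n) (c : ℝ) {f : Eu n → ℝ} {y : Eu n}
    (hf : ContDiffAt ℝ 2 f y) (v w : Eu n) : hess Γ (c • f) y v w = c * hess Γ f y v w := by
  have h1 : fderiv ℝ (c • f) =ᶠ[𝓝 y] fun z => c • fderiv ℝ f z := by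
    filter_upwards [hf.eventually (by simp)] with z hz
    exact fderiv_const_smul (hz.differentiableAt (by simp)) c
  have h2 : DifferentiableAt ℝ (fderiv ℝ f) y :=
    (hf.fderiv_right (m := 1) (by norm_num)).differentiableAt (by simp)
  rw [hess_apply, hess_apply, h1.fderiv_eq, h1.self_of_nhds, fderiv_fun_const_smul h2]
  simp only [smul_apply, smul_eq_mul]
  ring

end EuclideanLaplacian

section L2

open scoped RealInnerProductSpace

lemma inner_toLp {α : Type*} {m : MeasurableSpace α} {ν : Measure α} {u v : α → ℝ}
    (hu : MemLp u 2 ν) (hv : MemLp v 2 ν) :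
    ⟪hu.toLp u, hv.toLp v⟫ = ∫ x, u x * v x ∂ν := by
  rw [L2.inner_def]
  refine integral_congr_ae ?_
  filter_upwards [hu.coeFn_toLp, hv.coeFn_toLp] with x h1 h2
  rw [h1, h2]
  simp [mul_comm]

variable {n : ℕ} {M : Type*} [TopologicalSpace M] [ChartedSpace (Eu n) M]
  [IsManifold (𝓡 n) ∞ M]

lemma laplacian_add (g : Metric n M) {u v : M → ℝ} (hu : ContMDiff (𝓡 n) 𝓘(ℝ) ∞ u)
    (hv : ContMDiff (𝓡 n) 𝓘(ℝ) ∞ v) (x : M) :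
    laplacian g (u + v) x = laplacian g u x + laplacian g v x := by
  have hx := mem_extChartAt_source (I := 𝓡 n) x
  have hy := mem_extChartAt_target (I := 𝓡 n) x
  have h2 : (2 : WithTop ℕ∞) ≤ ∞ := by norm_cast
  rw [laplacian_eq g (hu.add hv) hx, laplacian_eq g hu hx, laplacian_eq g hv hx, lap, lap, lap,
    ← metricTrace_add]
  congr 1
  ext a c
  exact hess_add _ ((contDiffAt_comp_symm hu hy).of_le h2) ((contDiffAt_comp_symm hv hy).of_le h2)
    a c

lemma laplacian_const_smul (g : Metric n M) (c : ℝ) {u : M → ℝ}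
    (hu : ContMDiff (𝓡 n) 𝓘(ℝ) ∞ u) (x : M) :
    laplacian g (c • u) x = c * laplacian g u x := by
  have hx := mem_extChartAt_source (I := 𝓡 n) x
  have hy := mem_extChartAt_target (I := 𝓡 n) x
  have h2 : (2 : WithTop ℕ∞) ≤ ∞ := by norm_cast
  have hcu : ContMDiff (𝓡 n) 𝓘(ℝ) ∞ (c • u) := (contMDiff_const (c := c)).mul hu
  rw [laplacian_eq g hcu hx, laplacian_eq g hu hx, lap, lap, ← metricTrace_const_mul]
  congr 1
  ext a b
  exact hess_const_smul _ c ((contDiffAt_comp_symm hu hy).of_le h2) a b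

lemma confLaplacian_add (g : Metric n M) {u v : M → ℝ} (hu : ContMDiff (𝓡 n) 𝓘(ℝ) ∞ u)
    (hv : ContMDiff (𝓡 n) 𝓘(ℝ) ∞ v) :
    confLaplacian g (u + v) = confLaplacian g u + confLaplacian g v := by
  ext x
  simp only [confLaplacian, laplacian_add g hu hv, Pi.add_apply]
  ring

lemma confLaplacian_const_smul (g : Metric n M) (c : ℝ) {u : M → ℝ}
    (hu : ContMDiff (𝓡 n) 𝓘(ℝ) ∞ u) : confLaplacian g (c • u) = c • confLaplacian g u := by
  ext x
  simp only [confLaplacian, laplacian_const_smul g c hu, Pi.smul_apply, smul_eq_mul]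
  ring

lemma gradDot_comm (g : Metric n M) (u v : M → ℝ) (x : M) :
    gradDot g u v x = gradDot g v u x :=
  gradInner_comm (isScalarProduct_metricIn g x (mem_extChartAt_target x)) _ _

lemma gradSq_nonneg (g : Metric n M) (u : M → ℝ) (x : M) : 0 ≤ gradSq g u x := by
  have hs := isScalarProduct_metricIn g x (mem_extChartAt_target x)
  rw [gradSq_eq_gradDot, gradDot, gradInner, ← hs.apply_sharp]
  generalize sharp (metricIn g x (extChartAt (𝓡 n) x x))
      (fderiv ℝ (u ∘ (extChartAt (𝓡 n) x).symm) (extChartAt (𝓡 n) x x)) = w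
  rcases eq_or_ne w 0 with rfl | h
  · rw [map_zero]
  · exact (hs.pos w h).le

variable [MeasurableSpace M] [BorelSpace M] [CompactSpace M] [Nonempty M]

/-- The inclusion of the smooth functions in `L²(M, dv_g)`. -/
def smoothToL2 (g : Metric n M) : C^∞⟮𝓡 n, M; ℝ⟯ →ₗ[ℝ] Lp ℝ 2 (vol g) where
  toFun u := (memLp_of_continuous g u.contMDiff.continuous 2).toLp u
  map_add' _ _ := MemLp.toLp_add _ _
  map_smul' _ _ := MemLp.toLp_const_smul _ _

/-- The conformal Laplacian on smooth functions, with values in `L²(M, dv_g)`. -/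
def confLaplacianL2 (g : Metric n M) : C^∞⟮𝓡 n, M; ℝ⟯ →ₗ[ℝ] Lp ℝ 2 (vol g) where
  toFun u := (memLp_of_continuous g (confLaplacian_contMDiff g u.contMDiff).continuous 2).toLp
    (confLaplacian g u)
  map_add' u v := by
    rw [← MemLp.toLp_add]
    congr 1
    exact confLaplacian_add g u.contMDiff v.contMDiff
  map_smul' c u := by
    rw [RingHom.id_apply, ← MemLp.toLp_const_smul]
    congr 1
    exact confLaplacian_const_smul g c u.contMDiff

lemma confLaplacianL2_sub_smul_apply (g : Metric n M) (lam : ℝ) (v : C^∞⟮𝓡 n, M; ℝ⟯) :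
    ∃ h : MemLp (fun x => confLaplacian g v x - lam * v x) 2 (vol g),
      (confLaplacianL2 g - lam • smoothToL2 g) v = h.toLp _ :=
  ⟨(memLp_of_continuous g (confLaplacian_contMDiff g v.contMDiff).continuous 2).sub
    ((memLp_of_continuous g v.contMDiff.continuous 2).const_mul lam), rfl⟩

lemma norm_smoothToL2_sq (g : Metric n M) (v : C^∞⟮𝓡 n, M; ℝ⟯) :
    ‖smoothToL2 g v‖ ^ 2 = ∫ x, v x ^ 2 ∂(vol g) := by
  rw [← real_inner_self_eq_norm_sq, smoothToL2]
  simp only [LinearMap.coe_mk, AddHom.coe_mk, inner_toLp, sq]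

lemma inner_confLaplacianL2 (g : Metric n M) (u v : C^∞⟮𝓡 n, M; ℝ⟯) :
    ⟪smoothToL2 g u, confLaplacianL2 g v⟫ = ∫ x, u x * confLaplacian g v x ∂(vol g) :=
  inner_toLp (memLp_of_continuous g u.contMDiff.continuous 2)
    (memLp_of_continuous g (confLaplacian_contMDiff g v.contMDiff).continuous 2)

lemma inner_shifted (g : Metric n M) (lam : ℝ) (u v : C^∞⟮𝓡 n, M; ℝ⟯) :
    ⟪smoothToL2 g u, (confLaplacianL2 g - lam • smoothToL2 g) v⟫ =
      ⟪smoothToL2 g u, confLaplacianL2 g v⟫ - lam * ⟪smoothToL2 g u, smoothToL2 g v⟫ := by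
  rw [LinearMap.sub_apply, LinearMap.smul_apply, inner_sub_right, real_inner_smul_right]

section Green

variable [T2Space M]

lemma integral_mul_confLaplacian (g : Metric n M) {u v : M → ℝ}
    (hu : ContMDiff (𝓡 n) 𝓘(ℝ) ∞ u) (hv : ContMDiff (𝓡 n) 𝓘(ℝ) ∞ v) :
    ∫ x, u x * confLaplacian g v x ∂(vol g) = (∫ x, gradDot g u v x ∂(vol g)) +
      ∫ x, confConst n * scalarCurvature g x * (u x * v x) ∂(vol g) := by
  have h1 : Integrable (fun x => u x * laplacian g v x) (vol g) :=
    integrable_of_continuous g (hu.continuous.mul (laplacian_contMDiff g hv).continuous)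
  have h2 : Integrable (fun x => confConst n * scalarCurvature g x * (u x * v x)) (vol g) :=
    integrable_of_continuous g ((continuous_const.mul (scalarCurvature_contMDiff g).continuous).mul
      (hu.continuous.mul hv.continuous))
  have h3 := green g hu hv
  rw [← neg_eq_iff_eq_neg.2 h3, ← integral_neg, ← integral_add (by exact h1.neg) h2]
  refine integral_congr_ae (Filter.Eventually.of_forall fun x => ?_)
  simp only [confLaplacian]
  ring

lemma inner_confLaplacianL2_symm (g : Metric n M) (u v : C^∞⟮𝓡 n, M; ℝ⟯) :
    ⟪smoothToL2 g u, confLaplacianL2 g v⟫ = ⟪smoothToL2 g v, confLaplacianL2 g u⟫ := by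
  rw [inner_confLaplacianL2, inner_confLaplacianL2,
    integral_mul_confLaplacian g u.contMDiff v.contMDiff,
    integral_mul_confLaplacian g v.contMDiff u.contMDiff]
  simp only [gradDot_comm g u v, mul_comm (u _) (v _)]

lemma inner_shifted_symm (g : Metric n M) (lam : ℝ) (u v : C^∞⟮𝓡 n, M; ℝ⟯) :
    ⟪smoothToL2 g u, (confLaplacianL2 g - lam • smoothToL2 g) v⟫ =
      ⟪smoothToL2 g v, (confLaplacianL2 g - lam • smoothToL2 g) u⟫ := by
  rw [inner_shifted, inner_shifted, inner_confLaplacianL2_symm,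
    real_inner_comm (smoothToL2 g u) (smoothToL2 g v)]

/-- The quadratic form of the conformal Laplacian differs from the Dirichlet integral by a form
which is bounded in `L²`. -/
lemma exists_energy_bound (g : Metric n M) (lam : ℝ) : ∃ K, 0 ≤ K ∧ ∀ v : C^∞⟮𝓡 n, M; ℝ⟯,
    |⟪smoothToL2 g v, (confLaplacianL2 g - lam • smoothToL2 g) v⟫ - ∫ x, gradSq g v x ∂(vol g)|
      ≤ K * ‖smoothToL2 g v‖ ^ 2 := by
  have hc : Continuous fun x => confConst n * scalarCurvature g x - lam :=
    (continuous_const.mul (scalarCurvature_contMDiff g).continuous).sub continuous_const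
  obtain ⟨K, hK⟩ := isCompact_univ.exists_bound_of_continuousOn hc.continuousOn
  have hK0 : 0 ≤ K := (norm_nonneg _).trans (hK (Classical.arbitrary M) (Set.mem_univ _))
  refine ⟨K, hK0, fun v => ?_⟩
  have h1 : Integrable (fun x => confConst n * scalarCurvature g x * (v x * v x)) (vol g) :=
    integrable_of_continuous g ((continuous_const.mul (scalarCurvature_contMDiff g).continuous).mul
      (v.contMDiff.continuous.mul v.contMDiff.continuous))
  have h2 : Integrable (fun x => v x ^ 2) (vol g) :=
    integrable_of_continuous g (v.contMDiff.continuous.pow 2)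
  have h3 : ⟪smoothToL2 g v, (confLaplacianL2 g - lam • smoothToL2 g) v⟫ -
      ∫ x, gradSq g v x ∂(vol g) =
      ∫ x, (confConst n * scalarCurvature g x - lam) * v x ^ 2 ∂(vol g) := by
    rw [inner_shifted, inner_confLaplacianL2, integral_mul_confLaplacian g v.contMDiff v.contMDiff,
      real_inner_self_eq_norm_sq, norm_smoothToL2_sq]
    simp only [gradSq_eq_gradDot]
    rw [add_sub_assoc, add_sub_cancel_left, ← integral_const_mul,
      ← integral_sub h1 (h2.const_mul _)]
    refine integral_congr_ae (Filter.Eventually.of_forall fun x => ?_)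
    simp only
    ring
  rw [h3, norm_smoothToL2_sq, ← integral_const_mul, ← Real.norm_eq_abs]
  refine norm_integral_le_of_norm_le (h2.const_mul K) (Filter.Eventually.of_forall fun x => ?_)
  rw [norm_mul, Real.norm_of_nonneg (sq_nonneg (v x))]
  exact mul_le_mul_of_nonneg_right (hK x (Set.mem_univ x)) (sq_nonneg _)

end Green

end L2

/-! ### The first eigenvalue and Rayleigh quotients -/

section Spectrum

open scoped RealInnerProductSpace

variable {n : ℕ} {M : Type*} [TopologicalSpace M] [ChartedSpace (Eu n) M]
  [IsManifold (𝓡 n) ∞ M] [MeasurableSpace M] [BorelSpace M] [CompactSpace M] [Nonempty M]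
  [T2Space M]

/-- Sobolev approximation is approximation in the form norm: along sequences which converge in `L²`,
the Dirichlet integral and the quadratic form of `L_g - lam` are Cauchy at the same time. -/
lemma isFormApprox_iff {g : Metric n M} (lam : ℝ) {u : M → ℝ} (hu : MemLp u 2 (vol g))
    (φ : ℕ → C^∞⟮𝓡 n, M; ℝ⟯) :
    IsFormApprox (smoothToL2 g) (confLaplacianL2 g - lam • smoothToL2 g) (hu.toLp u) φ ↔
      IsW12Approx g u fun k => φ k := by
  have htend : Filter.Tendsto (fun k => smoothToL2 g (φ k)) Filter.atTop (𝓝 (hu.toLp u)) ↔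
      Filter.Tendsto (fun k => eLpNorm (⇑(φ k) - u) 2 (vol g)) Filter.atTop (𝓝 0) :=
    Lp.tendsto_Lp_iff_tendsto_eLpNorm'' (fun k => ⇑(φ k))
      (fun k => memLp_of_continuous g (φ k).contMDiff.continuous 2) u hu
  obtain ⟨K, hK0, hK⟩ := exists_energy_bound g lam
  have hsmall : Filter.Tendsto (fun k => smoothToL2 g (φ k)) Filter.atTop (𝓝 (hu.toLp u)) →
      ∀ ε > 0, ∃ N, ∀ k ≥ N, ∀ l ≥ N, K * ‖smoothToL2 g (φ k - φ l)‖ ^ 2 ≤ ε := by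
    intro h ε hε
    obtain ⟨N, hN⟩ := Metric.cauchySeq_iff.1 h.cauchySeq (Real.sqrt (ε / (K + 1)))
      (Real.sqrt_pos.2 (by positivity))
    refine ⟨N, fun k hk l hl => ?_⟩
    have h2 := hN k hk l hl
    rw [dist_eq_norm, ← map_sub] at h2
    have h3 := pow_le_pow_left₀ (norm_nonneg _) h2.le 2
    rw [Real.sq_sqrt (by positivity), le_div_iff₀ (by positivity)] at h3
    nlinarith [sq_nonneg ‖smoothToL2 g (φ k - φ l)‖]
  constructor
  · intro h
    refine ⟨hu, fun k => (φ k).contMDiff, htend.1 h.tendsto, fun ε hε => ?_⟩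
    obtain ⟨N, hN⟩ := h.cauchy (ε / 2) (by positivity)
    obtain ⟨N', hN'⟩ := hsmall h.tendsto (ε / 2) (by positivity)
    refine ⟨max N N', fun k hk l hl => ?_⟩
    have h1 := hN k (le_of_max_le_left hk) l (le_of_max_le_left hl)
    have h2 := hN' k (le_of_max_le_right hk) l (le_of_max_le_right hl)
    rw [← ContMDiffMap.coe_sub]
    linarith [(abs_le.1 (hK (φ k - φ l))).1]
  · intro h
    refine ⟨htend.2 h.tendsto, fun ε hε => ?_⟩
    obtain ⟨N, hN⟩ := h.cauchy (ε / 2) (by positivity)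
    obtain ⟨N', hN'⟩ := hsmall (htend.2 h.tendsto) (ε / 2) (by positivity)
    refine ⟨max N N', fun k hk l hl => ?_⟩
    have h1 := hN k (le_of_max_le_left hk) l (le_of_max_le_left hl)
    have h2 := hN' k (le_of_max_le_right hk) l (le_of_max_le_right hl)
    rw [← ContMDiffMap.coe_sub] at h1
    linarith [(abs_le.1 (hK (φ k - φ l))).2]

/-- Weak solutions on the manifold are the solutions of the abstract variational problem. -/
lemma isWeakSolution_iff (g : Metric n M) (lam : ℝ) {f u : M → ℝ} (hf : MemLp f 2 (vol g)) :
    IsWeakSolution g lam f u ↔ ∃ hu : MemLp u 2 (vol g),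
      IsFormSolution (smoothToL2 g) (confLaplacianL2 g - lam • smoothToL2 g) (hf.toLp f)
        (hu.toLp u) := by
  have key : ∀ (hu : MemLp u 2 (vol g)) (v : C^∞⟮𝓡 n, M; ℝ⟯),
      ⟪hu.toLp u, (confLaplacianL2 g - lam • smoothToL2 g) v⟫ = ⟪hf.toLp f, smoothToL2 g v⟫ ↔
      ∫ x, u x * (confLaplacian g v x - lam * v x) ∂(vol g) = ∫ x, f x * v x ∂(vol g) := by
    intro hu v
    obtain ⟨h, hv⟩ := confLaplacianL2_sub_smul_apply g lam v
    rw [hv, inner_toLp]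
    exact Eq.congr rfl (inner_toLp hf (memLp_of_continuous g v.contMDiff.continuous 2))
  constructor
  · rintro ⟨⟨φ, hφ⟩, h⟩
    exact ⟨hφ.memLp, ⟨fun k => ⟨φ k, hφ.smooth k⟩, (isFormApprox_iff lam hφ.memLp _).2 hφ⟩,
      fun v => (key hφ.memLp v).2 (h v v.contMDiff)⟩
  · rintro ⟨hu, ⟨φ, hφ⟩, h⟩
    exact ⟨⟨_, (isFormApprox_iff lam hu φ).1 hφ⟩, fun v hv => (key hu ⟨v, hv⟩).1 (h _)⟩

/-- A lower bound of the quadratic form is a lower bound of the spectrum. -/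
theorem le_of_mem_confSpectrum (g : Metric n M) {k : ℝ}
    (hk : ∀ v : C^∞⟮𝓡 n, M; ℝ⟯, k * ‖smoothToL2 g v‖ ^ 2 ≤ ⟪smoothToL2 g v, confLaplacianL2 g v⟫)
    {lam : ℝ} (hlam : lam ∈ confSpectrum g) : k ≤ lam := by
  by_contra! hlt
  refine hlam fun f hf => ?_
  have hsymm := inner_shifted_symm g lam
  have hc : 0 < k - lam := sub_pos.2 hlt
  have hcoer : ∀ v, (k - lam) * ‖smoothToL2 g v‖ ^ 2 ≤
      ⟪smoothToL2 g v, (confLaplacianL2 g - lam • smoothToL2 g) v⟫ := fun v => by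
    rw [inner_shifted, real_inner_self_eq_norm_sq]
    linarith [hk v]
  have hnn : ∀ v, 0 ≤ ⟪smoothToL2 g v, (confLaplacianL2 g - lam • smoothToL2 g) v⟫ := fun v =>
    (by positivity : 0 ≤ (k - lam) * ‖smoothToL2 g v‖ ^ 2).trans (hcoer v)
  obtain ⟨U, hU⟩ := exists_isFormSolution hsymm hc hcoer (hf.toLp f)
  refine ⟨U, (isWeakSolution_iff g lam hf).2 ⟨Lp.memLp U, by rwa [Lp.toLp_coeFn]⟩,
    fun u' hu' => ?_⟩
  obtain ⟨hm, ⟨ψ, hψ⟩, h'⟩ := (isWeakSolution_iff g lam hf).1 hu'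
  obtain ⟨⟨φ, hφ⟩, h⟩ := hU
  have h0 := (hψ.sub hsymm hnn hφ).eq_zero hsymm hc hcoer fun v => by
    rw [inner_sub_left, h, h', sub_self]
  rw [← sub_eq_zero.1 h0]
  exact hm.coeFn_toLp.symm

/-- A smooth function whose Rayleigh quotient is at most `a` forces a point of the spectrum
in `(-∞, a]`. -/
theorem exists_mem_confSpectrum_le (g : Metric n M) {k a : ℝ}
    (hk : ∀ v : C^∞⟮𝓡 n, M; ℝ⟯, k * ‖smoothToL2 g v‖ ^ 2 ≤ ⟪smoothToL2 g v, confLaplacianL2 g v⟫)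
    {w : C^∞⟮𝓡 n, M; ℝ⟯} (hw : smoothToL2 g w ≠ 0)
    (ha : ⟪smoothToL2 g w, confLaplacianL2 g w⟫ ≤ a * ‖smoothToL2 g w‖ ^ 2) :
    ∃ lam ∈ confSpectrum g, lam ≤ a := by
  obtain ⟨lam, hlam, hns⟩ := exists_not_solvable (inner_confLaplacianL2_symm g) hk hw ha
  refine ⟨lam, fun h => hns fun F => ?_, hlam⟩
  obtain ⟨u, hu, -⟩ := h F (Lp.memLp F)
  obtain ⟨hm, hsol⟩ := (isWeakSolution_iff g lam (Lp.memLp F)).1 hu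
  rw [Lp.toLp_coeFn] at hsol
  exact ⟨_, hsol⟩

lemma exists_rayleigh_lower_bound (g : Metric n M) : ∃ k : ℝ, ∀ v : C^∞⟮𝓡 n, M; ℝ⟯,
    k * ‖smoothToL2 g v‖ ^ 2 ≤ ⟪smoothToL2 g v, confLaplacianL2 g v⟫ := by
  obtain ⟨K, -, hK⟩ := exists_energy_bound g 0
  refine ⟨-K, fun v => ?_⟩
  have h1 := (abs_le.1 (hK v)).1
  rw [zero_smul, sub_zero] at h1
  have h2 : 0 ≤ ∫ x, gradSq g v x ∂(vol g) := integral_nonneg fun x => gradSq_nonneg g v x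
  linarith

/-- The first eigenvalue is bounded from above by Rayleigh quotients. -/
theorem firstEigenvalue_le (g : Metric n M) {a : ℝ} {w : C^∞⟮𝓡 n, M; ℝ⟯}
    (hw : smoothToL2 g w ≠ 0)
    (ha : ⟪smoothToL2 g w, confLaplacianL2 g w⟫ ≤ a * ‖smoothToL2 g w‖ ^ 2) :
    firstEigenvalue g ≤ a := by
  obtain ⟨k, hk⟩ := exists_rayleigh_lower_bound g
  obtain ⟨lam, hlam, hle⟩ := exists_mem_confSpectrum_le g hk hw ha
  exact (csInf_le ⟨k, fun _ h => le_of_mem_confSpectrum g hk h⟩ hlam).trans hle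

/-- A lower bound of all Rayleigh quotients is a lower bound of the first eigenvalue. The test
function `w` makes the spectrum nonempty, so that the infimum in `firstEigenvalue` is a true one. -/
theorem le_firstEigenvalue (g : Metric n M) {a : ℝ} {w : C^∞⟮𝓡 n, M; ℝ⟯}
    (hw : smoothToL2 g w ≠ 0)
    (hk : ∀ v : C^∞⟮𝓡 n, M; ℝ⟯, a * ‖smoothToL2 g v‖ ^ 2 ≤ ⟪smoothToL2 g v, confLaplacianL2 g v⟫) :
    a ≤ firstEigenvalue g := by
  have hsq : 0 < ‖smoothToL2 g w‖ ^ 2 := by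
    have := norm_pos_iff.2 hw
    positivity
  obtain ⟨lam, hlam, -⟩ := exists_mem_confSpectrum_le g hk hw (div_mul_cancel₀
    ⟪smoothToL2 g w, confLaplacianL2 g w⟫ hsq.ne').ge
  exact le_csInf ⟨lam, hlam⟩ fun _ h => le_of_mem_confSpectrum g hk h

end Spectrum

/-! ### Maximization in the conformal class -/

section ConformalClass

open scoped RealInnerProductSpace

variable {n : ℕ} {M : Type*} [TopologicalSpace M] [ChartedSpace (Eu n) M]
  [IsManifold (𝓡 n) ∞ M]

lemma confConst_pos (hn : 3 ≤ n) : 0 < confConst n := by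
  have h : (3 : ℝ) ≤ n := by exact_mod_cast hn
  exact div_pos (by linarith) (by linarith)

variable [MeasurableSpace M]

/-- The conformal factor of the maximal metric `(R_g / ∫ R_g) g`. -/
def maxFactor (g : Metric n M) (hR : ∀ x, scalarCurvature g x < 0)
    (hI : ∫ y, scalarCurvature g y ∂(vol g) < 0) : ConformalFactor n M where
  toFun x := (scalarCurvature g x / ∫ y, scalarCurvature g y ∂(vol g)) ^ (((n : ℝ) - 2) / 4)
  smooth x := by
    have h : ContDiffAt ℝ ∞ (fun t : ℝ => t ^ (((n : ℝ) - 2) / 4))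
        (scalarCurvature g x / ∫ y, scalarCurvature g y ∂(vol g)) :=
      contDiffAt_id.rpow_const_of_ne (div_pos_of_neg_of_neg (hR x) hI).ne'
    exact ContMDiffAt.comp x h.contMDiffAt ((scalarCurvature_contMDiff g).div_const _ x)
  pos x := Real.rpow_pos_of_pos (div_pos_of_neg_of_neg (hR x) hI) _

lemma maxFactor_rpow (hn : 3 ≤ n) (g : Metric n M) (hR : ∀ x, scalarCurvature g x < 0)
    (hI : ∫ y, scalarCurvature g y ∂(vol g) < 0) (x : M) :
    (maxFactor g hR hI).toFun x ^ (4 / ((n : ℝ) - 2)) =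
      scalarCurvature g x / ∫ y, scalarCurvature g y ∂(vol g) := by
  have h : (n : ℝ) - 2 ≠ 0 := by
    have h3 : (3 : ℝ) ≤ n := by exact_mod_cast hn
    linarith
  rw [maxFactor, ← Real.rpow_mul (div_pos_of_neg_of_neg (hR x) hI).le,
    div_mul_div_cancel₀' h, div_self four_ne_zero, Real.rpow_one]

variable [BorelSpace M] [CompactSpace M] [Nonempty M]

lemma integral_pos_of_continuous (g : Metric n M) {F : M → ℝ} (hF : Continuous F)
    (hpos : ∀ x, 0 < F x) : 0 < ∫ x, F x ∂(vol g) := by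
  rw [integral_pos_iff_support_of_nonneg (fun x => (hpos x).le) (integrable_of_continuous g hF)]
  have : Function.support F = Set.univ := Set.eq_univ_of_forall fun x => (hpos x).ne'
  rw [this]
  exact vol_univ_pos g

lemma norm_smoothToL2_conformal_sq (hn : 3 ≤ n) (g : Metric n M) (μ : ConformalFactor n M)
    (v : C^∞⟮𝓡 n, M; ℝ⟯) : ‖smoothToL2 (conformal g μ) v‖ ^ 2 =
      ∫ x, μ.toFun x ^ (4 / ((n : ℝ) - 2)) * (μ.toFun x * v x) ^ 2 ∂(vol g) := by
  rw [norm_smoothToL2_sq, integral_vol_conformal hn]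
  refine integral_congr_ae (Filter.Eventually.of_forall fun x => ?_)
  simp only
  ring

/-- The conformal invariance of the quadratic form of the conformal Laplacian. -/
lemma inner_confLaplacianL2_conformal (hn : 3 ≤ n) (g : Metric n M) (μ : ConformalFactor n M)
    (v : C^∞⟮𝓡 n, M; ℝ⟯) :
    ⟪smoothToL2 (conformal g μ) v, confLaplacianL2 (conformal g μ) v⟫ =
      ∫ x, (μ.toFun x * v x) * confLaplacian g (fun z => μ.toFun z * v z) x ∂(vol g) := by
  rw [inner_confLaplacianL2, integral_vol_conformal hn]
  refine integral_congr_ae (Filter.Eventually.of_forall fun x => ?_)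
  simp only [← confLaplacian_conformal hn g μ v.contMDiff]
  ring

/-- The reciprocal of the conformal factor, the test function which gives the upper bound. -/
def ConformalFactor.inv (μ : ConformalFactor n M) : C^∞⟮𝓡 n, M; ℝ⟯ :=
  ⟨fun x => (μ.toFun x)⁻¹, μ.smooth.inv₀ fun x => (μ.pos x).ne'⟩

lemma norm_smoothToL2_inv_sq (hn : 3 ≤ n) (g : Metric n M) (μ : ConformalFactor n M) :
    ‖smoothToL2 (conformal g μ) μ.inv‖ ^ 2 =
      ∫ x, μ.toFun x ^ (4 / ((n : ℝ) - 2)) ∂(vol g) := by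
  rw [norm_smoothToL2_conformal_sq hn]
  refine integral_congr_ae (Filter.Eventually.of_forall fun x => ?_)
  have h : μ.toFun x * μ.inv x = 1 := mul_inv_cancel₀ (μ.pos x).ne'
  simp only [h, one_pow, mul_one]

lemma integral_conformalFactor_pos (g : Metric n M) (μ : ConformalFactor n M) :
    0 < ∫ x, μ.toFun x ^ (4 / ((n : ℝ) - 2)) ∂(vol g) :=
  integral_pos_of_continuous g (conformalFactor_rpow_continuous μ _)
    fun x => Real.rpow_pos_of_pos (μ.pos x) _

lemma smoothToL2_inv_ne_zero (hn : 3 ≤ n) (g : Metric n M) (μ : ConformalFactor n M) :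
    smoothToL2 (conformal g μ) μ.inv ≠ 0 := by
  intro h
  have h1 := norm_smoothToL2_inv_sq hn g μ
  rw [h, norm_zero, zero_pow two_ne_zero] at h1
  exact (integral_conformalFactor_pos g μ).ne h1

variable [T2Space M]

lemma inner_confLaplacianL2_inv (hn : 3 ≤ n) (g : Metric n M) (μ : ConformalFactor n M) :
    ⟪smoothToL2 (conformal g μ) μ.inv, confLaplacianL2 (conformal g μ) μ.inv⟫ =
      confConst n * ∫ x, scalarCurvature g x ∂(vol g) := by
  have h : (fun x => μ.toFun x * μ.inv x) = fun _ => 1 :=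
    funext fun x => mul_inv_cancel₀ (μ.pos x).ne'
  have h' : ∀ x, μ.toFun x * μ.inv x = 1 := congrFun h
  have hgrad : ∀ x, gradDot g (fun _ : M => (1 : ℝ)) (fun _ => 1) x = 0 := fun x => by
    have h0 : (fun _ : M => (1 : ℝ)) ∘ (extChartAt (𝓡 n) x).symm = fun _ => 1 := rfl
    rw [gradDot, gradInner, h0, fderiv_const_apply]
    rfl
  rw [inner_confLaplacianL2_conformal hn, h]
  simp only [h']
  rw [integral_mul_confLaplacian g contMDiff_const contMDiff_const]
  simp only [hgrad, integral_zero, zero_add, mul_one, integral_const_mul]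

/-- The upper bound: the test function `μ⁻¹` for `L` of the metric `μ^{4/(n-2)} g` bounds
`F_g^1` by `c_n ∫ R_g`. -/
theorem functionalF_le (hn : 3 ≤ n) (g : Metric n M) (μ : ConformalFactor n M) :
    functionalF g μ ≤ confConst n * ∫ x, scalarCurvature g x ∂(vol g) := by
  have hI := integral_conformalFactor_pos g μ
  rw [functionalF, ← le_div_iff₀ hI]
  refine firstEigenvalue_le _ (smoothToL2_inv_ne_zero hn g μ) ?_
  rw [inner_confLaplacianL2_inv hn, norm_smoothToL2_inv_sq hn, div_mul_cancel₀ _ hI.ne']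

/-- Equality in the upper bound when the conformal metric is proportional to `R_g g`: then the
zeroth-order part of the quadratic form is a multiple of the `L²` norm. -/
theorem functionalF_eq (hn : 3 ≤ n) (g : Metric n M) (μ : ConformalFactor n M)
    (hR : ∀ x, μ.toFun x ^ (4 / ((n : ℝ) - 2)) =
      scalarCurvature g x / ∫ y, scalarCurvature g y ∂(vol g)) :
    functionalF g μ = confConst n * ∫ x, scalarCurvature g x ∂(vol g) := by
  refine le_antisymm (functionalF_le hn g μ) ?_
  have hpos := integral_conformalFactor_pos g μ
  have hI : ∫ y, scalarCurvature g y ∂(vol g) ≠ 0 := by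
    intro h
    simp only [hR, h, div_zero, integral_zero, lt_self_iff_false] at hpos
  have hone : ∫ x, μ.toFun x ^ (4 / ((n : ℝ) - 2)) ∂(vol g) = 1 := by
    simp only [hR]
    rw [integral_div, div_self hI]
  rw [functionalF, hone, mul_one]
  refine le_firstEigenvalue _ (smoothToL2_inv_ne_zero hn g μ) fun v => ?_
  have hv : ContMDiff (𝓡 n) 𝓘(ℝ) ∞ fun z => μ.toFun z * v z := μ.smooth.mul v.contMDiff
  rw [norm_smoothToL2_conformal_sq hn, inner_confLaplacianL2_conformal hn,
    integral_mul_confLaplacian g hv hv, ← integral_const_mul]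
  have h1 : 0 ≤ ∫ x, gradDot g (fun z => μ.toFun z * v z) (fun z => μ.toFun z * v z) x ∂(vol g) :=
    integral_nonneg fun x => by
      rw [← gradSq_eq_gradDot]
      exact gradSq_nonneg g _ x
  refine le_trans (le_of_eq ?_) (le_add_of_nonneg_left h1)
  refine integral_congr_ae (Filter.Eventually.of_forall fun x => ?_)
  simp only [hR]
  field_simp

end ConformalClass

end ConfLap

end

theorem theorem3 {n : ℕ} (hn : 3 ≤ n)
    {M : Type*} [TopologicalSpace M] [ChartedSpace (ConfLap.Eu n) M] [IsManifold (𝓡 n) ∞ M]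
    [T2Space M] [CompactSpace M] [Nonempty M] [MeasurableSpace M] [BorelSpace M]
    (g : ConfLap.Metric n M) (hY : ConfLap.yamabeInvariant g < 0)
    (hR : ∀ x : M, ConfLap.scalarCurvature g x < 0) :
    ∃ μmax : ConfLap.ConformalFactor n M,
      (∀ (x : M) (v w : TangentSpace (𝓡 n) x),
        (ConfLap.conformal g μmax).inner x v w =
          (ConfLap.scalarCurvature g x / ∫ y, ConfLap.scalarCurvature g y ∂(ConfLap.vol g)) *
            g.inner x v w) ∧
      IsGreatest (Set.range (ConfLap.functionalF g)) (ConfLap.functionalF g μmax) ∧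
      ConfLap.functionalF g μmax = ConfLap.supF g ∧
      ConfLap.supF g =
        ConfLap.confConst n * ∫ y, ConfLap.scalarCurvature g y ∂(ConfLap.vol g) ∧
      ConfLap.supF g < 0 := by
  have hI : ∫ y, ConfLap.scalarCurvature g y ∂(ConfLap.vol g) < 0 := by
    have h := ConfLap.integral_pos_of_continuous g
      (ConfLap.scalarCurvature_contMDiff g).continuous.neg fun x => neg_pos.2 (hR x)
    rwa [MeasureTheory.integral_neg', neg_pos] at h
  have hpow := ConfLap.maxFactor_rpow hn g hR hI
  have hF := ConfLap.functionalF_eq hn g _ hpow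
  have hgreat : IsGreatest (Set.range (ConfLap.functionalF g))
      (ConfLap.functionalF g (ConfLap.maxFactor g hR hI)) := by
    refine ⟨Set.mem_range_self _, ?_⟩
    rintro _ ⟨μ, rfl⟩
    rw [hF]
    exact ConfLap.functionalF_le hn g μ
  have hsup : ConfLap.functionalF g (ConfLap.maxFactor g hR hI) = ConfLap.supF g :=
    hgreat.csSup_eq.symm
  refine ⟨ConfLap.maxFactor g hR hI, fun x v w => ?_, hgreat, hsup, hsup.symm.trans hF, ?_⟩
  · rw [← hpow x]
    rfl
  · rw [← hsup, hF]
    exact mul_neg_of_pos_of_neg (ConfLap.confConst_pos hn) hI
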